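/- **Setting.** Let $m\ge 2$, $n,r\ge 0$ be integers. A *monotone norm* on $\mathbb R^d$ is a norm $N$ with $N(x)\le N(y)$ whenever $0\le x\le y$ coordinatewise. Fix monotone norms $\|\cdot\|_1,\dots,\|\cdot\|_m$ on $\mathbb R^{nr}$ (inner norms) and a function $f:\mathbb R^m\to\mathbb R$. In the online problem Sched-Pack$_{f,\{\|\cdot\|_i\}}$ a budget $B\ge 0$ is given, and jobs $j=1,\dots,n$ arrive one at a time; on arrival, job $j$ reveals loads $p_{ijk}\in\mathbb R_{\ge 0}$ ($i\in[m]$, $k\in[r]$), and one must irrevocably leave it unscheduled or schedule it on one machine $i$ in one way $k$. With $x_{ijk}\in\{0,1\}$ the indicator that $j$ is scheduled on $i$ in way $k$ (so $\sum_{i,k}x_{ijk}\le 1$), let $\Lambda_i(x)=\|(x_{ijk}p_{ijk})_{j,k}\|_i$. The aim is to maximize the number $\sum_{i,j,k}x_{ijk}$ of scheduled jobs subject to $f(\Lambda(x))\le B$; $\mathrm{OPT}$ denotes the offline maximum. The problem Norm-Pack$_{\|\cdot\|_i}$ is the special case of one machine with norm $\|\cdot\|_i$ and $f$ the identity. For $\alpha\in[0,1]$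 and $c\ge 1$ such a problem (with $f$ and the inner norms fixed and known) is *$(\alpha,c)$-solvable* if there is a randomized online algorithm, which is given $B$ and a number $M\in\mathbb R$ up front, such that for every $B$, every $M$ and all loads $p$ its solution always satisfies $f(\Lambda(x))\le cB$, and, if $M\le\mathrm{OPT}$, the expected number of jobs it schedules is at least $\alpha M$. **Theorem.** There are universal constants $\kappa>0$ and $C\ge 1$ such that the following holds for all $m\ge2$, $n$, $r$, all monotone inner norms $\|\cdot\|_1,\dots,\|\cdot\|_m$ on $\mathbb R^{nr}$ and all $\alpha\in[0,1]$, $c\ge 1$ for which every Norm-Pack$_{\|\cdot\|_i}$, $i\in[m]$, is $(\alpha,c)$-solvable. Let $w_1,\dots,w_m>0$ be arbitrary weights, and for a norm $g$ on $\mathbb R^m$ let $g_w(y)=g(w_1y_1,\dots,w_my_m)$ (the choice $w\equiv 1$ gives $g$ itself). 1. If $g$ is a monotone norm on $\mathbb R^m$ that is symmetric (invariant under permutations of the coordinates), then Sched-Pack$_{g_w,\{\|\cdot\|_i\}}$ is $\left(\kappa\,\dfrac{\alpha}{\log^2 m},\ C\,c\right)$-solvable. 2. If $g$ is the $\ell_p$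 norm for some $p\in[1,\infty]$, or the Top-$k$ norm for some $1\le k\le m$ (the sum of the $k$ largest absolute values of the coordinates), then Sched-Pack$_{g_w,\{\|\cdot\|_i\}}$ is $\left(\kappa\,\dfrac{\alpha}{\log m},\ C\,c\right)$-solvable. -/

import Mathlib

open MeasureTheory
open scoped NNReal ENNReal

namespace SchedPack

/-- `N` is a norm on `ℝ^ι` that is monotone on the nonnegative orthant. -/
structure IsMonotoneNorm {ι : Type} (N : (ι → ℝ) → ℝ) : Prop where
  add_le : ∀ x y, N (x + y) ≤ N x + N y
  smul : ∀ (t : ℝ) x, N (t • x) = |t| * N x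
  eq_zero : ∀ x, N x = 0 → x = 0
  mono : ∀ x y, 0 ≤ x → x ≤ y → N x ≤ N y

/-- Invariance under all permutations of the coordinates. -/
def IsSymmetric {m : ℕ} (g : (Fin m → ℝ) → ℝ) : Prop :=
  ∀ (σ : Equiv.Perm (Fin m)) (x : Fin m → ℝ), g (fun i => x (σ i)) = g x

/-- The weighted version `y ↦ g (w₁ y₁, …, wₘ yₘ)` of `g`. -/
def weighted {m : ℕ} (w : Fin m → ℝ) (g : (Fin m → ℝ) → ℝ) : (Fin m → ℝ) → ℝ :=
  fun y => g (fun i => w i * y i)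

/-- The `ℓ_p` norm on `ℝ^m`, for `1 ≤ p ≤ ∞`. -/
noncomputable def ellpNorm {m : ℕ} (p : ℝ≥0∞) (y : Fin m → ℝ) : ℝ :=
  ‖(WithLp.toLp p y : PiLp p (fun _ : Fin m => ℝ))‖

/-- The Top-`k` norm: the sum of the `k` largest absolute values of coordinates, that is,
the maximum of `∑ i ∈ S, |y i|` over sets `S` of at most `k` coordinates. -/
noncomputable def topKNorm {m : ℕ} (k : ℕ) (y : Fin m → ℝ) : ℝ :=
  ⨆ S : {S : Finset (Fin m) // S.card ≤ k}, ∑ i ∈ S.1, |y i|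

/-- Loads: `p j i k` is incurred when job `j` is scheduled on machine `i` in way `k`.
Job `j` arrives at time `j` and then reveals the whole table `p j`. -/
abbrev Loads (m n r : ℕ) : Type := Fin n → Fin m → Fin r → ℝ≥0

/-- Partial allocations: `a j = some (i, k)` if job `j` is scheduled on machine `i` in way `k`,
and `a j = none` if job `j` is not scheduled. -/
abbrev Alloc (m n r : ℕ) : Type := Fin n → Option (Fin m × Fin r)

/-- The indicator `x_{ijk}` of a partial allocation. -/
def Alloc.x {m n r : ℕ} (a : Alloc m n r) (i : Fin m) (j : Fin n) (k : Fin r) : ℝ :=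
  if a j = some (i, k) then 1 else 0

/-- The number of scheduled jobs. -/
def Alloc.count {m n r : ℕ} (a : Alloc m n r) : ℕ :=
  (Finset.univ.filter fun j => (a j).isSome = true).card

/-- The load vector `Λ_i = ‖(x_{ijk} p_{ijk})_{j,k}‖_i`. -/
def machineLoad {m n r : ℕ} (N : Fin m → (Fin n × Fin r → ℝ) → ℝ) (p : Loads m n r)
    (a : Alloc m n r) : Fin m → ℝ :=
  fun i => N i (fun jk => a.x i jk.1 jk.2 * (p jk.1 i jk.2 : ℝ))

open Classical in
/-- The offline optimum: the maximum number of jobs scheduled by a partial allocation whose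
aggregate load is at most `B`. -/
noncomputable def opt {m n r : ℕ} (f : (Fin m → ℝ) → ℝ)
    (N : Fin m → (Fin n × Fin r → ℝ) → ℝ) (B : ℝ≥0) (p : Loads m n r) : ℕ :=
  (Finset.univ.filter fun a : Alloc m n r => f (machineLoad N p a) ≤ B).sup Alloc.count

/-- Randomized online algorithms: a random seed `ω` is drawn at the beginning, and the (irrevocable)
decision on job `j` is a function of the seed and of the loads of the jobs that arrived up to `j`. -/
structure OnlineAlg (m n r : ℕ) where
  Ω : Type
  [measurableSpace : MeasurableSpace Ω]
  μ : Measure Ω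
  [isProb : IsProbabilityMeasure μ]
  run : Ω → Loads m n r → Alloc m n r
  online : ∀ (ω : Ω) (p p' : Loads m n r) (j : Fin n),
    (∀ j' ≤ j, p j' = p' j') → run ω p j = run ω p' j
  measurable_run : ∀ (p : Loads m n r) (a : Alloc m n r), MeasurableSet {ω | run ω p = a}

attribute [instance] OnlineAlg.measurableSpace OnlineAlg.isProb

/-- The expected number of jobs scheduled on input `p`. -/
noncomputable def OnlineAlg.expectedCount {m n r : ℕ} (A : OnlineAlg m n r)
    (p : Loads m n r) : ℝ :=
  ∫ ω, ((A.run ω p).count : ℝ) ∂A.μ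

/-- `(α, c)`-solvability of the online Schedule-Packing problem with aggregate function `f` and
machine norms `N i`. The algorithm knows `f`, `N`, the budget `B` and the number `M` up front. It
always has aggregate load at most `c * B`, and in expectation it schedules at least `α * M` jobs
whenever `M` is a lower bound on the offline optimum. -/
def SchedPackSolvable {m n r : ℕ} (f : (Fin m → ℝ) → ℝ)
    (N : Fin m → (Fin n × Fin r → ℝ) → ℝ) (α c : ℝ) : Prop :=
  0 ≤ α ∧ α ≤ 1 ∧ 1 ≤ c ∧
    ∀ (B : ℝ≥0) (M : ℝ), ∃ A : OnlineAlg m n r,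
      (∀ (p : Loads m n r) (ω : A.Ω), f (machineLoad N p (A.run ω p)) ≤ c * B) ∧
      (∀ p : Loads m n r, M ≤ opt f N B p → α * M ≤ A.expectedCount p)

/-- `(α, c)`-solvability of Norm-Packing: Schedule-Packing on one machine, with the identity as
aggregate function. -/
def NormPackSolvable {n r : ℕ} (N : (Fin n × Fin r → ℝ) → ℝ) (α c : ℝ) : Prop :=
  SchedPackSolvable (m := 1) (fun y => y 0) (fun _ => N) α c

end SchedPack

namespace SchedPack

/-! ### Finite-valued random variables -/

/-! For every machine and every budget in a geometric sequence of about `log m` scales, keep one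
copy of the Norm-Pack solver, a packer. A packer is closed at first. It opens when the jobs that
have arrived and are not taken by packers opened earlier contain enough that it could pack, provided
that the norm still has room for its budget. From then on it is offered the jobs that the earlier
packers refuse. The total load of the open packers is bounded by the admission rule `ok` alone, so
the work is in the expected number of jobs.

Two points make black-box solvers usable. A withheld job is shown to the solver with a load that no
solution within its guarantee can contain (`mem_of_maskLoad_le`). And the set offered to a packer
depends on the other seeds and on its own threshold, but not on its internal randomness
(`Ensemble.final_update`), so the guarantee for fixed inputs applies conditionally.

The threshold of `v` is a random multiple of a quota `q v`, larger multiples having geometrically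
larger probability. If `v` opens at one multiple, then at the next smaller one it also opens, no
later, and is still offered about `q v` packable jobs. Shifting the threshold by one step costs only
a factor 2 in probability. So, up to an exponentially small penalty, an open packer gains a constant
times `α * q v` on average (`Ensemble.opening_pays`).

Now fix a good allocation and assign to each machine `i` a packer `v` whose budget covers the load
there. In every run one of three things happens: half of the jobs on `i` are taken by someone; or
`v` is open and is offered a constant fraction of them, from which it packs a share `α / log m`, the
logarithm paying for not knowing the scale of their number (`Ensemble.open_packer_gain`); or `v` is
blocked by the admission rule, and then the quotas of the open packers pay for it
(`Ensemble.expected_bound`).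

For `ℓ_p` and Top-`k` the constraint `g ≤ 1` is, up to constants, a budget `∑ i, H (y i) ≤ 1`. The
admission rule bounds the total cost and quotas are proportional to cost, so any blocking means that
quotas worth the whole optimum are already open (`solvable_of_additive`). For a general symmetric
norm the rule is a cap on the number of open packers at each level, taken from a guessed profile of
the optimum. A minimax argument gives a distribution on profiles whose expected coverage of every
profile is at least the reciprocal of twice the number of levels; this costs the second logarithm
(`exists_mixed_profile`). -/

lemma integrable_comp_finite {Ω σ : Type} [MeasurableSpace Ω] (μ : Measure Ω) [IsFiniteMeasure μ]
    [Finite σ] (X : Ω → σ) (hX : ∀ s, MeasurableSet {ω | X ω = s}) (φ : σ → ℝ) :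
    Integrable (fun ω => φ (X ω)) μ := by
  classical
  have := Fintype.ofFinite σ
  have h : (fun ω => φ (X ω)) = fun ω => ∑ s, Set.indicator {ω | X ω = s} (fun _ => φ s) ω := by
    funext ω
    simp [Set.indicator_apply]
  rw [h]
  exact integrable_finsetSum _ fun s _ => (integrable_const _).indicator (hX s)

lemma measurable_comp_finite {Ω σ : Type} [MeasurableSpace Ω]
    [Finite σ] (X : Ω → σ) (hX : ∀ s, MeasurableSet {ω | X ω = s}) (φ : σ → ℝ) :
    Measurable (fun ω => φ (X ω)) := by
  classical
  have := Fintype.ofFinite σ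
  have h : (fun ω => φ (X ω)) = fun ω => ∑ s, Set.indicator {ω | X ω = s} (fun _ => φ s) ω := by
    funext ω
    simp [Set.indicator_apply]
  rw [h]
  exact Finset.measurable_sum _ fun s _ => measurable_const.indicator (hX s)

/-- An inequality of integrals may be checked by integrating over one coordinate only. -/
lemma integral_pi_le_of_update {V : Type} [Fintype V] [DecidableEq V] {Ω : V → Type}
    [∀ v, MeasurableSpace (Ω v)] (μ : ∀ v, Measure (Ω v)) [∀ v, IsProbabilityMeasure (μ v)]
    (v : V) (f g : (∀ v, Ω v) → ℝ) (hf : Measurable f) (hg : Measurable g)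
    (hf0 : 0 ≤ f) (hg0 : 0 ≤ g) (hfi : Integrable f (Measure.pi μ))
    (hgi : Integrable g (Measure.pi μ))
    (hf' : ∀ x, Integrable (fun y => f (Function.update x v y)) (μ v))
    (hg' : ∀ x, Integrable (fun y => g (Function.update x v y)) (μ v))
    (h : ∀ x, ∫ y, f (Function.update x v y) ∂μ v ≤ ∫ y, g (Function.update x v y) ∂μ v) :
    ∫ x, f x ∂Measure.pi μ ≤ ∫ x, g x ∂Measure.pi μ := by
  -- Nonnegativity permits the passage to lower integrals, where integration over a single
  -- coordinate is `lmarginal`.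
  have key : ∫⁻ x, ENNReal.ofReal (f x) ∂Measure.pi μ ≤ ∫⁻ x, ENNReal.ofReal (g x) ∂Measure.pi μ := by
    refine lintegral_le_of_lmarginal_le {v} hf.ennreal_ofReal hg.ennreal_ofReal ?_
    rw [lmarginal_singleton, lmarginal_singleton]
    intro x
    change ∫⁻ y, ENNReal.ofReal (f (Function.update x v y)) ∂μ v ≤
      ∫⁻ y, ENNReal.ofReal (g (Function.update x v y)) ∂μ v
    rw [← ofReal_integral_eq_lintegral_ofReal (hf' x) (Filter.Eventually.of_forall fun y => hf0 _),
      ← ofReal_integral_eq_lintegral_ofReal (hg' x) (Filter.Eventually.of_forall fun y => hg0 _)]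
    exact ENNReal.ofReal_le_ofReal (h x)
  rw [← ofReal_integral_eq_lintegral_ofReal hfi (Filter.Eventually.of_forall hf0),
    ← ofReal_integral_eq_lintegral_ofReal hgi (Filter.Eventually.of_forall hg0)] at key
  exact (ENNReal.ofReal_le_ofReal_iff (integral_nonneg hg0)).1 key

/-! ### Mixtures of online algorithms -/

/-- The seed space is the disjoint union of the given ones, with weighted measures. Each run is a
run of some `A i`, so guarantees that hold in every run survive mixing. -/
lemma exists_mixture {ι : Type} [Fintype ι] {m n r : ℕ} (w : ι → ℝ) (hw : ∀ i, 0 ≤ w i)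
    (hw1 : ∑ i, w i = 1) (A : ι → OnlineAlg m n r) :
    ∃ A' : OnlineAlg m n r, (∀ ω', ∃ i ω, ∀ p, A'.run ω' p = (A i).run ω p) ∧
      ∀ p, A'.expectedCount p = ∑ i, w i * (A i).expectedCount p := by
  have hmk : ∀ i, Measurable (@Sigma.mk ι (fun i => (A i).Ω) i) := fun i s hs =>
    MeasurableSpace.measurableSet_iInf.1 hs i
  let μ : Measure (Σ i, (A i).Ω) :=
    ∑ i, ENNReal.ofReal (w i) • (A i).μ.map (@Sigma.mk ι (fun i => (A i).Ω) i)
  have hμ : IsProbabilityMeasure μ := by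
    constructor
    have : ∀ i, ((A i).μ.map (@Sigma.mk ι (fun i => (A i).Ω) i)) Set.univ = 1 := fun i => by
      rw [Measure.map_apply (hmk i) MeasurableSet.univ]; simp
    simp only [μ, Measure.coe_finsetSum, Finset.sum_apply, Measure.smul_apply, this, smul_eq_mul,
      mul_one]
    rw [← ENNReal.ofReal_sum_of_nonneg fun i _ => hw i, hw1, ENNReal.ofReal_one]
  have hmeas : ∀ (p : Loads m n r) (a : Alloc m n r),
      MeasurableSet {x : Σ i, (A i).Ω | (A x.1).run x.2 p = a} := fun p a =>
    MeasurableSpace.measurableSet_iInf.2 fun i => (A i).measurable_run p a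
  refine ⟨⟨Σ i, (A i).Ω, μ, fun x p => (A x.1).run x.2 p, fun x => (A x.1).online x.2, hmeas⟩,
    fun x => ⟨x.1, x.2, fun p => rfl⟩, fun p => ?_⟩
  have hint : ∀ ν : Measure (Σ i, (A i).Ω), IsFiniteMeasure ν →
      Integrable (fun x : Σ i, (A i).Ω => (((A x.1).run x.2 p).count : ℝ)) ν := fun ν _ =>
    integrable_comp_finite ν (fun x : Σ i, (A i).Ω => (A x.1).run x.2 p) (hmeas p)
      fun a => (a.count : ℝ)
  have hfin : ∀ i, IsFiniteMeasure (ENNReal.ofReal (w i) •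
      (A i).μ.map (@Sigma.mk ι (fun i => (A i).Ω) i)) := fun i =>
    Measure.smul_finite _ ENNReal.ofReal_ne_top
  unfold OnlineAlg.expectedCount
  simp only [μ]
  rw [integral_finsetSum_measure fun i _ => hint _ (hfin i)]
  refine Finset.sum_congr rfl fun i _ => ?_
  rw [integral_smul_measure, ENNReal.toReal_ofReal (hw i), integral_map (hmk i).aemeasurable]
  · rfl
  · exact (hint _ inferInstance).aestronglyMeasurable

/-! ### Packing on one machine -/

/-- A selection of jobs on one machine, together with the ways of scheduling them. -/
abbrev Sel (n r : ℕ) : Type := Fin n → Option (Fin r)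

/-- The number of selected jobs. -/
def Sel.count {n r : ℕ} (a : Sel n r) : ℕ := (Finset.univ.filter fun j => (a j).isSome = true).card

/-- The load of a selection. -/
def selLoad {n r : ℕ} (N : (Fin n × Fin r → ℝ) → ℝ) (p : Fin n → Fin r → ℝ≥0) (a : Sel n r) : ℝ :=
  N fun jk => (if a jk.1 = some jk.2 then 1 else 0) * (p jk.1 jk.2 : ℝ)

open Classical in
/-- The largest number of jobs of `D` that can be packed with load at most `b`. -/
noncomputable def packOpt {n r : ℕ} (N : (Fin n × Fin r → ℝ) → ℝ) (b : ℝ≥0)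
    (p : Fin n → Fin r → ℝ≥0) (D : Finset (Fin n)) : ℕ :=
  (Finset.univ.filter fun a : Sel n r => (∀ j, a j ≠ none → j ∈ D) ∧ selLoad N p a ≤ b).sup Sel.count

namespace IsMonotoneNorm

variable {ι : Type} {N : (ι → ℝ) → ℝ}

lemma zero (hN : IsMonotoneNorm N) : N 0 = 0 := by
  simpa using hN.smul 0 0

lemma nonneg (hN : IsMonotoneNorm N) (x : ι → ℝ) : 0 ≤ N x := by
  have h := hN.add_le x ((-1 : ℝ) • x)
  rw [hN.smul, show x + (-1 : ℝ) • x = 0 by simp, hN.zero] at h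
  norm_num at h
  exact h

lemma smul_of_nonneg (hN : IsMonotoneNorm N) {t : ℝ} (ht : 0 ≤ t) (x : ι → ℝ) :
    N (t • x) = t * N x := by rw [hN.smul, abs_of_nonneg ht]

lemma sum_le (hN : IsMonotoneNorm N) {κ : Type} (s : Finset κ) (x : κ → ι → ℝ) :
    N (∑ k ∈ s, x k) ≤ ∑ k ∈ s, N (x k) := by
  classical
  induction s using Finset.induction_on with
  | empty => simp [hN.zero]
  | insert a s ha ih =>
    rw [Finset.sum_insert ha, Finset.sum_insert ha]
    exact (hN.add_le _ _).trans (by linarith)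

lemma pos (hN : IsMonotoneNorm N) {x : ι → ℝ} (hx : x ≠ 0) : 0 < N x :=
  lt_of_le_of_ne (hN.nonneg x) fun h => hx (hN.eq_zero x h.symm)

end IsMonotoneNorm

section Pack

variable {n r : ℕ} {N : (Fin n × Fin r → ℝ) → ℝ} {b : ℝ≥0} {p p' : Fin n → Fin r → ℝ≥0}
  {D D' : Finset (Fin n)}

lemma le_packOpt {a : Sel n r} (h : ∀ j, a j ≠ none → j ∈ D) (hl : selLoad N p a ≤ b) :
    a.count ≤ packOpt N b p D := by
  classical
  unfold packOpt
  exact Finset.le_sup (f := Sel.count) (by simpa using ⟨h, hl⟩)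

lemma exists_packOpt (hN : IsMonotoneNorm N) (b : ℝ≥0) (p : Fin n → Fin r → ℝ≥0)
    (D : Finset (Fin n)) : ∃ a : Sel n r, (∀ j, a j ≠ none → j ∈ D) ∧ selLoad N p a ≤ b ∧
      a.count = packOpt N b p D := by
  classical
  have hne : (Finset.univ.filter fun a : Sel n r =>
      (∀ j, a j ≠ none → j ∈ D) ∧ selLoad N p a ≤ b).Nonempty := by
    refine ⟨fun _ => none, Finset.mem_filter.2 ⟨Finset.mem_univ _, by simp, ?_⟩⟩
    have : selLoad N p (fun _ => none) = N 0 := by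
      unfold selLoad
      congr 1
      funext jk
      simp
    rw [this, hN.zero]
    exact b.2
  obtain ⟨a, ha, h⟩ := Finset.exists_mem_eq_sup _ hne Sel.count
  simp only [Finset.mem_filter, Finset.mem_univ, true_and] at ha
  refine ⟨a, ha.1, ha.2, ?_⟩
  unfold packOpt
  rw [h]

/-- Restricting a selection to a set of jobs. -/
def Sel.restrict (a : Sel n r) (D : Finset (Fin n)) : Sel n r := fun j => if j ∈ D then a j else none

lemma Sel.isSome_restrict (a : Sel n r) (j : Fin n) :
    (a.restrict D j).isSome = true ↔ j ∈ D ∧ (a j).isSome = true := by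
  unfold Sel.restrict
  split_ifs with h <;> simp [h]

lemma selLoad_restrict_le (hN : IsMonotoneNorm N) (a : Sel n r) :
    selLoad N p (a.restrict D) ≤ selLoad N p a := by
  refine hN.mono _ _ (fun jk => ?_) (fun jk => ?_)
  · simp only [Pi.zero_apply]; positivity
  · simp only [Sel.restrict]
    split_ifs <;> simp_all

lemma packOpt_mono (hN : IsMonotoneNorm N) (h : D ⊆ D') : packOpt N b p D ≤ packOpt N b p D' := by
  obtain ⟨a, h1, h2, h3⟩ := exists_packOpt hN b p D
  rw [← h3]
  exact le_packOpt (fun j hj => h (h1 j hj)) h2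

lemma Sel.count_le_restrict_add (a : Sel n r) (h : ∀ j, a j ≠ none → j ∈ D ∪ D') :
    a.count ≤ (a.restrict D).count + (a.restrict D').count := by
  unfold Sel.count
  refine (Finset.card_le_card ?_).trans (Finset.card_union_le _ _)
  intro j hj
  simp only [Finset.mem_filter, Finset.mem_univ, true_and, Finset.mem_union,
    Sel.isSome_restrict] at hj ⊢
  have := Finset.mem_union.1 (h j (by intro h0; simp [h0] at hj))
  tauto

/-- Restricting an optimal selection does not increase its load. This subadditivity is what allows
the jobs that came before an opening to be discounted. -/
lemma packOpt_union_le (hN : IsMonotoneNorm N) :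
    packOpt N b p (D ∪ D') ≤ packOpt N b p D + packOpt N b p D' := by
  obtain ⟨a, h1, h2, h3⟩ := exists_packOpt hN b p (D ∪ D')
  rw [← h3]
  refine (a.count_le_restrict_add h1).trans (add_le_add ?_ ?_) <;>
  · refine le_packOpt (fun j hj => ?_) ((selLoad_restrict_le hN a).trans h2)
    by_contra hD
    simp [Sel.restrict, hD] at hj

lemma packOpt_empty : packOpt N b p ∅ = 0 := by
  classical
  unfold packOpt
  rw [← Nat.le_zero]
  refine Finset.sup_le fun a ha => ?_
  simp only [Finset.mem_filter, Finset.notMem_empty, imp_false, not_not] at ha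
  simp [Sel.count, ha.2.1]

lemma packOpt_congr (h : ∀ j ∈ D, p j = p' j) : packOpt N b p D = packOpt N b p' D := by
  classical
  unfold packOpt
  congr 1
  ext a
  simp only [Finset.mem_filter, Finset.mem_univ, true_and, and_congr_right_iff]
  intro ha
  have : selLoad N p a = selLoad N p' a := by
    unfold selLoad
    congr 1
    funext jk
    by_cases h0 : a jk.1 = some jk.2
    · rw [h jk.1 (ha _ (by simp [h0]))]
    · simp [h0]
  rw [this]

/-- The packing problem restricted to subsets of a packable set. -/
lemma card_inter_le_packOpt (hN : IsMonotoneNorm N) (a : Sel n r) (hl : selLoad N p a ≤ b)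
    {S : Finset (Fin n)} (hS : ∀ j ∈ S, (a j).isSome = true) :
    (S ∩ D).card ≤ packOpt N b p D := by
  have h : (S ∩ D).card ≤ (a.restrict D).count := by
    refine Finset.card_le_card fun j hj => ?_
    rw [Finset.mem_inter] at hj
    exact Finset.mem_filter.2 ⟨Finset.mem_univ _, (a.isSome_restrict j).2 ⟨hj.2, hS j hj.1⟩⟩
  refine h.trans (le_packOpt (fun j hj => ?_) ((selLoad_restrict_le hN a).trans hl))
  by_contra hD
  simp [Sel.restrict, hD] at hj

end Pack

/-! ### Packers: Norm-Pack solvers from which jobs may be withheld -/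

/-- A randomized online algorithm for packing on one machine, in which some jobs are withheld. -/
structure Packer (n r : ℕ) where
  Ω : Type
  [measurableSpace : MeasurableSpace Ω]
  μ : Measure Ω
  [isProb : IsProbabilityMeasure μ]
  run : Ω → (Fin n → Fin r → ℝ≥0) → Finset (Fin n) → Sel n r
  online : ∀ (ω : Ω) (p p' : Fin n → Fin r → ℝ≥0) (D D' : Finset (Fin n)) (j : Fin n),
    (∀ j' ≤ j, p j' = p' j') → (∀ j' ≤ j, j' ∈ D ↔ j' ∈ D') → run ω p D j = run ω p' D' j
  measurable_run : ∀ p D (a : Sel n r), MeasurableSet {ω | run ω p D = a}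
  mem_of_run : ∀ ω p D j, run ω p D j ≠ none → j ∈ D

attribute [instance] Packer.measurableSpace Packer.isProb

/-- The expected number of packed jobs. -/
noncomputable def Packer.expectedCount {n r : ℕ} (P : Packer n r) (p : Fin n → Fin r → ℝ≥0)
    (D : Finset (Fin n)) : ℝ := ∫ ω, ((P.run ω p D).count : ℝ) ∂P.μ

section Solver

variable {n r : ℕ} {N : (Fin n × Fin r → ℝ) → ℝ}

/-- A load that exceeds `K` on its own. -/
noncomputable def bigLoad (N : (Fin n × Fin r → ℝ) → ℝ) (K : ℝ) (jk : Fin n × Fin r) : ℝ≥0 :=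
  Real.toNNReal ((|K| + 1) / N (Pi.single jk 1))

lemma lt_bigLoad (hN : IsMonotoneNorm N) (K : ℝ) (jk : Fin n × Fin r) :
    K < N (Pi.single jk (bigLoad N K jk : ℝ)) := by
  have hpos : 0 < N (Pi.single jk 1) := hN.pos (by simp)
  have h0 : (0 : ℝ) ≤ (|K| + 1) / N (Pi.single jk 1) := by positivity
  have : (Pi.single jk (bigLoad N K jk : ℝ) : Fin n × Fin r → ℝ) =
      (bigLoad N K jk : ℝ) • Pi.single jk 1 := by
    rw [← Pi.single_smul]; simp
  rw [this, hN.smul_of_nonneg (NNReal.coe_nonneg _), bigLoad, Real.coe_toNNReal _ h0,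
    div_mul_cancel₀ _ hpos.ne']
  linarith [le_abs_self K]

/-- Loads in which the jobs outside `D` cannot be packed with load at most `K`. -/
noncomputable def maskLoads (N : (Fin n × Fin r → ℝ) → ℝ) (K : ℝ) (p : Fin n → Fin r → ℝ≥0)
    (D : Finset (Fin n)) : Loads 1 n r :=
  fun j _ k => if j ∈ D then p j k else bigLoad N K (j, k)

/-- The selection made by an allocation on a single machine. -/
def Alloc.toSel (a : Alloc 1 n r) : Sel n r := fun j => (a j).map Prod.snd

lemma Alloc.count_toSel (a : Alloc 1 n r) : a.toSel.count = a.count := by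
  simp [Sel.count, Alloc.count, Alloc.toSel]

lemma Alloc.x_eq (a : Alloc 1 n r) (j : Fin n) (k : Fin r) :
    a.x 0 j k = if a.toSel j = some k then 1 else 0 := by
  unfold Alloc.x Alloc.toSel
  congr 1
  rcases a j with _ | ⟨i, k'⟩
  · simp
  · simp [Subsingleton.elim i 0]

/-- A withheld job exceeds `K` by itself in every way, and by monotonicity other jobs cannot bring
the load down again. Hence a solver that always respects `K` never takes a withheld job, although it
sees a full sequence of `n` jobs. -/
lemma mem_of_maskLoad_le (hN : IsMonotoneNorm N) {K : ℝ} {p : Fin n → Fin r → ℝ≥0}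
    {D : Finset (Fin n)} {a : Alloc 1 n r}
    (h : machineLoad (fun _ => N) (maskLoads N K p D) a 0 ≤ K) {j : Fin n}
    (hj : a.toSel j ≠ none) : j ∈ D := by
  by_contra hD
  obtain ⟨k, hk⟩ := Option.ne_none_iff_exists'.1 hj
  refine absurd h (not_le.2 ((lt_bigLoad hN K (j, k)).trans_le (hN.mono _ _ ?_ ?_)))
  · intro jk
    by_cases h1 : jk = (j, k)
    · subst h1; simp
    · simp [h1]
  · intro jk
    by_cases h1 : jk = (j, k)
    · subst h1; simp [Alloc.x_eq, hk, maskLoads, hD]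
    · simp only [Pi.single_eq_of_ne h1, Alloc.x_eq]
      positivity

lemma maskLoad_eq {K : ℝ} {p : Fin n → Fin r → ℝ≥0} {D : Finset (Fin n)} {a : Alloc 1 n r}
    (h : ∀ j, a.toSel j ≠ none → j ∈ D) :
    machineLoad (fun _ => N) (maskLoads N K p D) a 0 = selLoad N p a.toSel := by
  unfold machineLoad selLoad
  refine congrArg N ?_
  funext jk
  rw [Alloc.x_eq]
  by_cases h1 : a.toSel jk.1 = some jk.2
  · simp [h1, maskLoads, h jk.1 (by simp [h1])]
  · simp [h1]

lemma packOpt_le_opt (hN : IsMonotoneNorm N) (K : ℝ) (b : ℝ≥0) (p : Fin n → Fin r → ℝ≥0)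
    (D : Finset (Fin n)) :
    packOpt N b p D ≤ opt (fun y => y 0) (fun _ : Fin 1 => N) b (maskLoads N K p D) := by
  classical
  obtain ⟨a, h1, h2, h3⟩ := exists_packOpt hN b p D
  let a' : Alloc 1 n r := fun j => (a j).map fun k => (0, k)
  have ha : a'.toSel = a := by
    funext j
    simp only [a', Alloc.toSel]
    cases a j <;> rfl
  rw [← h3, ← ha, Alloc.count_toSel]
  unfold opt
  refine Finset.le_sup (f := Alloc.count) ?_
  simp only [Finset.mem_filter, Finset.mem_univ, true_and]
  rw [maskLoad_eq (by rw [ha]; exact h1), ha]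
  exact h2

/-- A Norm-Packing solver used for several guesses of the optimum at the same time. -/
lemma exists_packer {ι : Type} [Fintype ι] (hN : IsMonotoneNorm N) {α c : ℝ}
    (hs : NormPackSolvable N α c) (b : ℝ≥0) (M : ι → ℝ) (w : ι → ℝ)
    (hw : ∀ i, 0 ≤ w i) (hw1 : ∑ i, w i = 1) :
    ∃ P : Packer n r, (∀ ω p D, selLoad N p (P.run ω p D) ≤ c * b) ∧
      ∀ p D i, M i ≤ packOpt N b p D → w i * (α * M i) ≤ P.expectedCount p D := by
  obtain ⟨hα, -, hc, hs⟩ := hs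
  choose A hA1 hA2 using fun i => hs b (M i)
  obtain ⟨A', h1, h2⟩ := exists_mixture w hw hw1 A
  -- The mask level is the guaranteed load `c * b` itself, so that the load guarantee excludes
  -- withheld jobs.
  have hload : ∀ ω p D, machineLoad (fun _ => N) (maskLoads N (c * b) p D)
      (A'.run ω (maskLoads N (c * b) p D)) 0 ≤ c * b := by
    intro ω p D
    obtain ⟨i, ω', h⟩ := h1 ω
    rw [h]
    exact hA1 i _ ω'
  have hmem : ∀ ω p D j, (A'.run ω (maskLoads N (c * b) p D)).toSel j ≠ none → j ∈ D :=
    fun ω p D j hj => mem_of_maskLoad_le hN (hload ω p D) hj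
  have hon : ∀ (ω : A'.Ω) (p p' : Fin n → Fin r → ℝ≥0) (D D' : Finset (Fin n)) (j : Fin n),
      (∀ j' ≤ j, p j' = p' j') → (∀ j' ≤ j, j' ∈ D ↔ j' ∈ D') →
      (A'.run ω (maskLoads N (c * b) p D)).toSel j =
        (A'.run ω (maskLoads N (c * b) p' D')).toSel j := by
    intro ω p p' D D' j h h'
    simp only [Alloc.toSel]
    rw [A'.online ω (maskLoads N (c * b) p D) (maskLoads N (c * b) p' D') j]
    intro j' hj'
    funext _ k
    simp [maskLoads, h j' hj', h' j' hj']
  have hme : ∀ (p : Fin n → Fin r → ℝ≥0) (D : Finset (Fin n)) (a : Sel n r),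
      MeasurableSet {ω | (A'.run ω (maskLoads N (c * b) p D)).toSel = a} := by
    intro p D a
    have : {ω | (A'.run ω (maskLoads N (c * b) p D)).toSel = a} =
        ⋃ a' ∈ {a' : Alloc 1 n r | a'.toSel = a},
          {ω | A'.run ω (maskLoads N (c * b) p D) = a'} := by
      ext ω; simp
    rw [this]
    exact MeasurableSet.biUnion (Set.to_countable _) fun a' _ => A'.measurable_run _ a'
  refine ⟨⟨A'.Ω, A'.μ, fun ω p D => (A'.run ω (maskLoads N (c * b) p D)).toSel, hon, hme, hmem⟩,
    ?_, ?_⟩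
  · intro ω p D
    rw [← maskLoad_eq (hmem ω p D)]
    exact hload ω p D
  · intro p D i hi
    have : Packer.expectedCount ⟨A'.Ω, A'.μ,
        fun ω p D => (A'.run ω (maskLoads N (c * b) p D)).toSel, hon, hme, hmem⟩ p D =
        A'.expectedCount (maskLoads N (c * b) p D) := by
      simp only [Packer.expectedCount, OnlineAlg.expectedCount, Alloc.count_toSel]
    rw [this, h2]
    have hnn : ∀ i, 0 ≤ (A i).expectedCount (maskLoads N (c * b) p D) := fun i =>
      integral_nonneg fun _ => Nat.cast_nonneg _
    refine le_trans ?_ (Finset.single_le_sum (fun i _ => mul_nonneg (hw i) (hnn i))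
      (Finset.mem_univ i))
    refine mul_le_mul_of_nonneg_left (hA2 i _ (hi.trans ?_)) (hw i)
    exact_mod_cast packOpt_le_opt hN _ b p D

end Solver

/-! ### The opening process

`V` is a finite set of packers. A packer `v` is opened at the first time `t` such that `thr v` of the
jobs that arrived up to `t` and are not taken by packers opened before could be packed by `v`. From
time `t` on it is offered the jobs that the packers opened before do not take. -/

/-- The packers opened so far, with the jobs offered to them and the jobs that they take. -/
abbrev PState (V : Type) (n r : ℕ) : Type := V → Option (Finset (Fin n) × Sel n r)

/-- The data that determine the opening process. -/
structure Proc (V : Type) (n r : ℕ) where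
  ok : Finset V → V → Prop
  opt : V → Finset (Fin n) → ℕ
  thr : V → ℕ
  sel : V → Finset (Fin n) → Sel n r

section Opening

variable {V : Type} [Fintype V] {n r : ℕ}

/-- The set of open packers. -/
def PState.active (st : PState V n r) : Finset V := Finset.univ.filter fun v => (st v).isSome = true

open Classical in
/-- The set of jobs that are not taken. -/
noncomputable def PState.avail (st : PState V n r) : Finset (Fin n) :=
  Finset.univ.filter fun j => ∀ v z, st v = some z → z.2 j = none

/-- The jobs that are offered to a packer opened at time `t`. -/
noncomputable def PState.mask (st : PState V n r) (t : ℕ) : Finset (Fin n) :=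
  st.avail.filter fun j => t ≤ j.val

lemma PState.avail_filter_le {V : Type} {n r : ℕ} (st : PState V n r) (t s : ℕ) :
    (st.avail.filter fun j => j.val ≤ s) ⊆ (st.avail.filter fun j => j.val < t) ∪ st.mask t := by
  intro j hj
  simp only [PState.mask, Finset.mem_union, Finset.mem_filter] at hj ⊢
  rcases lt_or_ge j.val t with h | h
  · exact Or.inl ⟨hj.1, h⟩
  · exact Or.inr ⟨hj.1, h⟩

/-- The condition for opening `v` at time `t`. -/
def Proc.Fires (P : Proc V n r) (st : PState V n r) (t : ℕ) (v : V) : Prop :=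
  st v = none ∧ P.ok st.active v ∧ P.thr v ≤ P.opt v (st.avail.filter fun j => j.val ≤ t)

variable [Nonempty V]

/-- The packer that is considered in step `u`. -/
noncomputable def turn (V : Type) [Fintype V] [Nonempty V] (u : ℕ) : V :=
  (Fintype.equivFin V).symm ⟨u % Fintype.card V, Nat.mod_lt _ Fintype.card_pos⟩

/-- Steps refine time: time `t` consists of the `Fintype.card V` steps `u` with `u / Fintype.card V
= t`, and every packer has its turn in exactly one of them. -/
lemma exists_turn (t : ℕ) (v : V) : ∃ u, turn V u = v ∧ u / Fintype.card V = t ∧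
    ∀ u', turn V u' = v → t < u' / Fintype.card V → u < u' := by
  have hc : 0 < Fintype.card V := Fintype.card_pos
  set i := Fintype.equivFin V v
  have h1 : (Fintype.card V * t + i) / Fintype.card V = t := by
    rw [Nat.mul_add_div hc, Nat.div_eq_of_lt i.2, add_zero]
  refine ⟨Fintype.card V * t + i, ?_, h1, ?_⟩
  · unfold turn
    rw [Equiv.symm_apply_eq]
    ext
    simp [Nat.mod_eq_of_lt i.2, i]
  · intro u' _ hu'
    by_contra hle
    have := Nat.div_le_div_right (c := Fintype.card V) (not_lt.1 hle)
    omega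

lemma lt_of_turn_div_lt {u t : ℕ} (h : u / Fintype.card V < t) : u < t * Fintype.card V :=
  (Nat.div_lt_iff_lt_mul Fintype.card_pos).1 h

variable [DecidableEq V]

open Classical in
/-- The state after `u` steps. -/
noncomputable def Proc.run (P : Proc V n r) : ℕ → PState V n r
  | 0 => fun _ => none
  | u + 1 =>
    -- An opened packer is recorded at once with its choices on all jobs still to come. This
    -- look-ahead is harmless: by `Proc.run_agree`, the choices on jobs up to `j` use no data after
    -- `j`.
    if P.Fires (P.run u) (u / Fintype.card V) (turn V u) then
      Function.update (P.run u) (turn V u)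
        (some ((P.run u).mask (u / Fintype.card V),
          P.sel (turn V u) ((P.run u).mask (u / Fintype.card V))))
    else P.run u

/-- The final state. -/
noncomputable def Proc.final (P : Proc V n r) : PState V n r := P.run (n * Fintype.card V)

variable {P P' : Proc V n r} {u u' : ℕ} {v : V}

lemma Proc.run_succ_of_fires (h : P.Fires (P.run u) (u / Fintype.card V) (turn V u)) :
    P.run (u + 1) = Function.update (P.run u) (turn V u)
        (some ((P.run u).mask (u / Fintype.card V),
          P.sel (turn V u) ((P.run u).mask (u / Fintype.card V)))) := by
  rw [Proc.run, if_pos h]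

lemma Proc.run_succ_of_not_fires (h : ¬ P.Fires (P.run u) (u / Fintype.card V) (turn V u)) :
    P.run (u + 1) = P.run u := by
  rw [Proc.run, if_neg h]

lemma Proc.run_mono (h : u ≤ u') {z} (hz : P.run u v = some z) : P.run u' v = some z := by
  induction u', h using Nat.le_induction with
  | base => exact hz
  | succ k _ ih =>
    by_cases hf : P.Fires (P.run k) (k / Fintype.card V) (turn V k)
    · rw [Proc.run_succ_of_fires hf, Function.update_of_ne, ih]
      rintro rfl
      rw [hf.1] at ih
      cases ih
    · rw [Proc.run_succ_of_not_fires hf, ih]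

lemma Proc.run_none_of_le (h : u ≤ u') (hz : P.run u' v = none) : P.run u v = none := by
  by_contra h0
  obtain ⟨z, h1⟩ := Option.ne_none_iff_exists'.1 h0
  rw [Proc.run_mono h h1] at hz
  cases hz

lemma Proc.active_mono (h : u ≤ u') : (P.run u).active ⊆ (P.run u').active := by
  intro v hv
  simp only [PState.active, Finset.mem_filter, Finset.mem_univ, true_and] at hv ⊢
  obtain ⟨z, hz⟩ := Option.isSome_iff_exists.1 hv
  rw [Proc.run_mono h hz]; rfl

lemma Proc.avail_anti (h : u ≤ u') : (P.run u').avail ⊆ (P.run u).avail := by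
  intro j hj
  simp only [PState.avail, Finset.mem_filter, Finset.mem_univ, true_and] at hj ⊢
  exact fun v z hz => hj v z (Proc.run_mono h hz)

lemma Proc.exists_fires {z} (h : P.run u v = some z) :
    ∃ u₀ < u, turn V u₀ = v ∧ P.Fires (P.run u₀) (u₀ / Fintype.card V) v ∧
      z = ((P.run u₀).mask (u₀ / Fintype.card V), P.sel v ((P.run u₀).mask (u₀ / Fintype.card V))) := by
  induction u with
  | zero => simp [Proc.run] at h
  | succ k ih =>
    by_cases hf : P.Fires (P.run k) (k / Fintype.card V) (turn V k)
    · rw [Proc.run_succ_of_fires hf] at h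
      by_cases hv : v = turn V k
      · subst hv
        rw [Function.update_self] at h
        exact ⟨k, Nat.lt_succ_self k, rfl, hf, (Option.some_injective _ h).symm⟩
      · rw [Function.update_of_ne hv] at h
        obtain ⟨u₀, h0, h1⟩ := ih h
        exact ⟨u₀, h0.trans (Nat.lt_succ_self k), h1⟩
    · rw [Proc.run_succ_of_not_fires hf] at h
      obtain ⟨u₀, h0, h1⟩ := ih h
      exact ⟨u₀, h0.trans (Nat.lt_succ_self k), h1⟩

lemma Proc.run_eq_of_fires {u₀ : ℕ} (hu : u₀ < u) (hv : turn V u₀ = v)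
    (hf : P.Fires (P.run u₀) (u₀ / Fintype.card V) v) :
    P.run u v = some ((P.run u₀).mask (u₀ / Fintype.card V),
      P.sel v ((P.run u₀).mask (u₀ / Fintype.card V))) := by
  subst hv
  refine Proc.run_mono hu ?_
  rw [Proc.run_succ_of_fires hf, Function.update_self]

/-- Before `v` is opened, nothing depends on the seed of `v`. -/
lemma Proc.run_congr (hok : P.ok = P'.ok) (hopt : P.opt = P'.opt)
    (hthr : ∀ v' ≠ v, P.thr v' = P'.thr v') (hsel : ∀ v' ≠ v, P.sel v' = P'.sel v')
    (hle : P.thr v ≤ P'.thr v) (h : P.run u v = none) : P'.run u = P.run u := by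
  induction u with
  | zero => rfl
  | succ k ih =>
    have hk := Proc.run_none_of_le (Nat.le_succ k) h
    have ih := ih hk
    -- When `v` has its turn, it does not fire in the first process because it stays closed, hence
    -- not in the second, where its threshold is at least as large. At the other turns both
    -- processes do the same.
    by_cases hv : turn V k = v
    · have h1 : ¬ P.Fires (P.run k) (k / Fintype.card V) (turn V k) := by
        intro hf
        rw [Proc.run_succ_of_fires hf, hv, Function.update_self] at h
        cases h
      have h2 : ¬ P'.Fires (P'.run k) (k / Fintype.card V) (turn V k) := by
        rw [ih]
        rintro ⟨a, b, c⟩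
        rw [hv] at a b c h1
        exact h1 ⟨a, hok ▸ b, hopt ▸ hle.trans c⟩
      rw [Proc.run_succ_of_not_fires h1, Proc.run_succ_of_not_fires h2, ih]
    · have hiff : P.Fires (P.run k) (k / Fintype.card V) (turn V k) ↔
          P'.Fires (P'.run k) (k / Fintype.card V) (turn V k) := by
        rw [ih]
        simp only [Proc.Fires, hok, hopt, hthr _ hv]
      by_cases hf : P.Fires (P.run k) (k / Fintype.card V) (turn V k)
      · rw [Proc.run_succ_of_fires hf, Proc.run_succ_of_fires (hiff.1 hf), ih, hsel _ hv]
      · rw [Proc.run_succ_of_not_fires hf, Proc.run_succ_of_not_fires (fun h => hf (hiff.2 h)), ih]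

/-- The properties of the data that the analysis uses. -/
structure Proc.Valid (P : Proc V n r) : Prop where
  ok_anti : ∀ s s' v, s ⊆ s' → P.ok s' v → P.ok s v
  opt_mono : ∀ v D D', D ⊆ D' → P.opt v D ≤ P.opt v D'
  opt_union : ∀ v D D', P.opt v (D ∪ D') ≤ P.opt v D + P.opt v D'
  opt_empty : ∀ v, P.opt v ∅ = 0
  thr_pos : ∀ v, 1 ≤ P.thr v
  sel_mem : ∀ v D j, P.sel v D j ≠ none → j ∈ D

/-- While `v` is allowed but not open, fewer than `thr v` of the available jobs that arrived so far
can be packed by `v`. -/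
lemma Proc.opt_lt (hP : P.Valid) (h : P.run u v = none) (hok : P.ok (P.run u).active v) (t : ℕ)
    (ht : ∀ u₀, turn V u₀ = v → u₀ / Fintype.card V + 1 = t →
      (∀ u', turn V u' = v → t ≤ u' / Fintype.card V → u₀ < u') → u₀ < u) :
    P.opt v ((P.run u).avail.filter fun j => j.val < t) < P.thr v := by
  rcases Nat.eq_zero_or_pos t with rfl | htp
  · simp [hP.opt_empty, Nat.lt_of_succ_le (hP.thr_pos v)]
  · obtain ⟨u₀, h1, h2, h3⟩ := exists_turn (t - 1) v
    have hlt := ht u₀ h1 (by omega) (fun u' a b => h3 u' a (by omega))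
    have hn := Proc.run_none_of_le hlt.le h
    have hok' := hP.ok_anti _ _ v (Proc.active_mono hlt.le) hok
    have hnf : ¬ P.Fires (P.run u₀) (u₀ / Fintype.card V) v := by
      intro hf
      rw [Proc.run_eq_of_fires hlt h1 hf] at h
      cases h
    have : ¬ P.thr v ≤ P.opt v ((P.run u₀).avail.filter fun j => j.val ≤ u₀ / Fintype.card V) :=
      fun h' => hnf ⟨hn, hok', h'⟩
    refine lt_of_le_of_lt (hP.opt_mono v _ _ ?_) (not_le.1 this)
    intro j hj
    simp only [Finset.mem_filter] at hj ⊢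
    exact ⟨Proc.avail_anti hlt.le hj.1, by omega⟩

/-- When `v` is opened, fewer than `thr v` of the available earlier jobs can be packed by `v`. -/
lemma Proc.opt_lt_of_turn (hP : P.Valid) (h : P.run u v = none) (hv : turn V u = v)
    (hok : P.ok (P.run u).active v) :
    P.opt v ((P.run u).avail.filter fun j => j.val < u / Fintype.card V) < P.thr v :=
  Proc.opt_lt hP h hok _ fun _ _ _ h3 => h3 u hv le_rfl

/-- At the end, fewer than `thr v` available jobs can be packed by a packer `v` that is allowed but
not open. -/
lemma Proc.opt_final_lt (hP : P.Valid) (h : P.final v = none) (hok : P.ok P.final.active v) :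
    P.opt v P.final.avail < P.thr v := by
  refine lt_of_le_of_lt (hP.opt_mono v _ _ ?_) (Proc.opt_lt hP h hok n fun u₀ _ h2 _ =>
    lt_of_turn_div_lt (by omega))
  intro j hj
  exact Finset.mem_filter.2 ⟨hj, j.2⟩

lemma Proc.final_some (h : ∃ z, P.final v = some z) :
    ∃ u < n * Fintype.card V, turn V u = v ∧ P.Fires (P.run u) (u / Fintype.card V) v ∧
      P.final v = some ((P.run u).mask (u / Fintype.card V),
        P.sel v ((P.run u).mask (u / Fintype.card V))) := by
  obtain ⟨z, hz⟩ := h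
  obtain ⟨u, h1, h2, h3, h4⟩ := Proc.exists_fires hz
  exact ⟨u, h1, h2, h3, h4 ▸ hz⟩

/-- The jobs offered to `v` do not depend on which of them `v` takes. -/
lemma Proc.final_congr (hok : P.ok = P'.ok) (hopt : P.opt = P'.opt)
    (hthr : ∀ v, P.thr v = P'.thr v) (hsel : ∀ v' ≠ v, P.sel v' = P'.sel v')
    {D a} (h : P.final v = some (D, a)) :
    a = P.sel v D ∧ P'.final v = some (D, P'.sel v D) := by
  obtain ⟨u, h1, h2, h3, h4⟩ := Proc.final_some ⟨_, h⟩
  have hr := Proc.run_congr hok hopt (fun v' _ => hthr v') hsel (hthr v).le h3.1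
  have h3' : P'.Fires (P'.run u) (u / Fintype.card V) v := by
    rw [hr]; exact ⟨h3.1, hok ▸ h3.2.1, hopt ▸ hthr v ▸ h3.2.2⟩
  have := Proc.run_eq_of_fires h1 h2 h3'
  rw [hr] at this
  rw [h4] at h
  simp only [Option.some.injEq, Prod.mk.injEq] at h
  obtain ⟨rfl, rfl⟩ := h
  exact ⟨rfl, this⟩

/-- If `v` is opened with a larger threshold, then it is opened with the smaller threshold, and is
offered many jobs. -/
lemma Proc.final_of_thr_lt (hP : P.Valid) (hok : P.ok = P'.ok) (hopt : P.opt = P'.opt)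
    (hthr : ∀ v' ≠ v, P.thr v' = P'.thr v') (hsel : ∀ v' ≠ v, P.sel v' = P'.sel v')
    (hle : P.thr v ≤ P'.thr v) (h : ∃ z, P'.final v = some z) :
    ∃ D, P.final v = some (D, P.sel v D) ∧ P'.thr v - P.thr v < P.opt v D := by
  obtain ⟨u', a1, a2, a3, -⟩ := Proc.final_some h
  have hsome : ∃ z, P.final v = some z := by
    -- If `v` stayed closed with the smaller threshold, both runs would agree up to the step at
    -- which the larger threshold is met, and there the smaller one is met as well.
    by_contra hne
    have hnone : P.run u' v = none := by
      by_contra h0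
      obtain ⟨z, h1⟩ := Option.ne_none_iff_exists'.1 h0
      exact hne ⟨z, Proc.run_mono a1.le h1⟩
    have hr := Proc.run_congr hok hopt hthr hsel hle hnone
    rw [hr] at a3
    exact hne ⟨_, Proc.run_eq_of_fires a1 a2 ⟨a3.1, hok ▸ a3.2.1, hle.trans (hopt ▸ a3.2.2)⟩⟩
  obtain ⟨u, b1, b2, b3, b4⟩ := Proc.final_some hsome
  refine ⟨_, b4, ?_⟩
  have hr := Proc.run_congr hok hopt hthr hsel hle b3.1
  have hu : u ≤ u' := by
    by_contra hlt
    have hnone := Proc.run_none_of_le (not_le.1 hlt).le b3.1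
    have hr' := Proc.run_congr hok hopt hthr hsel hle hnone
    rw [hr'] at a3
    have := Proc.run_eq_of_fires (not_le.1 hlt) a2
      (P := P) ⟨a3.1, hok ▸ a3.2.1, hle.trans (hopt ▸ a3.2.2)⟩
    rw [b3.1] at this
    cases this
  -- The available jobs up to the later opening contain `P'.thr v` packable ones, and those before
  -- the earlier opening fewer than `P.thr v`. By subadditivity the difference is offered to `v`.
  have h1 := Proc.opt_lt_of_turn hP b3.1 b2 b3.2.1
  have h2 : P'.thr v ≤ P.opt v ((P.run u).avail.filter fun j => j.val ≤ u' / Fintype.card V) := by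
    rw [hopt, ← hr]
    refine a3.2.2.trans ?_
    rw [← hopt]
    refine hP.opt_mono v _ _ (Finset.filter_subset_filter _ (Proc.avail_anti hu))
  have h3 := hP.opt_mono v _ _ ((P.run u).avail_filter_le (u / Fintype.card V) (u' / Fintype.card V))
  have h4 := hP.opt_union v ((P.run u).avail.filter fun j => j.val < u / Fintype.card V)
    ((P.run u).mask (u / Fintype.card V))
  omega

lemma Proc.one_le_opt (hP : P.Valid) {D a} (h : P.final v = some (D, a)) : 1 ≤ P.opt v D := by
  obtain ⟨D', h1, h2⟩ := Proc.final_of_thr_lt hP (P' := P) rfl rfl (fun _ _ => rfl) (fun _ _ => rfl)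
    le_rfl ⟨_, h⟩
  rw [h] at h1
  simp only [Option.some.injEq, Prod.mk.injEq] at h1
  rw [h1.1]
  omega

/-- A set of packable jobs that are not taken by others is mostly offered to an open packer. -/
lemma Proc.card_le_of_open (hP : P.Valid) {S : Finset (Fin n)}
    (hS : ∀ D, (S ∩ D).card ≤ P.opt v D) {D a} (h : P.final v = some (D, a)) :
    S.card ≤ (S ∩ D).card + (P.thr v - 1) + (S \ P.final.avail).card := by
  obtain ⟨u, h1, h2, h3, h4⟩ := Proc.final_some ⟨_, h⟩
  rw [h] at h4
  simp only [Option.some.injEq, Prod.mk.injEq] at h4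
  obtain ⟨rfl, -⟩ := h4
  have hlt := Proc.opt_lt_of_turn hP h3.1 h2 h3.2.1
  have hb := hS ((P.run u).avail.filter fun j => j.val < u / Fintype.card V)
  -- A job of `S` is taken by the end, or is offered to `v`, or was available but arrived before `v`
  -- opened. The last kind numbers fewer than `thr v`.
  have hsub : S ⊆ (S ∩ (P.run u).mask (u / Fintype.card V)) ∪
      (S ∩ ((P.run u).avail.filter fun j => j.val < u / Fintype.card V)) ∪ (S \ P.final.avail) := by
    intro j hj
    by_cases hav : j ∈ P.final.avail
    · have := Proc.avail_anti h1.le hav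
      simp only [PState.mask, Finset.mem_union, Finset.mem_inter, Finset.mem_filter]
      rcases lt_or_ge j.val (u / Fintype.card V) with h | h
      · exact Or.inl (Or.inr ⟨hj, this, h⟩)
      · exact Or.inl (Or.inl ⟨hj, this, h⟩)
    · exact Finset.mem_union_right _ (Finset.mem_sdiff.2 ⟨hj, hav⟩)
  have h5 := Finset.card_le_card hsub
  have h6 := Finset.card_union_le ((S ∩ (P.run u).mask (u / Fintype.card V)) ∪
      (S ∩ ((P.run u).avail.filter fun j => j.val < u / Fintype.card V))) (S \ P.final.avail)
  have h7 := Finset.card_union_le (S ∩ (P.run u).mask (u / Fintype.card V))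
      (S ∩ ((P.run u).avail.filter fun j => j.val < u / Fintype.card V))
  omega

/-- The jobs of `S` left over at the end are packable by `v`; `thr v` of them would have opened it.
-/
lemma Proc.card_le_of_closed (hP : P.Valid) {S : Finset (Fin n)}
    (hS : ∀ D, (S ∩ D).card ≤ P.opt v D) (h : P.final v = none) (hok : P.ok P.final.active v) :
    S.card ≤ (P.thr v - 1) + (S \ P.final.avail).card := by
  have h1 := Proc.opt_final_lt hP h hok
  have h2 := hS P.final.avail
  have h3 := Finset.card_inter_add_card_sdiff S P.final.avail
  omega

/-- Every job is taken at most once. -/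
lemma Proc.take_unique (hP : P.Valid) {v v' : V} {z z'} {j : Fin n} (h : P.run u v = some z)
    (h' : P.run u v' = some z') (hj : z.2 j ≠ none) (hj' : z'.2 j ≠ none) : v = v' := by
  by_contra hne
  -- One of the two packers opens strictly first, and the other is then offered only jobs that the
  -- first does not take.
  wlog hlt : ∃ w, P.run w v = some z ∧ P.run w v' = none generalizing v v' z z'
  · obtain ⟨w, _, h2, h3, h4⟩ := Proc.exists_fires h
    refine this h' h hj' hj (Ne.symm hne) ⟨w, ?_, h3.1⟩
    by_contra hcon
    refine hlt ⟨w + 1, ?_, ?_⟩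
    · rw [h4]
      exact Proc.run_eq_of_fires (Nat.lt_succ_self w) h2 h3
    · subst h2
      rw [Proc.run_succ_of_fires h3, Function.update_of_ne (Ne.symm hne)]
      by_contra h0
      obtain ⟨z₀, h1⟩ := Option.ne_none_iff_exists'.1 h0
      have := Proc.run_mono (le_max_left w u) h1
      rw [Proc.run_mono (le_max_right w u) h'] at this
      exact hcon (by rw [h1, this])
  obtain ⟨w, h1, h2⟩ := hlt
  obtain ⟨w', _, h5, h6, h7⟩ := Proc.exists_fires h'
  have hw : w ≤ w' := by
    by_contra hc
    rw [Proc.run_eq_of_fires (not_le.1 hc) h5 h6] at h2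
    cases h2
  rw [h7] at hj'
  have hm := hP.sel_mem _ _ _ hj'
  simp only [PState.mask, PState.avail, Finset.mem_filter, Finset.mem_univ, true_and] at hm
  exact hj (hm.1 v z (Proc.run_mono hw h1))

/-- The number of jobs taken by `v`. -/
def PState.gain (st : PState V n r) (v : V) : ℕ := (st v).elim 0 fun z => z.2.count

lemma Proc.card_compl_avail (hP : P.Valid) :
    (Finset.univ \ P.final.avail).card = ∑ v, P.final.gain v := by
  classical
  have h1 : (Finset.univ \ P.final.avail) = Finset.univ.biUnion fun v : V =>
      Finset.univ.filter fun j => ∃ z, P.final v = some z ∧ z.2 j ≠ none := by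
    ext j
    simp only [PState.avail, Finset.mem_sdiff, Finset.mem_univ, Finset.mem_filter, true_and,
      Finset.mem_biUnion]
    push Not
    rfl
  rw [h1, Finset.card_biUnion]
  · refine Finset.sum_congr rfl fun v _ => ?_
    unfold PState.gain
    rcases hz : P.final v with _ | z
    · simp
    · simp only [Option.elim_some, Sel.count]
      congr 1
      ext j
      simp [Option.isSome_iff_ne_none]
  · intro v _ v' _ hne
    rw [Function.onFun, Finset.disjoint_left]
    intro j hj hj'
    simp only [Finset.mem_filter, Finset.mem_univ, true_and] at hj hj'
    obtain ⟨z, hz, h0⟩ := hj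
    obtain ⟨z', hz', h0'⟩ := hj'
    exact hne (Proc.take_unique hP hz hz' h0 h0')

/-- Properties that are inherited when an allowed packer is opened hold for the open packers. -/
lemma Proc.active_induction {Q : Finset V → Prop} (h0 : Q ∅)
    (hs : ∀ s v, Q s → v ∉ s → P.ok s v → Q (insert v s)) (u : ℕ) : Q (P.run u).active := by
  induction u with
  | zero => simpa [Proc.run, PState.active] using h0
  | succ k ih =>
    by_cases hf : P.Fires (P.run k) (k / Fintype.card V) (turn V k)
    · have : (P.run (k + 1)).active = insert (turn V k) (P.run k).active := by
        ext v
        rw [Proc.run_succ_of_fires hf]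
        by_cases hv : v = turn V k
        · subst hv; simp [PState.active]
        · simp [PState.active, hv]
      rw [this]
      refine hs _ _ ih ?_ hf.2.1
      simp [PState.active, hf.1]
    · rwa [Proc.run_succ_of_not_fires hf]

end Opening

/-! ### The allocation of a state, and causality of the process -/

section OnlineOpening

variable {V : Type} {n r m : ℕ}

/-- Job `j` is taken by the packer `z.1` in way `z.2`. -/
def PState.Takes (st : PState V n r) (j : Fin n) (z : V × Fin r) : Prop :=
  ∃ D a, st z.1 = some (D, a) ∧ a j = some z.2

open Classical in
/-- The allocation that corresponds to a state, if the packer `v` runs on machine `mach v`. -/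
noncomputable def PState.alloc (st : PState V n r) (mach : V → Fin m) : Alloc m n r :=
  fun j => if h : ∃ z, st.Takes j z then some (mach h.choose.1, h.choose.2) else none

/-- The choice in `PState.alloc` depends only on the predicate `Takes j`, so two states with
equivalent predicates choose the same machine and way. -/
lemma PState.alloc_congr {st st' : PState V n r} {j : Fin n} (mach : V → Fin m)
    (h : ∀ z, st.Takes j z ↔ st'.Takes j z) : st.alloc mach j = st'.alloc mach j := by
  have : st.Takes j = st'.Takes j := funext fun z => propext (h z)
  unfold PState.alloc
  generalize st.Takes j = T at this
  subst this
  rfl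

lemma PState.exists_takes_iff (st : PState V n r) (j : Fin n) :
    (∃ z, st.Takes j z) ↔ j ∉ st.avail := by
  simp only [PState.avail, Finset.mem_filter, Finset.mem_univ, true_and, PState.Takes]
  push Not
  constructor
  · rintro ⟨z, D, a, h1, h2⟩
    exact ⟨z.1, (D, a), h1, by simp [h2]⟩
  · rintro ⟨v, ⟨D, a⟩, h1, h2⟩
    obtain ⟨k, hk⟩ := Option.ne_none_iff_exists'.1 h2
    exact ⟨(v, k), D, a, h1, hk⟩

lemma PState.count_alloc (st : PState V n r) (mach : V → Fin m) :
    (st.alloc mach).count = (Finset.univ \ st.avail).card := by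
  unfold Alloc.count
  congr 1
  ext j
  rw [Finset.mem_filter, Finset.mem_sdiff, ← st.exists_takes_iff, PState.alloc]
  split_ifs with h <;> simp [h]

lemma PState.exists_of_alloc {st : PState V n r} {mach : V → Fin m} {j : Fin n} {i : Fin m}
    {k : Fin r} (h : st.alloc mach j = some (i, k)) :
    ∃ v D a, mach v = i ∧ st v = some (D, a) ∧ a j = some k := by
  unfold PState.alloc at h
  split_ifs at h with hz
  obtain ⟨D, a, h1, h2⟩ := hz.choose_spec
  simp only [Option.some.injEq, Prod.mk.injEq] at h
  exact ⟨hz.choose.1, D, a, h.1, h1, h.2 ▸ h2⟩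

variable [Fintype V]

open Classical in
lemma PState.machineLoad_le (st : PState V n r) (mach : V → Fin m)
    (N : Fin m → (Fin n × Fin r → ℝ) → ℝ) (hN : ∀ i, IsMonotoneNorm (N i)) (p : Loads m n r)
    (K : V → ℝ)
    (hK : ∀ v D a, st v = some (D, a) → selLoad (N (mach v)) (fun j k => p j (mach v) k) a ≤ K v)
    (i : Fin m) :
    machineLoad N p (st.alloc mach) i ≤ ∑ v ∈ st.active with mach v = i, K v := by
  let sel : V → Sel n r := fun v => (st v).elim (fun _ => none) Prod.snd
  have h1 : machineLoad N p (st.alloc mach) i ≤ N i (∑ v ∈ st.active with mach v = i,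
      fun jk : Fin n × Fin r => (if sel v jk.1 = some jk.2 then 1 else 0) * (p jk.1 i jk.2 : ℝ)) := by
    refine (hN i).mono _ _ (fun jk => ?_) (fun jk => ?_)
    · simp only [Pi.zero_apply, Alloc.x]; positivity
    · rw [Finset.sum_apply]
      by_cases h : st.alloc mach jk.1 = some (i, jk.2)
      · obtain ⟨v, D, a, h1, h2, h3⟩ := PState.exists_of_alloc h
        refine le_trans (le_of_eq ?_) (Finset.single_le_sum (fun v _ => by positivity)
          (show v ∈ st.active.filter fun v => mach v = i from ?_))
        · simp [Alloc.x, h, sel, h2, h3]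
        · simp [PState.active, h1, h2]
      · simp only [Alloc.x, h, if_false, zero_mul]
        exact Finset.sum_nonneg fun v _ => by positivity
  refine h1.trans (((hN i).sum_le _ _).trans (Finset.sum_le_sum fun v hv => ?_))
  simp only [PState.active, Finset.mem_filter, Finset.mem_univ, true_and] at hv
  obtain ⟨z, hz⟩ := Option.isSome_iff_exists.1 hv.1
  have := hK v z.1 z.2 hz
  rw [hv.2] at this
  simpa [sel, hz, selLoad] using this

variable [Nonempty V] [DecidableEq V] {P P' : Proc V n r}

/-- The state up to time `j` is determined by the data up to time `j`. -/
lemma Proc.run_agree (j : ℕ) (hok : P.ok = P'.ok) (hthr : P.thr = P'.thr)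
    (hopt : ∀ v D, (∀ i ∈ D, i.val ≤ j) → P.opt v D = P'.opt v D)
    (hsel : ∀ v D D', (∀ i : Fin n, i.val ≤ j → (i ∈ D ↔ i ∈ D')) →
      ∀ i : Fin n, i.val ≤ j → P.sel v D i = P'.sel v D' i)
    (u : ℕ) (hu : u ≤ (j + 1) * Fintype.card V) (v : V) :
    (P.run u v = none ∧ P'.run u v = none) ∨ ∃ D a D' a', P.run u v = some (D, a) ∧
      P'.run u v = some (D', a') ∧ ∀ i : Fin n, i.val ≤ j → a i = a' i := by
  induction u generalizing v with
  | zero => exact Or.inl ⟨rfl, rfl⟩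
  | succ k ih =>
    have ih := ih (by omega)
    have hact : (P.run k).active = (P'.run k).active := by
      ext v
      simp only [PState.active, Finset.mem_filter, Finset.mem_univ, true_and]
      rcases ih v with h | ⟨D, a, D', a', h1, h2, -⟩
      · simp [h]
      · simp [h1, h2]
    have hnone : ∀ v, P.run k v = none ↔ P'.run k v = none := by
      intro v
      rcases ih v with h | ⟨D, a, D', a', h1, h2, -⟩
      · simp [h]
      · simp [h1, h2]
    have hav : ∀ i : Fin n, i.val ≤ j → (i ∈ (P.run k).avail ↔ i ∈ (P'.run k).avail) := by
      intro i hi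
      simp only [PState.avail, Finset.mem_filter, Finset.mem_univ, true_and]
      refine forall_congr' fun v => ?_
      rcases ih v with h | ⟨D, a, D', a', h1, h2, h3⟩
      · simp [h]
      · simp [h1, h2, h3 i hi]
    -- Steps before `(j + 1) * Fintype.card V` belong to times up to `j`, so opening conditions look
    -- only at jobs up to `j`. The offered sets may differ after `j`, which `hsel` tolerates.
    have ht : k / Fintype.card V ≤ j := by
      have : k / Fintype.card V < j + 1 := (Nat.div_lt_iff_lt_mul Fintype.card_pos).2 (by omega)
      omega
    have hfilter : ((P.run k).avail.filter fun i => i.val ≤ k / Fintype.card V) =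
        (P'.run k).avail.filter fun i => i.val ≤ k / Fintype.card V := by
      ext i
      simp only [Finset.mem_filter]
      exact and_congr_left fun hi => hav i (hi.trans ht)
    have hf : P.Fires (P.run k) (k / Fintype.card V) (turn V k) ↔
        P'.Fires (P'.run k) (k / Fintype.card V) (turn V k) := by
      unfold Proc.Fires
      rw [hnone, hact, hok, hthr, hfilter, hopt]
      intro i hi
      exact (Finset.mem_filter.1 hi).2.trans ht
    by_cases h : P.Fires (P.run k) (k / Fintype.card V) (turn V k)
    · rw [Proc.run_succ_of_fires h, Proc.run_succ_of_fires (hf.1 h)]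
      by_cases hv : v = turn V k
      · subst hv
        refine Or.inr ⟨_, _, _, _, Function.update_self .., Function.update_self .., ?_⟩
        refine hsel _ _ _ fun i hi => ?_
        simp only [PState.mask, Finset.mem_filter]
        exact and_congr_left fun _ => hav i hi
      · rw [Function.update_of_ne hv, Function.update_of_ne hv]
        exact ih v
    · rw [Proc.run_succ_of_not_fires h, Proc.run_succ_of_not_fires (fun h' => h (hf.2 h'))]
      exact ih v

/-- A packer opened at time `t` is offered only jobs `j ≥ t`. Whoever takes `j` is therefore open
before the steps of time `j` are over. -/
lemma Proc.takes_final_iff (hP : P.Valid) (j : Fin n) (z : V × Fin r) :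
    P.final.Takes j z ↔ (P.run ((j + 1) * Fintype.card V)).Takes j z := by
  have hle : (j.val + 1) * Fintype.card V ≤ n * Fintype.card V :=
    Nat.mul_le_mul_right _ j.2
  constructor
  · rintro ⟨D, a, h1, h2⟩
    obtain ⟨u, hu, h3, h4, h5⟩ := Proc.exists_fires h1
    simp only [Prod.mk.injEq] at h5
    refine ⟨D, a, ?_, h2⟩
    have hj : j ∈ D := by
      rw [h5.1]
      refine hP.sel_mem z.1 _ j ?_
      rw [← h5.2, h2]
      simp
    rw [h5.1] at hj
    have ht := (Finset.mem_filter.1 hj).2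
    rw [h5.1, h5.2]
    refine Proc.run_eq_of_fires ?_ h3 h4
    exact lt_of_turn_div_lt (Nat.lt_succ_of_le ht)
  · rintro ⟨D, a, h1, h2⟩
    exact ⟨D, a, Proc.run_mono hle h1, h2⟩

lemma Proc.alloc_agree (hP : P.Valid) (hP' : P'.Valid) (mach : V → Fin m) (j : Fin n)
    (hok : P.ok = P'.ok) (hthr : P.thr = P'.thr)
    (hopt : ∀ v D, (∀ i ∈ D, i ≤ j) → P.opt v D = P'.opt v D)
    (hsel : ∀ v D D', (∀ i ≤ j, i ∈ D ↔ i ∈ D') → ∀ i ≤ j, P.sel v D i = P'.sel v D' i) :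
    P.final.alloc mach j = P'.final.alloc mach j := by
  refine PState.alloc_congr mach fun z => ?_
  rw [Proc.takes_final_iff hP, Proc.takes_final_iff hP']
  rcases Proc.run_agree j.val hok hthr hopt hsel _ le_rfl z.1 with h | ⟨D, a, D', a', h1, h2, h3⟩
  · simp [PState.Takes, h]
  · simp [PState.Takes, h1, h2, h3 j le_rfl]

end OnlineOpening

/-! ### Random thresholds -/

/-- The distribution on `{0, …, l}` in which `k` has a probability proportional to `2 ^ k`. -/
noncomputable def geomMeasure (l : ℕ) : Measure (Fin (l + 1)) :=
  ∑ k : Fin (l + 1), ENNReal.ofReal (2 ^ k.val / (2 ^ (l + 1) - 1)) • Measure.dirac k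

lemma geom_pos (l : ℕ) : (0 : ℝ) < 2 ^ (l + 1) - 1 := by
  have : (1 : ℝ) < 2 ^ (l + 1) := one_lt_pow₀ (by norm_num) (by omega)
  linarith

instance (l : ℕ) : IsProbabilityMeasure (geomMeasure l) := by
  constructor
  have hp := geom_pos l
  simp only [geomMeasure, Measure.coe_finsetSum, Finset.sum_apply, Measure.smul_apply,
    measure_univ, smul_eq_mul, mul_one]
  rw [← ENNReal.ofReal_sum_of_nonneg fun i _ => by positivity, ← Finset.sum_div,
    Fin.sum_univ_eq_sum_range (fun k => (2 : ℝ) ^ k), geom_sum_eq (by norm_num)]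
  norm_num [hp.ne']

lemma integral_geom_prod {Ω : Type} [MeasurableSpace Ω] (μ : Measure Ω) [IsProbabilityMeasure μ]
    (l : ℕ) (f : Fin (l + 1) × Ω → ℝ) (hf : Integrable f ((geomMeasure l).prod μ)) :
    ∫ y, f y ∂(geomMeasure l).prod μ =
      ∑ k : Fin (l + 1), 2 ^ k.val / (2 ^ (l + 1) - 1) * ∫ ω, f (k, ω) ∂μ := by
  have hp := geom_pos l
  rw [integral_prod _ hf]
  simp only [geomMeasure]
  rw [integral_finsetSum_measure]
  · refine Finset.sum_congr rfl fun k _ => ?_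
    rw [integral_smul_measure, integral_dirac, ENNReal.toReal_ofReal (by positivity), smul_eq_mul]
  · intro k _
    exact (integrable_dirac (by simp)).smul_measure ENNReal.ofReal_ne_top

/-- Finite-valued random variables may be composed. -/
lemma measurableSet_fiber_bind {Ω σ τ : Type} [MeasurableSpace Ω] [Finite σ] {X : Ω → σ}
    {Y : σ → Ω → τ} (hX : ∀ s, MeasurableSet {ω | X ω = s})
    (hY : ∀ s t, MeasurableSet {ω | Y s ω = t}) (t : τ) : MeasurableSet {ω | Y (X ω) ω = t} := by
  have : {ω | Y (X ω) ω = t} = ⋃ s, {ω | X ω = s} ∩ {ω | Y s ω = t} := by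
    ext ω; simp
  rw [this]
  exact MeasurableSet.iUnion fun s => (hX s).inter (hY s t)

/-! ### Ensembles: the opening process with independent random seeds -/

/-- A finite family of packers on the machines, with the rule that governs when they are opened. -/
structure Ensemble (m n r : ℕ) (V : Type) where
  N : Fin m → (Fin n × Fin r → ℝ) → ℝ
  norm : ∀ i, IsMonotoneNorm (N i)
  mach : V → Fin m
  b : V → ℝ≥0
  q : V → ℕ
  q_pos : ∀ v, 1 ≤ q v
  l : V → ℕ
  pk : V → Packer n r
  ok : Finset V → V → Prop
  ok_anti : ∀ s s' v, s ⊆ s' → ok s' v → ok s v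

namespace Ensemble

variable {m n r : ℕ} {V : Type} [Fintype V] (E : Ensemble m n r V)

/-- The seed of a packer: its random threshold and its own randomness. -/
abbrev Seed (v : V) : Type := Fin (E.l v + 1) × (E.pk v).Ω

/-- The distribution of the seed of a packer. -/
noncomputable def seedMeasure (v : V) : Measure (E.Seed v) := (geomMeasure (E.l v)).prod (E.pk v).μ

instance (v : V) : IsProbabilityMeasure (E.seedMeasure v) := by
  unfold seedMeasure; infer_instance

/-- The loads of the jobs on the machine of `v`. -/
def loads (p : Loads m n r) (v : V) : Fin n → Fin r → ℝ≥0 := fun j k => p j (E.mach v) k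

/-- The number of jobs of `D` that can be packed by `v`. -/
noncomputable def optOn (p : Loads m n r) (v : V) (D : Finset (Fin n)) : ℕ :=
  packOpt (E.N (E.mach v)) (E.b v) (E.loads p v) D

/-- The process for given seeds and loads. -/
noncomputable def proc (x : ∀ v, E.Seed v) (p : Loads m n r) : Proc V n r where
  ok := E.ok
  opt := E.optOn p
  -- The shift by one makes the smallest threshold equal to the quota and keeps all thresholds
  -- positive.
  thr v := ((x v).1 + 1) * E.q v
  sel v D := (E.pk v).run (x v).2 (E.loads p v) D

omit [Fintype V] in
lemma proc_valid (x : ∀ v, E.Seed v) (p : Loads m n r) : (E.proc x p).Valid where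
  ok_anti := E.ok_anti
  opt_mono _ _ _ h := packOpt_mono (E.norm _) h
  opt_union _ _ _ := packOpt_union_le (E.norm _)
  opt_empty _ := packOpt_empty
  thr_pos v := Nat.one_le_iff_ne_zero.2 (Nat.mul_ne_zero (by omega)
    (Nat.one_le_iff_ne_zero.1 (E.q_pos v)))
  sel_mem v D j h := (E.pk v).mem_of_run _ _ _ _ h

omit [Fintype V] in
lemma measurableSet_thr (v : V) (k : Fin (E.l v + 1)) :
    MeasurableSet {x : ∀ v, E.Seed v | (x v).1 = k} :=
  (measurable_fst.comp (measurable_pi_apply v)) (measurableSet_singleton k)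

omit [Fintype V] in
lemma measurableSet_sel (p : Loads m n r) (v : V) (D : Finset (Fin n)) (a : Sel n r) :
    MeasurableSet {x : ∀ v, E.Seed v | (E.pk v).run (x v).2 (E.loads p v) D = a} :=
  (measurable_snd.comp (measurable_pi_apply v)) ((E.pk v).measurable_run (E.loads p v) D a)

variable [DecidableEq V] [Nonempty V]

/-- The next state is a function of three finite-valued variables: the state, the threshold of the
packer on turn, and its selection. The offered set depends on the state, hence the conditioning by
`measurableSet_fiber_bind`, one variable at a time. -/
lemma measurableSet_run (p : Loads m n r) (u : ℕ) (s : PState V n r) :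
    MeasurableSet {x | (E.proc x p).run u = s} := by
  classical
  induction u generalizing s with
  | zero => exact MeasurableSet.const ((fun _ => none : PState V n r) = s)
  | succ k ih =>
    set v := turn V k
    set t := k / Fintype.card V
    let G : PState V n r → Fin (E.l v + 1) → Sel n r → PState V n r := fun st i a =>
      if st v = none ∧ E.ok st.active v ∧
        (i + 1) * E.q v ≤ E.optOn p v (st.avail.filter fun j => j.val ≤ t)
      then Function.update st v (some (st.mask t, a)) else st
    have h : ∀ x, (E.proc x p).run (k + 1) = G ((E.proc x p).run k) (x v).1
        ((E.pk v).run (x v).2 (E.loads p v) (((E.proc x p).run k).mask t)) := by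
      intro x
      by_cases hf : (E.proc x p).Fires ((E.proc x p).run k) t v
      · rw [Proc.run_succ_of_fires hf]
        exact (if_pos hf).symm
      · rw [Proc.run_succ_of_not_fires hf]
        exact (if_neg hf).symm
    simp only [h]
    refine measurableSet_fiber_bind (X := fun x => (E.proc x p).run k)
      (Y := fun st x => G st (x v).1 ((E.pk v).run (x v).2 (E.loads p v) (st.mask t))) ih ?_ s
    intro st s
    refine measurableSet_fiber_bind (X := fun x : ∀ v, E.Seed v => (x v).1)
      (Y := fun i x => G st i ((E.pk v).run (x v).2 (E.loads p v) (st.mask t)))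
      (E.measurableSet_thr v) ?_ s
    intro i s
    refine measurableSet_fiber_bind
      (X := fun x : ∀ v, E.Seed v => (E.pk v).run (x v).2 (E.loads p v) (st.mask t))
      (Y := fun a _ => G st i a) (E.measurableSet_sel p v _) ?_ s
    exact fun a s => MeasurableSet.const _

/-- The online algorithm given by an ensemble. -/
noncomputable def alg : OnlineAlg m n r where
  Ω := ∀ v, E.Seed v
  μ := Measure.pi E.seedMeasure
  run x p := (E.proc x p).final.alloc E.mach
  online := by
    intro x p p' j h
    refine Proc.alloc_agree (E.proc_valid x p) (E.proc_valid x p') E.mach j rfl rfl ?_ ?_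
    · intro v D hD
      refine packOpt_congr fun i hi => ?_
      change (fun k => p i (E.mach v) k) = fun k => p' i (E.mach v) k
      rw [h i (hD i hi)]
    · intro v D D' hD i hi
      refine (E.pk v).online _ _ _ _ _ i (fun i' hi' => ?_) fun i' hi' => hD i' (hi'.trans hi)
      change (fun k => p i' (E.mach v) k) = fun k => p' i' (E.mach v) k
      rw [h i' (hi'.trans hi)]
  measurable_run := by
    intro p a
    exact measurableSet_fiber_bind (X := fun x => (E.proc x p).final)
      (Y := fun st _ => st.alloc E.mach) (E.measurableSet_run p _) (fun st s => MeasurableSet.const _) a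

lemma integrable_final (p : Loads m n r) (φ : PState V n r → ℝ) :
    Integrable (fun x => φ (E.proc x p).final) (Measure.pi E.seedMeasure) :=
  integrable_comp_finite _ (fun x => (E.proc x p).final) (E.measurableSet_run p _) φ

lemma measurable_final (p : Loads m n r) (φ : PState V n r → ℝ) :
    Measurable (fun x => φ (E.proc x p).final) :=
  measurable_comp_finite (fun x => (E.proc x p).final) (E.measurableSet_run p _) φ

lemma integrable_final_update (p : Loads m n r) (φ : PState V n r → ℝ) (x : ∀ v, E.Seed v) (v : V) :
    Integrable (fun y => φ (E.proc (Function.update x v y) p).final) (E.seedMeasure v) :=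
  integrable_comp_finite _ (fun y => (E.proc (Function.update x v y) p).final)
    (fun s => measurable_update x (E.measurableSet_run p _ s)) φ

lemma expectedCount_alg (p : Loads m n r) :
    E.alg.expectedCount p =
      ∑ v, ∫ x, ((E.proc x p).final.gain v : ℝ) ∂Measure.pi E.seedMeasure := by
  rw [← integral_finsetSum _ fun v _ => E.integrable_final p fun st => (st.gain v : ℝ)]
  refine integral_congr_ae (Filter.Eventually.of_forall fun x => ?_)
  change (((E.proc x p).final.alloc E.mach).count : ℝ) = _
  rw [PState.count_alloc, Proc.card_compl_avail (E.proc_valid x p)]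
  push_cast
  rfl

/-- The inequality `∫ f ≤ ∫ g` may be checked by averaging over the seed of one packer. -/
lemma integral_final_le (p : Loads m n r) (v : V) (f g : PState V n r → ℝ) (hf : ∀ s, 0 ≤ f s)
    (hg : ∀ s, 0 ≤ g s)
    (h : ∀ x, ∑ k : Fin (E.l v + 1), 2 ^ k.val / (2 ^ (E.l v + 1) - 1) *
        ∫ ω, f (E.proc (Function.update x v (k, ω)) p).final ∂(E.pk v).μ ≤
      ∑ k : Fin (E.l v + 1), 2 ^ k.val / (2 ^ (E.l v + 1) - 1) *
        ∫ ω, g (E.proc (Function.update x v (k, ω)) p).final ∂(E.pk v).μ) :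
    ∫ x, f (E.proc x p).final ∂Measure.pi E.seedMeasure ≤
      ∫ x, g (E.proc x p).final ∂Measure.pi E.seedMeasure := by
  refine integral_pi_le_of_update E.seedMeasure v _ _ (E.measurable_final p f)
    (E.measurable_final p g) (fun _ => hf _) (fun _ => hg _) (E.integrable_final p f)
    (E.integrable_final p g) (fun x => E.integrable_final_update p f x v)
    (fun x => E.integrable_final_update p g x v) fun x => ?_
  have h1 := integral_geom_prod (E.pk v).μ (E.l v) _ (E.integrable_final_update p f x v)
  have h2 := integral_geom_prod (E.pk v).μ (E.l v) _ (E.integrable_final_update p g x v)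
  unfold seedMeasure
  rw [h1, h2]
  exact h x

/-- The jobs offered to `v`, as a function of the threshold of `v`. -/
noncomputable def offer (p : Loads m n r) (x : ∀ v, E.Seed v) (v : V) (k : Fin (E.l v + 1)) :
    Option (Finset (Fin n)) :=
  ((E.proc (Function.update x v (k, (x v).2)) p).final v).map Prod.fst

/-- The internal randomness `ω` of `v` matters only after `v` is opened, and later packers take only
what `v` leaves. With the other seeds and the threshold fixed, `v` thus faces a fixed input, and its
expected gain on it may be used. -/
lemma final_update (p : Loads m n r) (x : ∀ v, E.Seed v) (v : V) (k : Fin (E.l v + 1))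
    (ω : (E.pk v).Ω) : (E.proc (Function.update x v (k, ω)) p).final v =
      (E.offer p x v k).map fun D => (D, (E.pk v).run ω (E.loads p v) D) := by
  have key : ∀ ω ω' D a, (E.proc (Function.update x v (k, ω)) p).final v = some (D, a) →
      (E.proc (Function.update x v (k, ω')) p).final v =
        some (D, (E.pk v).run ω' (E.loads p v) D) := by
    intro ω ω' D a h
    have := Proc.final_congr (P := E.proc (Function.update x v (k, ω)) p)
      (P' := E.proc (Function.update x v (k, ω')) p) (v := v) rfl rfl ?_ ?_ h
    · simpa [proc] using this.2
    · intro v'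
      by_cases hv : v' = v
      · subst hv; simp [proc]
      · simp [proc, hv]
    · intro v' hv
      simp [proc, hv]
  unfold offer
  rcases h : (E.proc (Function.update x v (k, (x v).2)) p).final v with _ | ⟨D, a⟩
  · rcases h' : (E.proc (Function.update x v (k, ω)) p).final v with _ | ⟨D, a⟩
    · rfl
    · rw [key _ (x v).2 _ _ h'] at h
      cases h
  · rw [key _ ω _ _ h]
    rfl

/-- The expected number of jobs packed by `v` for a given threshold. -/
noncomputable def offerGain (p : Loads m n r) (x : ∀ v, E.Seed v) (v : V) (k : Fin (E.l v + 1)) : ℝ :=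
  (E.offer p x v k).elim 0 fun D => (E.pk v).expectedCount (E.loads p v) D

omit [Nonempty V] [Fintype V] [DecidableEq V] in
lemma expectedCount_nonneg (P : Packer n r) (p : Fin n → Fin r → ℝ≥0) (D : Finset (Fin n)) :
    0 ≤ P.expectedCount p D := integral_nonneg fun _ => Nat.cast_nonneg _

lemma offerGain_nonneg (p : Loads m n r) (x : ∀ v, E.Seed v) (v : V) (k : Fin (E.l v + 1)) :
    0 ≤ E.offerGain p x v k := by
  unfold offerGain
  rcases E.offer p x v k with _ | D
  · exact le_rfl
  · exact expectedCount_nonneg _ _ _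

lemma integral_gain_update (p : Loads m n r) (x : ∀ v, E.Seed v) (v : V) (k : Fin (E.l v + 1)) :
    ∫ ω, ((E.proc (Function.update x v (k, ω)) p).final.gain v : ℝ) ∂(E.pk v).μ =
      E.offerGain p x v k := by
  simp only [PState.gain, E.final_update, offerGain]
  rcases E.offer p x v k with _ | D
  · simp
  · rfl

/-- Consecutive thresholds differ by `q v`. With the smaller one `v` opens no later, and by
subadditivity the missing `q v` packable jobs are among those offered to it. -/
lemma offer_of_succ (p : Loads m n r) (x : ∀ v, E.Seed v) (v : V) (k k' : Fin (E.l v + 1))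
    (hk : k'.val = k.val + 1) (h : E.offer p x v k' ≠ none) :
    ∃ D, E.offer p x v k = some D ∧ E.q v ≤ E.optOn p v D := by
  obtain ⟨D', hD'⟩ := Option.ne_none_iff_exists'.1 h
  have h1 := E.final_update p x v k' (x v).2
  rw [hD'] at h1
  obtain ⟨D, h2, h3⟩ := Proc.final_of_thr_lt
    (P := E.proc (Function.update x v (k, (x v).2)) p)
    (P' := E.proc (Function.update x v (k', (x v).2)) p) (v := v) (E.proc_valid _ p) rfl rfl
    (fun v' hv => by simp [proc, hv]) (fun v' hv => by simp [proc, hv])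
    (by simp only [proc, Function.update_self]; exact Nat.mul_le_mul_right _ (by omega)) ⟨_, h1⟩
  refine ⟨D, by simp [offer, h2], ?_⟩
  simp only [proc, Function.update_self, hk, ← Nat.sub_mul] at h3
  have : k.val + 1 + 1 - (k.val + 1) = 1 := by omega
  rw [this, one_mul] at h3
  exact h3.le

lemma one_le_of_offer (p : Loads m n r) (x : ∀ v, E.Seed v) (v : V) (k : Fin (E.l v + 1))
    {D} (h : E.offer p x v k = some D) : 1 ≤ E.optOn p v D := by
  have h1 := E.final_update p x v k (x v).2
  rw [h] at h1
  exact Proc.one_le_opt (E.proc_valid _ p) h1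

/-- The probability that `v` is opened at its smallest threshold, if this may be too early. -/
noncomputable def penalty (v : V) : ℝ := if E.q v = 1 then 0 else 1 / (2 ^ (E.l v + 1) - 1)

omit [Nonempty V] [Fintype V] [DecidableEq V] in
lemma penalty_nonneg (v : V) : 0 ≤ E.penalty v := by
  have := geom_pos (E.l v)
  unfold penalty
  split_ifs <;> positivity

open Classical in
/-- Opening a packer pays off on average. -/
lemma opening_pays (p : Loads m n r) {α : ℝ} (hα : 0 ≤ α) (v : V)
    (hq : ∀ D, E.q v ≤ E.optOn p v D →
      α * E.q v / 2 ≤ (E.pk v).expectedCount (E.loads p v) D) :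
    α * E.q v / 4 * ∫ x, (if v ∈ (E.proc x p).final.active then 1 else 0) ∂Measure.pi E.seedMeasure ≤
      ∫ x, ((E.proc x p).final.gain v : ℝ) ∂Measure.pi E.seedMeasure +
        α * E.q v / 4 * E.penalty v := by
  have hp := geom_pos (E.l v)
  have hpen := E.penalty_nonneg v
  set A : ℝ := α * E.q v / 4 with hA
  have hA0 : 0 ≤ A := by positivity
  have key := E.integral_final_le p v (fun s => A * if v ∈ s.active then 1 else 0)
    (fun s => (s.gain v : ℝ) + A * E.penalty v) (fun s => by positivity) (fun s => by positivity) ?_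
  · rw [integral_const_mul, integral_add (E.integrable_final p fun s => (s.gain v : ℝ))
      (integrable_const _)] at key
    simpa using key
  intro x
  have hL : ∀ k : Fin (E.l v + 1),
      ∫ ω, A * (if v ∈ (E.proc (Function.update x v (k, ω)) p).final.active then 1 else 0 : ℝ)
        ∂(E.pk v).μ = A * if E.offer p x v k = none then 0 else 1 := by
    intro k
    simp only [PState.active, Finset.mem_filter, Finset.mem_univ, true_and, E.final_update]
    rcases E.offer p x v k with _ | D <;> simp
  have hR : ∀ k : Fin (E.l v + 1),
      ∫ ω, (((E.proc (Function.update x v (k, ω)) p).final.gain v : ℝ) + A * E.penalty v)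
        ∂(E.pk v).μ = E.offerGain p x v k + A * E.penalty v := by
    intro k
    rw [integral_add, integral_gain_update]
    · simp
    · exact integrable_comp_finite _ (fun ω => (E.proc (Function.update x v (k, ω)) p).final)
        (fun s => (measurable_update x).comp (measurable_const.prodMk measurable_id)
          (E.measurableSet_run p _ s)) fun s => (s.gain v : ℝ)
    · exact integrable_const _
  simp only [hL, hR]
  have hsum : ∑ k : Fin (E.l v + 1), (2 : ℝ) ^ k.val / (2 ^ (E.l v + 1) - 1) = 1 := by
    rw [← Finset.sum_div, Fin.sum_univ_eq_sum_range (fun k => (2 : ℝ) ^ k),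
      geom_sum_eq (by norm_num)]
    norm_num [hp.ne']
  have hg := E.offerGain_nonneg p x v
  have hs : ∀ k, 0 ≤ (2 : ℝ) ^ k / (2 ^ (E.l v + 1) - 1) := fun k => by positivity
  simp only [mul_add, Finset.sum_add_distrib, ← Finset.sum_mul, hsum, one_mul]
  -- For quota 1 no shift is needed: opening at any threshold already guarantees one packable
  -- offered job.
  by_cases hq1 : E.q v = 1
  · refine le_add_of_le_of_nonneg (Finset.sum_le_sum fun k _ => ?_) (by positivity)
    refine mul_le_mul_of_nonneg_left ?_ (hs k)
    rcases h : E.offer p x v k with _ | D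
    · simpa using hg k
    · have := hq D (hq1 ▸ E.one_le_of_offer p x v k h)
      simp only [offerGain, h, Option.elim_some, reduceCtorEq, if_false, mul_one]
      have : A ≤ α * E.q v / 2 := by rw [hA]; linarith
      linarith
  · have hpen' : E.penalty v = 1 / (2 ^ (E.l v + 1) - 1) := if_neg hq1
    -- The sums are compared with a shift: opening at index `k + 1` is paid by the gain at index
    -- `k`. The opening at index 0 has no predecessor and goes into the penalty.
    rw [Fin.sum_univ_succ, Fin.sum_univ_castSucc (fun k => _ * E.offerGain p x v k), hpen', add_comm]
    have h0 : (2 : ℝ) ^ (0 : Fin (E.l v + 1)).val / (2 ^ (E.l v + 1) - 1) *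
        (A * if E.offer p x v 0 = none then 0 else 1) ≤ A * (1 / (2 ^ (E.l v + 1) - 1)) := by
      simp only [Fin.val_zero, pow_zero]
      rw [mul_comm]
      refine mul_le_mul_of_nonneg_right ?_ (by positivity)
      split_ifs <;> simp [hA0]
    refine add_le_add (le_trans (Finset.sum_le_sum fun k _ => ?_)
      (le_add_of_nonneg_right (mul_nonneg (hs _) (hg _)))) h0
    -- Index `k + 1` is twice as likely as `k`, which is why the gain `α * q / 2` pays only for `A =
    -- α * q / 4`.
    have h2 : (2 : ℝ) ^ k.succ.val / (2 ^ (E.l v + 1) - 1) =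
        2 ^ k.castSucc.val / (2 ^ (E.l v + 1) - 1) * 2 := by
      simp only [Fin.val_succ, Fin.val_castSucc, pow_succ]
      ring
    rw [h2, mul_assoc]
    refine mul_le_mul_of_nonneg_left ?_ (hs k.castSucc.val)
    by_cases h : E.offer p x v k.succ = none
    · simpa [h] using hg k.castSucc
    · obtain ⟨D, h3, h4⟩ := E.offer_of_succ p x v k.castSucc k.succ (by simp) h
      have := hq D h4
      simp only [offerGain, h3, Option.elim_some, h, if_false, mul_one]
      rw [hA]
      linarith

open Classical in
/-- An open packer whose jobs are not taken by others packs many of them on average. -/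
lemma open_packer_gain (p : Loads m n r) {α M t : ℝ} (hα : 0 ≤ α) (ht : 0 ≤ t) (htM : t ≤ M)
    (e : ℕ) (v : V)
    (hg : ∀ D, M / 2 ^ e ≤ E.optOn p v D →
      α * min (E.optOn p v D : ℝ) M / (4 * (e + 1)) ≤ (E.pk v).expectedCount (E.loads p v) D)
    (S : Finset (Fin n)) (hS : ∀ D, (S ∩ D).card ≤ E.optOn p v D) (htS : t ≤ S.card)
    (hthr : 4 * ((E.l v + 1) * E.q v - 1) ≤ S.card) (hMS : M / 2 ^ e ≤ S.card / 4) :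
    α * t / (16 * (e + 1)) * ∫ x, (if v ∈ (E.proc x p).final.active ∧
        2 * (S \ (E.proc x p).final.avail).card < S.card then 1 else 0) ∂Measure.pi E.seedMeasure ≤
      ∫ x, ((E.proc x p).final.gain v : ℝ) ∂Measure.pi E.seedMeasure := by
  have hp := geom_pos (E.l v)
  set A : ℝ := α * t / (16 * (e + 1)) with hA
  have hA0 : 0 ≤ A := by positivity
  rw [← integral_const_mul]
  refine E.integral_final_le p v
    (fun s => A * if v ∈ s.active ∧ 2 * (S \ s.avail).card < S.card then 1 else 0)
    (fun s => (s.gain v : ℝ)) (fun s => by positivity) (fun s => by positivity) fun x => ?_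
  refine Finset.sum_le_sum fun k _ => mul_le_mul_of_nonneg_left ?_ (by positivity)
  rw [integral_gain_update]
  have hle : ∀ ω, A * (if v ∈ (E.proc (Function.update x v (k, ω)) p).final.active ∧
        2 * (S \ (E.proc (Function.update x v (k, ω)) p).final.avail).card < S.card then 1 else 0 : ℝ)
      ≤ E.offerGain p x v k := by
    intro ω
    split_ifs with h
    · obtain ⟨h1, h2⟩ := h
      simp only [PState.active, Finset.mem_filter, Finset.mem_univ, true_and, E.final_update,
        Option.isSome_map] at h1
      obtain ⟨D, hD⟩ := Option.isSome_iff_exists.1 h1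
      have hf := E.final_update p x v k ω
      rw [hD] at hf
      have h3 := Proc.card_le_of_open (E.proc_valid _ p) (S := S) hS hf
      have hk : (E.proc (Function.update x v (k, ω)) p).thr v ≤ (E.l v + 1) * E.q v := by
        simp only [proc, Function.update_self]
        exact Nat.mul_le_mul_right _ (by omega)
      -- Fewer than half of `S` is taken and at most a quarter was lost before the opening, so at
      -- least a quarter is offered.
      have h4 : S.card ≤ 4 * (S ∩ D).card := by omega
      have h5 : (S.card : ℝ) / 4 ≤ E.optOn p v D := by
        have := h4.trans (Nat.mul_le_mul_left 4 (hS D))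
        have : (S.card : ℝ) ≤ 4 * E.optOn p v D := by exact_mod_cast this
        linarith
      have h6 := hg D (hMS.trans h5)
      simp only [offerGain, hD, Option.elim_some, mul_one]
      refine le_trans ?_ h6
      rw [hA, div_le_div_iff₀ (by positivity) (by positivity)]
      -- This quarter and the 4 in the guarantee of the packer make up the 16.
      have h7 : t / 4 ≤ min (E.optOn p v D : ℝ) M := le_min (by linarith) (by linarith)
      have : α * (t / 4) ≤ α * min (E.optOn p v D : ℝ) M := mul_le_mul_of_nonneg_left h7 hα
      have h8 : (0 : ℝ) ≤ e + 1 := by positivity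
      nlinarith
    · simpa using E.offerGain_nonneg p x v k
  refine (integral_mono ?_ (integrable_const _) hle).trans (by simp)
  exact integrable_comp_finite _ (fun ω => (E.proc (Function.update x v (k, ω)) p).final)
    (fun s => (measurable_update x).comp (measurable_const.prodMk measurable_id)
      (E.measurableSet_run p _ s))
    fun s => A * if v ∈ s.active ∧ 2 * (S \ s.avail).card < S.card then 1 else 0

end Ensemble

/-! ### Charging an allocation to the jobs scheduled by the ensemble -/

namespace Ensemble

variable {m n r : ℕ} {V : Type} [Fintype V] (E : Ensemble m n r V) [DecidableEq V] [Nonempty V]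

open Classical in
/-- In every run, the jobs of `S v`, `v ∈ I`, are taken by others, or `v` is open, or `v` is not
allowed any more. -/
lemma sum_le_pointwise (p : Loads m n r) (x : ∀ v, E.Seed v) (I : Finset V) (t : V → ℝ)
    (S : V → Finset (Fin n)) (hdisj : (I : Set V).PairwiseDisjoint S)
    (ht : ∀ v ∈ I, 0 ≤ t v)
    (hS : ∀ v ∈ I, ∀ D, (S v ∩ D).card ≤ E.optOn p v D) (htS : ∀ v ∈ I, t v ≤ (S v).card)
    (hthr : ∀ v ∈ I, 4 * ((E.l v + 1) * E.q v - 1) ≤ (S v).card) {K : ℝ}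
    (credit : ∀ s J : Finset V, J ⊆ I → (∀ v ∈ J, ¬ E.ok s v) →
      ∑ v ∈ J, t v ≤ K * ∑ v ∈ s, (E.q v : ℝ)) :
    ∑ v ∈ I, t v ≤ 2 * ∑ v, ((E.proc x p).final.gain v : ℝ) +
      ∑ v ∈ I, t v * (if v ∈ (E.proc x p).final.active ∧
        2 * (S v \ (E.proc x p).final.avail).card < (S v).card then 1 else 0) +
      K * ∑ v, (E.q v : ℝ) * (if v ∈ (E.proc x p).final.active then 1 else 0) := by
  set st := (E.proc x p).final with hst
  have h1 : ∑ v ∈ I, t v ≤ ∑ v ∈ I, (2 * ((S v \ st.avail).card : ℝ) +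
      t v * (if v ∈ st.active ∧ 2 * (S v \ st.avail).card < (S v).card then 1 else 0) +
      if ¬ E.ok st.active v then t v else 0) := by
    refine Finset.sum_le_sum fun v hv => ?_
    have ht0 := ht v hv
    have hts := htS v hv
    have hc : (0 : ℝ) ≤ ((S v \ st.avail).card : ℝ) := Nat.cast_nonneg _
    -- If at least half of `S v` is taken, twice the taken jobs pay for `t v`. Otherwise `v` is
    -- open, or it is blocked: a closed packer that is still allowed would leave fewer than `thr v`
    -- of these jobs, contradicting the bound on its largest threshold.
    by_cases h : 2 * (S v \ st.avail).card < (S v).card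
    · by_cases ha : v ∈ st.active
      · rw [if_pos ⟨ha, h⟩, mul_one]
        have : (0 : ℝ) ≤ if ¬ E.ok st.active v then t v else 0 := by split_ifs <;> simp [ht0]
        linarith
      · have hok : ¬ E.ok st.active v := by
          intro hok
          have hnone : st v = none := by
            simpa [PState.active] using ha
          have hcl := Proc.card_le_of_closed (E.proc_valid x p) (hS v hv) hnone hok
          have hk : (E.proc x p).thr v ≤ (E.l v + 1) * E.q v :=
            Nat.mul_le_mul_right _ (by omega)
          have := hthr v hv
          rw [← hst] at hcl
          omega
        rw [if_pos hok, if_neg (fun h => ha h.1)]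
        linarith
    · have : ((S v).card : ℝ) ≤ 2 * ((S v \ st.avail).card : ℝ) := by exact_mod_cast not_lt.1 h
      have : (0 : ℝ) ≤ if ¬ E.ok st.active v then t v else 0 := by split_ifs <;> simp [ht0]
      rw [if_neg (fun h' => h h'.2)]
      linarith
  have h2 : ∑ v ∈ I, ((S v \ st.avail).card : ℝ) ≤ ∑ v, (st.gain v : ℝ) := by
    have h3 := Proc.card_compl_avail (E.proc_valid x p)
    rw [← hst] at h3
    have h4 : ∑ v ∈ I, (S v \ st.avail).card ≤ (Finset.univ \ st.avail).card := by
      rw [← Finset.card_biUnion fun v hv v' hv' hne =>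
        (hdisj hv hv' hne).mono Finset.sdiff_subset Finset.sdiff_subset]
      refine Finset.card_le_card fun j hj => ?_
      obtain ⟨v, _, hj⟩ := Finset.mem_biUnion.1 hj
      exact Finset.mem_sdiff.2 ⟨Finset.mem_univ _, (Finset.mem_sdiff.1 hj).2⟩
    rw [h3] at h4
    exact_mod_cast h4
  have h5 : ∑ v, (E.q v : ℝ) * (if v ∈ st.active then 1 else 0) = ∑ v ∈ st.active, (E.q v : ℝ) := by
    simp [Finset.sum_ite_mem]
  have h6 := credit st.active (I.filter fun v => ¬ E.ok st.active v) (Finset.filter_subset _ _)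
    fun v hv => (Finset.mem_filter.1 hv).2
  rw [Finset.sum_filter] at h6
  rw [Finset.sum_add_distrib, Finset.sum_add_distrib, ← Finset.mul_sum] at h1
  rw [h5]
  linarith

/-- A lower bound for the expected number of jobs that an ensemble schedules. -/
lemma expected_bound (p : Loads m n r) {α M : ℝ} (hα : 0 ≤ α) (e : ℕ)
    (hq : ∀ v D, E.q v ≤ E.optOn p v D →
      α * E.q v / 2 ≤ (E.pk v).expectedCount (E.loads p v) D)
    (hg : ∀ v D, M / 2 ^ e ≤ E.optOn p v D →
      α * min (E.optOn p v D : ℝ) M / (4 * (e + 1)) ≤ (E.pk v).expectedCount (E.loads p v) D)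
    (I : Finset V) (t : V → ℝ)
    (S : V → Finset (Fin n)) (hdisj : (I : Set V).PairwiseDisjoint S)
    (ht : ∀ v ∈ I, 0 ≤ t v) (htM : ∀ v ∈ I, t v ≤ M)
    (hS : ∀ v ∈ I, ∀ D, (S v ∩ D).card ≤ E.optOn p v D) (htS : ∀ v ∈ I, t v ≤ (S v).card)
    (hthr : ∀ v ∈ I, 4 * ((E.l v + 1) * E.q v - 1) ≤ (S v).card)
    (hMS : ∀ v ∈ I, M / 2 ^ e ≤ (S v).card / 4) {K : ℝ} (hK : 0 ≤ K)
    (credit : ∀ s J : Finset V, J ⊆ I → (∀ v ∈ J, ¬ E.ok s v) →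
      ∑ v ∈ J, t v ≤ K * ∑ v ∈ s, (E.q v : ℝ)) :
    α * ∑ v ∈ I, t v ≤ (2 * α + 16 * (e + 1) + 4 * K) * E.alg.expectedCount p +
      α * K * ∑ v, E.q v * E.penalty v := by
  classical
  have hpt := fun x => E.sum_le_pointwise p x I t S hdisj ht hS htS hthr credit
  set μ := Measure.pi E.seedMeasure with hμ
  have hint := fun φ => E.integrable_final p φ
  have h1 : ∑ v ∈ I, t v ≤ 2 * ∑ v, ∫ x, ((E.proc x p).final.gain v : ℝ) ∂μ +
      ∑ v ∈ I, t v * ∫ x, (if v ∈ (E.proc x p).final.active ∧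
        2 * (S v \ (E.proc x p).final.avail).card < (S v).card then 1 else 0) ∂μ +
      K * ∑ v, (E.q v : ℝ) * ∫ x, (if v ∈ (E.proc x p).final.active then 1 else 0) ∂μ := by
    have h := integral_mono (μ := μ) (integrable_const (∑ v ∈ I, t v))
      (hint fun st => 2 * ∑ v, (st.gain v : ℝ) +
      ∑ v ∈ I, t v * (if v ∈ st.active ∧
        2 * (S v \ st.avail).card < (S v).card then 1 else 0) +
      K * ∑ v, (E.q v : ℝ) * (if v ∈ st.active then 1 else 0)) hpt
    rw [integral_const, integral_add (hint fun st => 2 * ∑ v, (st.gain v : ℝ) +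
      ∑ v ∈ I, t v * (if v ∈ st.active ∧
        2 * (S v \ st.avail).card < (S v).card then 1 else 0))
      (hint fun st => K * ∑ v, (E.q v : ℝ) * (if v ∈ st.active then 1 else 0)),
      integral_add (hint fun st => 2 * ∑ v, (st.gain v : ℝ))
        (hint fun st => ∑ v ∈ I, t v * (if v ∈ st.active ∧
        2 * (S v \ st.avail).card < (S v).card then 1 else 0)),
      integral_const_mul, integral_const_mul,
      integral_finsetSum _ (fun v _ => hint fun st => (st.gain v : ℝ)),
      integral_finsetSum _ (fun v _ => hint fun st => t v * (if v ∈ st.active ∧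
        2 * (S v \ st.avail).card < (S v).card then 1 else 0)),
      integral_finsetSum _ (fun v _ => hint fun st => (E.q v : ℝ) *
        (if v ∈ st.active then 1 else 0))] at h
    simpa only [integral_const_mul, probReal_univ, one_smul] using h
  have hG : E.alg.expectedCount p = ∑ v, ∫ x, ((E.proc x p).final.gain v : ℝ) ∂μ :=
    E.expectedCount_alg p
  have hG0 : ∀ v, 0 ≤ ∫ x, ((E.proc x p).final.gain v : ℝ) ∂μ := fun v =>
    integral_nonneg fun _ => Nat.cast_nonneg _
  -- The open packers of `I` repay their credits at the rate `α / (16 * (e + 1))`, and `h3` lets all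
  -- open packers repay their quotas at the rate `α / 4`, up to penalties.
  have h2 : α * ∑ v ∈ I, t v * ∫ x, (if v ∈ (E.proc x p).final.active ∧
        2 * (S v \ (E.proc x p).final.avail).card < (S v).card then 1 else 0) ∂μ ≤
      16 * (e + 1) * E.alg.expectedCount p := by
    rw [hG, Finset.mul_sum, Finset.mul_sum]
    refine (Finset.sum_le_sum fun v hv => ?_).trans (Finset.sum_le_sum_of_subset_of_nonneg
      (Finset.subset_univ I) fun v _ _ => mul_nonneg (by positivity) (hG0 v))
    have := E.open_packer_gain p hα (ht v hv) (htM v hv) e v (hg v) (S v) (hS v hv) (htS v hv)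
      (hthr v hv) (hMS v hv)
    have he : (0 : ℝ) < 16 * (e + 1) := by positivity
    rw [div_mul_eq_mul_div, div_le_iff₀ he] at this
    linarith
  have h3 : α * ∑ v, (E.q v : ℝ) * ∫ x, (if v ∈ (E.proc x p).final.active then 1 else 0) ∂μ ≤
      4 * E.alg.expectedCount p + α * ∑ v, E.q v * E.penalty v := by
    rw [hG, Finset.mul_sum, Finset.mul_sum, Finset.mul_sum, ← Finset.sum_add_distrib]
    refine Finset.sum_le_sum fun v _ => ?_
    have := E.opening_pays p hα v (hq v)
    rw [← hμ] at this
    linarith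
  have h4 := mul_le_mul_of_nonneg_left h1 hα
  have h5 := mul_le_mul_of_nonneg_left h3 hK
  rw [← hG] at h4
  linarith

end Ensemble

/-! ### From ensembles to online algorithms -/

section Jobs

variable {m n r : ℕ}

/-- The jobs that an allocation schedules on machine `i`. -/
def Alloc.jobs (a : Alloc m n r) (i : Fin m) : Finset (Fin n) :=
  Finset.univ.filter fun j => (a j).map Prod.fst = some i

lemma Alloc.sum_card_jobs (a : Alloc m n r) : ∑ i, (a.jobs i).card = a.count := by
  have h : (Finset.univ.filter fun j => (a j).isSome = true) = Finset.univ.biUnion a.jobs := by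
    ext j
    simp [Alloc.jobs, Option.isSome_iff_exists]
  rw [Alloc.count, h, Finset.card_biUnion]
  intro i _ i' _ hne
  rw [Function.onFun, Finset.disjoint_left]
  intro j hj hj'
  simp only [Alloc.jobs, Finset.mem_filter, Finset.mem_univ, true_and] at hj hj'
  rw [hj] at hj'
  exact hne (Option.some_injective _ hj')

lemma Alloc.disjoint_jobs (a : Alloc m n r) {i i' : Fin m} (h : i ≠ i') :
    Disjoint (a.jobs i) (a.jobs i') := by
  rw [Finset.disjoint_left]
  intro j hj hj'
  simp only [Alloc.jobs, Finset.mem_filter, Finset.mem_univ, true_and] at hj hj'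
  rw [hj] at hj'
  exact h (Option.some_injective _ hj')

lemma Alloc.card_jobs_inter_le {N : Fin m → (Fin n × Fin r → ℝ) → ℝ}
    (hN : ∀ i, IsMonotoneNorm (N i)) (p : Loads m n r) (a : Alloc m n r) (i : Fin m) (b : ℝ≥0)
    (h : machineLoad N p a i ≤ b) (D : Finset (Fin n)) :
    (a.jobs i ∩ D).card ≤ packOpt (N i) b (fun j k => p j i k) D := by
  let s : Sel n r := fun j => (a j).bind fun z => if z.1 = i then some z.2 else none
  have hs : ∀ j k, s j = some k ↔ a j = some (i, k) := by
    intro j k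
    simp only [s]
    rcases a j with _ | ⟨i', k'⟩
    · simp
    · simp only [Option.bind_some, Option.some.injEq, Prod.mk.injEq]
      split_ifs with h <;> simp [h]
  refine card_inter_le_packOpt (hN i) s ?_ fun j hj => ?_
  · refine le_trans (le_of_eq ?_) h
    unfold selLoad machineLoad Alloc.x
    congr 1
    funext jk
    simp only [hs]
  · simp only [Alloc.jobs, Finset.mem_filter, Finset.mem_univ, true_and] at hj
    obtain ⟨⟨i', k⟩, h1, h2⟩ := Option.map_eq_some_iff.1 hj
    simp only at h2
    subst h2
    exact Option.isSome_iff_exists.2 ⟨k, (hs j k).2 h1⟩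

lemma machineLoad_nonneg {N : Fin m → (Fin n × Fin r → ℝ) → ℝ}
    (hN : ∀ i, IsMonotoneNorm (N i)) (p : Loads m n r) (a : Alloc m n r) (i : Fin m) :
    0 ≤ machineLoad N p a i := (hN i).nonneg _

lemma exists_opt {f : (Fin m → ℝ) → ℝ} {N : Fin m → (Fin n × Fin r → ℝ) → ℝ} {B : ℝ≥0}
    {p : Loads m n r} (h : 0 < opt f N B p) :
    ∃ a : Alloc m n r, f (machineLoad N p a) ≤ B ∧ a.count = opt f N B p := by
  classical
  have hne : (Finset.univ.filter fun a : Alloc m n r => f (machineLoad N p a) ≤ B).Nonempty := by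
    by_contra hne
    rw [Finset.not_nonempty_iff_eq_empty] at hne
    unfold opt at h
    have : (Finset.univ.filter fun a : Alloc m n r => f (machineLoad N p a) ≤ B).sup Alloc.count = 0 := by
      rw [hne]; rfl
    omega
  obtain ⟨a, ha, h2⟩ := Finset.exists_mem_eq_sup _ hne Alloc.count
  refine ⟨a, by simpa using ha, ?_⟩
  unfold opt
  rw [h2]

end Jobs

/-- Norm-Packing solvers on the machines give an online algorithm for the whole problem. The packer
`v` runs on machine `mach v` with budget `b v`, it may be opened if `ok s v` holds for the set `s` of
open packers. The number of jobs is compared with a given allocation `a`. -/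
theorem exists_algorithm {m n r : ℕ} {f : (Fin m → ℝ) → ℝ} (hf : IsMonotoneNorm f)
    {N : Fin m → (Fin n × Fin r → ℝ) → ℝ} (hN : ∀ i, IsMonotoneNorm (N i)) {α c : ℝ}
    (hs : ∀ i, NormPackSolvable (N i) α c) (hα : 0 ≤ α) (hc : 1 ≤ c) {V : Type} [Fintype V]
    [Nonempty V] [DecidableEq V]
    (mach : V → Fin m) (b : V → ℝ≥0) (q l : V → ℕ) (hq : ∀ v, 1 ≤ q v)
    (ok : Finset V → V → Prop) (hok : ∀ s s' v, s ⊆ s' → ok s' v → ok s v)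
    (Q : Finset V → Prop) (hQ0 : Q ∅) (hQs : ∀ s v, Q s → v ∉ s → ok s v → Q (insert v s))
    {L : ℝ} (hQL : ∀ s, Q s → f (fun i => ∑ v ∈ s with mach v = i, (b v : ℝ)) ≤ L)
    {M : ℝ} (hM : 0 < M) (e : ℕ) :
    ∃ A : OnlineAlg m n r, (∀ p ω, f (machineLoad N p (A.run ω p)) ≤ c * L) ∧
      ∀ (p : Loads m n r) (a : Alloc m n r) (I : Finset V) (t : V → ℝ) (K : ℝ),
        (I : Set V).InjOn mach → (∀ v ∈ I, machineLoad N p a (mach v) ≤ b v) →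
        (∀ v ∈ I, 0 ≤ t v) → (∀ v ∈ I, t v ≤ M) → (∀ v ∈ I, t v ≤ (a.jobs (mach v)).card) →
        (∀ v ∈ I, 4 * ((l v + 1) * q v - 1) ≤ (a.jobs (mach v)).card) →
        (∀ v ∈ I, M / 2 ^ e ≤ ((a.jobs (mach v)).card : ℝ) / 4) → 0 ≤ K →
        (∀ s J : Finset V, J ⊆ I → (∀ v ∈ J, ¬ ok s v) → ∑ v ∈ J, t v ≤ K * ∑ v ∈ s, (q v : ℝ)) →
        α * ∑ v ∈ I, t v ≤ (2 * α + 16 * (e + 1) + 4 * K) * A.expectedCount p +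
          α * K * ∑ v, (q v : ℝ) * (if q v = 1 then 0 else 1 / (2 ^ (l v + 1) - 1) : ℝ) := by
  classical
  have hpk : ∀ v, ∃ P : Packer n r, (∀ ω p D, selLoad (N (mach v)) p (P.run ω p D) ≤ c * b v) ∧
      (∀ p D, q v ≤ packOpt (N (mach v)) (b v) p D → α * q v / 2 ≤ P.expectedCount p D) ∧
      (∀ p D, M / 2 ^ e ≤ packOpt (N (mach v)) (b v) p D →
        α * min (packOpt (N (mach v)) (b v) p D : ℝ) M / (4 * (e + 1)) ≤ P.expectedCount p D) := by
    intro v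
    obtain ⟨P, h1, h2⟩ := exists_packer (hN (mach v)) (hs (mach v)) (b v)
      -- The guess `q v` has probability 1/2 and makes opening pay off. The other half is spread
      -- over the scales `M / 2 ^ k`, `k ≤ e`, for offers of unknown size.
      (fun o : Option (Fin (e + 1)) => o.elim (q v : ℝ) fun k => M / 2 ^ k.val)
      (fun o => o.elim (1 / 2) fun _ => 1 / (2 * (e + 1)))
      (fun o => by rcases o with _ | k <;> simp only [Option.elim] <;> positivity)
      (by
        rw [Fintype.sum_option]
        simp only [Option.elim, Finset.sum_const, Finset.card_univ, Fintype.card_fin, nsmul_eq_mul]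
        have : ((e : ℝ) + 1) ≠ 0 := by positivity
        push_cast
        field_simp
        norm_num)
    refine ⟨P, h1, fun p D h => ?_, fun p D h => ?_⟩
    · have := h2 p D none (by simpa using h)
      simp only [Option.elim] at this
      linarith
    · set F := packOpt (N (mach v)) (b v) p D
      -- The first scale below `F` is within a factor 2 of `min F M`.
      have hex : ∃ k, M / 2 ^ k ≤ (F : ℝ) := ⟨e, h⟩
      have hk := Nat.find_spec hex
      have hke : Nat.find hex ≤ e := Nat.find_min' hex h
      have := h2 p D (some ⟨Nat.find hex, by omega⟩) (by simpa using hk)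
      simp only [Option.elim] at this
      refine le_trans ?_ this
      have hmin : min (F : ℝ) M ≤ 2 * (M / 2 ^ Nat.find hex) := by
        rcases Nat.eq_zero_or_pos (Nat.find hex) with h0 | h0
        · rw [h0]
          refine (min_le_right _ _).trans ?_
          simp only [pow_zero, div_one]
          linarith
        · have h3 := Nat.find_min hex (Nat.sub_lt h0 one_pos)
          refine (min_le_left _ _).trans ((not_le.1 h3).le.trans (le_of_eq ?_))
          obtain ⟨k, hk'⟩ := Nat.exists_eq_succ_of_ne_zero h0.ne'
          rw [hk', Nat.succ_sub_one, pow_succ]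
          field_simp
      have he : (0 : ℝ) < e + 1 := by positivity
      have h4 := mul_le_mul_of_nonneg_left hmin hα
      rw [div_mul_eq_mul_div, one_mul, div_le_div_iff₀ (by positivity) (by positivity)]
      nlinarith
  choose pk hp1 hp2 hp3 using hpk
  let E : Ensemble m n r V := ⟨N, hN, mach, b, q, hq, l, pk, ok, hok⟩
  refine ⟨E.alg, fun p x => ?_, fun p a I t K hinj hb ht htM htS hthr hMS hK credit => ?_⟩
  · have h1 : ∀ i, machineLoad N p ((E.proc x p).final.alloc mach) i ≤
        ∑ v ∈ (E.proc x p).final.active with mach v = i, c * (b v : ℝ) := by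
      intro i
      refine PState.machineLoad_le _ mach N hN p _ (fun v D a h => ?_) i
      obtain ⟨u, _, _, _, h4⟩ := Proc.final_some ⟨_, h⟩
      rw [h] at h4
      simp only [Option.some.injEq, Prod.mk.injEq] at h4
      rw [h4.2]
      exact hp1 v _ _ _
    have h2 := hQL _ (Proc.active_induction (P := E.proc x p) hQ0 hQs (n * Fintype.card V))
    calc f (machineLoad N p ((E.proc x p).final.alloc mach))
        ≤ f (c • fun i => ∑ v ∈ (E.proc x p).final.active with mach v = i, (b v : ℝ)) := by
          refine hf.mono _ _ (fun i => machineLoad_nonneg hN p _ i) fun i => (h1 i).trans ?_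
          simp [Finset.mul_sum]
      _ ≤ c * L := by
          rw [hf.smul_of_nonneg (by linarith)]
          exact mul_le_mul_of_nonneg_left h2 (by linarith)
  · refine E.expected_bound p hα e (fun v D => hp2 v _ D) (fun v D => hp3 v _ D) I t
      (fun v => a.jobs (mach v)) (fun v hv v' hv' hne => a.disjoint_jobs fun h => hne
        (hinj hv hv' h)) ht htM (fun v hv D => a.card_jobs_inter_le hN p (mach v) (b v) (hb v hv) D)
      htS hthr hMS hK credit

lemma IsMonotoneNorm.weighted {m : ℕ} {g : (Fin m → ℝ) → ℝ} (hg : IsMonotoneNorm g)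
    {w : Fin m → ℝ} (hw : ∀ i, 0 < w i) : IsMonotoneNorm (weighted w g) where
  add_le x y := by
    refine le_trans (le_of_eq ?_) (hg.add_le _ _)
    unfold SchedPack.weighted
    congr 1
    funext i
    simp [mul_add]
  smul t x := by
    unfold SchedPack.weighted
    rw [← hg.smul]
    congr 1
    funext i
    simp only [Pi.smul_apply, smul_eq_mul]
    ring
  eq_zero x h := by
    funext i
    have := congrFun (hg.eq_zero _ h) i
    simpa [(hw i).ne'] using this
  mono x y hx hxy := hg.mono _ _ (fun i => mul_nonneg (hw i).le (hx i))
    fun i => mul_le_mul_of_nonneg_left (hxy i) (hw i).le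

/-- It suffices to consider positive lower bounds on the optimum. -/
lemma schedPackSolvable_of_pos {m n r : ℕ} {f : (Fin m → ℝ) → ℝ} (hf : IsMonotoneNorm f)
    {N : Fin m → (Fin n × Fin r → ℝ) → ℝ} (hN : ∀ i, IsMonotoneNorm (N i)) {α c : ℝ}
    (hα : 0 ≤ α) (hα1 : α ≤ 1) (hc : 1 ≤ c)
    (h : ∀ (B : ℝ≥0) (M : ℝ), 0 < M → ∃ A : OnlineAlg m n r,
      (∀ p ω, f (machineLoad N p (A.run ω p)) ≤ c * B) ∧
      ∀ p (a : Alloc m n r), f (machineLoad N p a) ≤ B → M ≤ a.count → α * M ≤ A.expectedCount p) :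
    SchedPackSolvable f N α c := by
  refine ⟨hα, hα1, hc, fun B M => ?_⟩
  rcases le_or_gt M 0 with hM | hM
  · refine ⟨⟨Unit, Measure.dirac (), fun _ _ _ => none, fun _ _ _ _ _ => rfl,
      fun _ a => MeasurableSet.const _⟩, fun p ω => ?_, fun p _ => ?_⟩
    · have : machineLoad N p (fun _ => none) = 0 := by
        funext i
        have h0 : (fun jk : Fin n × Fin r => Alloc.x (m := m) (fun _ => none) i jk.1 jk.2 *
          (p jk.1 i jk.2 : ℝ)) = 0 := by
          funext jk
          simp [Alloc.x]
        unfold machineLoad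
        rw [h0]
        exact (hN i).zero
      rw [this, hf.zero]
      have := B.2
      exact mul_nonneg (by linarith) this
    · refine le_trans (mul_nonpos_of_nonneg_of_nonpos hα hM) ?_
      exact integral_nonneg fun _ => Nat.cast_nonneg _
  · obtain ⟨A, h1, h2⟩ := h B M hM
    refine ⟨A, h1, fun p hp => ?_⟩
    have h0 : 0 < opt f N B p := by
      have := hM.trans_le hp
      exact_mod_cast this
    obtain ⟨a, h3, h4⟩ := exists_opt h0
    exact h2 p a h3 (by rw [h4]; exact hp)

/-! ### Geometric levels of budgets -/

/-- Online algorithms whose packers on a machine have the budgets `β`, `β / 2`, …, `β / 2 ^ T`. -/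
theorem exists_level_algorithm {m n r : ℕ} [NeZero m] {g : (Fin m → ℝ) → ℝ} (hg : IsMonotoneNorm g)
    {w : Fin m → ℝ} (hw : ∀ i, 0 < w i)
    {N : Fin m → (Fin n × Fin r → ℝ) → ℝ} (hN : ∀ i, IsMonotoneNorm (N i)) {α c : ℝ}
    (hs : ∀ i, NormPackSolvable (N i) α c) (hα : 0 ≤ α) (hc : 1 ≤ c) {β : ℝ} (hβ : 0 ≤ β)
    (T l e : ℕ) (q : Fin (T + 1) → ℝ) (hq : ∀ s, 0 ≤ q s) {X : ℝ} (hqX : ∀ s, q s ≤ X)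
    (ok : Finset (Fin m × Fin (T + 1)) → Fin m × Fin (T + 1) → Prop)
    (hok : ∀ s s' v, s ⊆ s' → ok s' v → ok s v)
    (Q : Finset (Fin m × Fin (T + 1)) → Prop) (hQ0 : Q ∅)
    (hQs : ∀ s v, Q s → v ∉ s → ok s v → Q (insert v s)) {L : ℝ}
    (hQL : ∀ s, Q s → g (fun i => ∑ v ∈ s with v.1 = i, β / 2 ^ v.2.val) ≤ L)
    {M : ℝ} (hM : 0 < M) :
    ∃ A : OnlineAlg m n r, (∀ p ω, weighted w g (machineLoad N p (A.run ω p)) ≤ c * L) ∧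
      ∀ (p : Loads m n r) (a : Alloc m n r) (lev : Fin m → Fin (T + 1)) (J : Finset (Fin m))
        (t : Fin m → ℝ) (K : ℝ),
        (∀ i ∈ J, w i * machineLoad N p a i ≤ β / 2 ^ (lev i).val) →
        (∀ i ∈ J, 0 ≤ t i) → (∀ i ∈ J, t i ≤ M) → (∀ i ∈ J, t i ≤ (a.jobs i).card) →
        (∀ i ∈ J, 4 * ((l + 1) * q (lev i)) ≤ (a.jobs i).card) →
        (∀ i ∈ J, M / 2 ^ e ≤ ((a.jobs i).card : ℝ) / 4) → 0 ≤ K →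
        (∀ s : Finset (Fin m × Fin (T + 1)), ∀ J' : Finset (Fin m), J' ⊆ J →
          (∀ i ∈ J', ¬ ok s (i, lev i)) → ∑ i ∈ J', t i ≤ K * ∑ v ∈ s, q v.2 / 2) →
        α * ∑ i ∈ J, t i ≤ (2 * α + 16 * (e + 1) + 4 * K) * A.expectedCount p +
          α * (K * (m * (T + 1)) * X / (2 ^ (l + 1) - 1)) := by
  classical
  have hp := geom_pos l
  have hb : ∀ v : Fin m × Fin (T + 1), 0 ≤ β / 2 ^ v.2.val / w v.1 := fun v => by
    have := hw v.1
    positivity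
  -- Quotas must be positive integers. The rounding loses at most a factor 2, and it exceeds `q`
  -- only when the rounded quota is 1.
  let qn : Fin m × Fin (T + 1) → ℕ := fun v => max 1 ⌊q v.2⌋₊
  have hqn : ∀ v, q v.2 / 2 ≤ qn v := by
    intro v
    have h1 : (1 : ℝ) ≤ qn v := by exact_mod_cast le_max_left _ _
    have h2 : ((⌊q v.2⌋₊ : ℕ) : ℝ) ≤ qn v := by exact_mod_cast le_max_right _ _
    have := Nat.lt_floor_add_one (q v.2)
    linarith
  have hqn' : ∀ v, qn v ≠ 1 → (qn v : ℝ) ≤ q v.2 := by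
    intro v hv
    have : qn v = ⌊q v.2⌋₊ := by
      simp only [qn] at hv ⊢
      omega
    rw [this]
    exact Nat.floor_le (hq v.2)
  obtain ⟨A, h1, h2⟩ := exists_algorithm (hg.weighted hw) hN hs hα hc (V := Fin m × Fin (T + 1))
    Prod.fst (fun v => Real.toNNReal (β / 2 ^ v.2.val / w v.1)) qn
    -- With quota 1 the threshold is deterministically 1: the penalty vanishes, and the lower bound
    -- required on the number of jobs becomes trivial. The budgets are divided by the weights so
    -- that weighted loads have levels `β / 2 ^ s`.
    (fun v => if qn v = 1 then 0 else l) (fun v => le_max_left _ _) ok hok Q hQ0 hQs (L := L)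
    (fun s hs => by
      refine le_trans (le_of_eq ?_) (hQL s hs)
      unfold weighted
      congr 1
      funext i
      rw [Finset.mul_sum]
      refine Finset.sum_congr rfl fun v hv => ?_
      rw [Real.coe_toNNReal _ (hb v), ← (Finset.mem_filter.1 hv).2, mul_div_cancel₀ _ (hw v.1).ne'])
    hM e
  refine ⟨A, h1, fun p a lev J t K hload ht htM htS hthr hMS hK credit => ?_⟩
  have hinj : Function.Injective fun i => (i, lev i) := fun i i' h => congrArg Prod.fst h
  have key := h2 p a (J.image fun i => (i, lev i)) (fun v => t v.1) K ?_ ?_ ?_ ?_ ?_ ?_ ?_ hK ?_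
  · rw [Finset.sum_image fun i _ i' _ h => hinj h] at key
    refine key.trans (add_le_add le_rfl ?_)
    rw [mul_assoc α]
    refine mul_le_mul_of_nonneg_left ?_ hα
    rw [mul_assoc K, mul_div_assoc]
    refine mul_le_mul_of_nonneg_left ?_ hK
    have hX : 0 ≤ X := (hq 0).trans (hqX 0)
    have : ∀ v : Fin m × Fin (T + 1), (qn v : ℝ) *
        (if qn v = 1 then 0 else 1 / (2 ^ ((if qn v = 1 then 0 else l) + 1) - 1) : ℝ) ≤
          X / (2 ^ (l + 1) - 1) := by
      intro v
      split_ifs with h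
      · simp only [mul_zero]; positivity
      · rw [mul_one_div]
        exact div_le_div_of_nonneg_right ((hqn' v h).trans (hqX _)) hp.le
    refine (Finset.sum_le_sum fun v _ => this v).trans (le_of_eq ?_)
    rw [Finset.sum_const, Finset.card_univ, Fintype.card_prod, Fintype.card_fin, Fintype.card_fin,
      nsmul_eq_mul]
    push_cast
    ring
  · intro v hv v' hv' h
    obtain ⟨i, _, rfl⟩ := Finset.mem_image.1 (Finset.mem_coe.1 hv)
    obtain ⟨i', _, rfl⟩ := Finset.mem_image.1 (Finset.mem_coe.1 hv')
    simp only at h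
    rw [h]
  · refine Finset.forall_mem_image.2 fun i hi => ?_
    rw [Real.coe_toNNReal _ (hb _), le_div_iff₀ (hw i), mul_comm]
    exact hload i hi
  · exact Finset.forall_mem_image.2 ht
  · exact Finset.forall_mem_image.2 htM
  · exact Finset.forall_mem_image.2 htS
  · refine Finset.forall_mem_image.2 fun i hi => ?_
    by_cases h : qn (i, lev i) = 1
    · simp [h]
    · have h3 := hqn' _ h
      have h4 := hthr i hi
      have : 4 * (((l : ℝ) + 1) * qn (i, lev i)) ≤ (a.jobs i).card := by
        refine le_trans ?_ h4
        have : (0 : ℝ) ≤ l + 1 := by positivity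
        have := mul_le_mul_of_nonneg_left h3 this
        linarith
      have : 4 * ((l + 1) * qn (i, lev i)) ≤ (a.jobs i).card := by exact_mod_cast this
      simp only [h, if_false]
      omega
  · exact Finset.forall_mem_image.2 hMS
  · intro s J' hJ' hno
    have h3 : J' = (J'.image Prod.fst).image fun i => (i, lev i) := by
      ext v
      constructor
      · intro hv
        obtain ⟨i, _, rfl⟩ := Finset.mem_image.1 (hJ' hv)
        exact Finset.mem_image.2 ⟨i, Finset.mem_image.2 ⟨_, hv, rfl⟩, rfl⟩
      · intro hv
        obtain ⟨i, hi, rfl⟩ := Finset.mem_image.1 hv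
        obtain ⟨v', hv', rfl⟩ := Finset.mem_image.1 hi
        obtain ⟨i', _, rfl⟩ := Finset.mem_image.1 (hJ' hv')
        exact hv'
    have h4 := credit s (J'.image Prod.fst) ?_ ?_
    · rw [h3, Finset.sum_image fun i _ i' _ h => hinj h]
      refine h4.trans (mul_le_mul_of_nonneg_left (Finset.sum_le_sum fun v _ => hqn v) hK)
    · intro i hi
      obtain ⟨v, hv, rfl⟩ := Finset.mem_image.1 hi
      obtain ⟨i', hi', rfl⟩ := Finset.mem_image.1 (hJ' hv)
      exact hi'
    · intro i hi
      obtain ⟨v, hv, rfl⟩ := Finset.mem_image.1 hi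
      have h5 := hno v hv
      obtain ⟨i', _, rfl⟩ := Finset.mem_image.1 (hJ' hv)
      exact h5

/-- The level of a load `y ≤ β`: the largest `s ≤ T` with `y ≤ β / 2 ^ s`. -/
lemma exists_level {β y : ℝ} (hy : y ≤ β) (T : ℕ) :
    ∃ s : Fin (T + 1), y ≤ β / 2 ^ s.val ∧ (s.val < T → β / 2 ^ (s.val + 1) < y) := by
  classical
  refine ⟨⟨Nat.findGreatest (fun s => y ≤ β / 2 ^ s) T, Nat.lt_succ_of_le (Nat.findGreatest_le T)⟩,
    ?_, fun h => ?_⟩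
  · exact Nat.findGreatest_spec (P := fun s => y ≤ β / 2 ^ s) (Nat.zero_le T) (by simpa using hy)
  · exact not_le.1 (Nat.findGreatest_is_greatest (P := fun s => y ≤ β / 2 ^ s)
      (Nat.lt_succ_self _) h)

/-- A sum of distinct levels is at most twice the largest of them. -/
lemma exists_sum_levels_le {T : ℕ} {β : ℝ} (hβ : 0 ≤ β) (A : Finset (Fin (T + 1)))
    (hA : A.Nonempty) : ∃ k ∈ A, ∑ s ∈ A, β / 2 ^ s.val ≤ 2 * (β / 2 ^ k.val) := by
  refine ⟨A.min' hA, A.min'_mem hA, ?_⟩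
  set k := A.min' hA
  have h1 : ∑ s ∈ A, β / 2 ^ s.val ≤ ∑ s ∈ Finset.Ico k.val (T + 1), β / 2 ^ s := by
    refine (Finset.sum_map A Fin.valEmbedding fun s : ℕ => β / 2 ^ s).symm.le.trans ?_
    refine Finset.sum_le_sum_of_subset_of_nonneg (fun s hs => ?_) fun s _ _ => by positivity
    obtain ⟨i, hi, rfl⟩ := Finset.mem_map.1 hs
    exact Finset.mem_Ico.2 ⟨A.min'_le i hi, i.2⟩
  refine h1.trans ?_
  rw [Finset.sum_Ico_eq_sum_range]
  have h2 : ∀ i, β / 2 ^ (k.val + i) = β / 2 ^ k.val * (1 / 2) ^ i := fun i => by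
    rw [pow_add, one_div, inv_pow]
    field_simp
  simp only [h2]
  rw [← Finset.mul_sum, mul_comm]
  exact mul_le_mul_of_nonneg_right (sum_geometric_two_le _) (by positivity)

lemma sum_filter_fst {m T : ℕ} (s : Finset (Fin m × Fin (T + 1))) (i : Fin m) (F : Fin (T + 1) → ℝ) :
    ∑ v ∈ s with v.1 = i, F v.2 = ∑ k with (i, k) ∈ s, F k := by
  refine Finset.sum_nbij' Prod.snd (fun k => (i, k)) ?_ ?_ ?_ ?_ ?_
  · rintro ⟨i', k⟩ hv
    obtain ⟨h1, rfl⟩ := Finset.mem_filter.1 hv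
    simpa using h1
  · intro k hk
    simpa using hk
  · rintro ⟨i', k⟩ hv
    obtain ⟨h1, rfl⟩ := Finset.mem_filter.1 hv
    rfl
  · intro k _; rfl
  · intro v _; rfl

/-- Minimality of the exponent gives `clog ≤ 1 + log m / log 2 ≤ 2 * log m / log 2` for `m ≥ 2`, and
`2 / log 2 < 3`. -/
lemma clog_le_log {m : ℕ} (hm : 2 ≤ m) : (Nat.clog 2 m : ℝ) ≤ 3 * Real.log m := by
  have h1 : 2 ^ (Nat.clog 2 m - 1) < m := Nat.pow_pred_clog_lt_self (by norm_num) (by omega)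
  have hpos : 0 < Nat.clog 2 m := Nat.clog_pos (by norm_num) hm
  have h2 : ((2 : ℝ) ^ (Nat.clog 2 m - 1)) ≤ m := by exact_mod_cast h1.le
  have h3 := Real.log_le_log (by positivity) h2
  rw [Real.log_pow, Nat.cast_sub hpos] at h3
  have h4 : Real.log 2 ≤ Real.log m := Real.log_le_log (by norm_num) (by exact_mod_cast hm)
  have h5 := Real.log_two_gt_d9
  have h6 : (1 : ℝ) ≤ Nat.clog 2 m := by exact_mod_cast hpos
  push_cast at h3
  nlinarith

lemma one_half_le_log {m : ℕ} (hm : 2 ≤ m) : 1 / 2 ≤ Real.log m := by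
  have h4 : Real.log 2 ≤ Real.log m := Real.log_le_log (by norm_num) (by exact_mod_cast hm)
  have h5 := Real.log_two_gt_d9
  linarith

/-! ### Norms comparable to an additive constraint: one logarithm -/

namespace IsMonotoneNorm

variable {m : ℕ} {g : (Fin m → ℝ) → ℝ}

lemma apply_single (hg : IsMonotoneNorm g) (i : Fin m) (y : ℝ) :
    g (Pi.single i y) = |y| * g (Pi.single i 1) := by
  rw [← hg.smul, ← Pi.single_smul]
  simp

lemma le_sum (hg : IsMonotoneNorm g) {κ : ℝ} (h1 : ∀ i, g (Pi.single i 1) = κ) (y : Fin m → ℝ) :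
    g y ≤ ∑ i, |y i| * κ := by
  have h := hg.sum_le Finset.univ fun i => (Pi.single i (y i) : Fin m → ℝ)
  rw [Finset.univ_sum_single] at h
  refine h.trans (le_of_eq (Finset.sum_congr rfl fun i _ => ?_))
  rw [hg.apply_single, h1]

lemma mul_single_le (hg : IsMonotoneNorm g) {y : Fin m → ℝ} (hy : 0 ≤ y) (i : Fin m) :
    y i * g (Pi.single i 1) ≤ g y := by
  have := hg.mono (Pi.single i (y i)) y (Pi.single_nonneg.2 (hy i)) ?_
  · rwa [hg.apply_single, abs_of_nonneg (hy i)] at this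
  · intro j
    by_cases h : j = i
    · subst h; simp
    · simpa [h] using hy j

end IsMonotoneNorm

set_option maxHeartbeats 1000000 in
/-- If a norm is comparable to the condition `∑ i, H (y i) ≤ 1`, then only a factor `log m` is lost. -/
theorem solvable_of_additive {m n r : ℕ} (hm : 2 ≤ m) {g : (Fin m → ℝ) → ℝ} (hg : IsMonotoneNorm g)
    (hg1 : ∀ i, g (Pi.single i 1) = 1) {H : ℝ → ℝ} (H0 : H 0 = 0) (Hnn : ∀ y, 0 ≤ H y)
    (Hmono : ∀ x y, 0 ≤ x → x ≤ y → H x ≤ H y)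
    (h1 : ∀ y : Fin m → ℝ, 0 ≤ y → g y ≤ 1 → ∑ i, H (y i) ≤ 1)
    (h2 : ∀ y : Fin m → ℝ, 0 ≤ y → ∑ i, H (y i) ≤ 2 → g y ≤ 3)
    {w : Fin m → ℝ} (hw : ∀ i, 0 < w i)
    {N : Fin m → (Fin n × Fin r → ℝ) → ℝ} (hN : ∀ i, IsMonotoneNorm (N i)) {α c : ℝ}
    (hs : ∀ i, NormPackSolvable (N i) α c) :
    SchedPackSolvable (weighted w g) N (1 / 10800 * α / Real.log m) (13 * c) := by
  classical
  have : NeZero m := ⟨by omega⟩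
  obtain ⟨hα, hα1, hc, -⟩ := hs 0
  have hlog := one_half_le_log hm
  have hlog0 : 0 < Real.log m := by linarith
  have hm0 : (0 : ℝ) < m := by exact_mod_cast (by omega : 0 < m)
  refine schedPackSolvable_of_pos (hg.weighted hw) hN (by positivity) ?_ (by linarith) ?_
  · rw [div_le_one hlog0]; linarith
  intro B M hM
  set T := Nat.clog 2 m with hT
  have hmT : (m : ℝ) ≤ 2 ^ T := by exact_mod_cast Nat.le_pow_clog (by norm_num) m
  have hT1 : 1 ≤ T := Nat.clog_pos (by norm_num) hm
  have hH1 : H 1 ≤ 1 := by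
    have h := h1 (Pi.single 0 1) (Pi.single_nonneg.2 zero_le_one) (hg1 0).le
    refine le_trans ?_ h
    have := Finset.single_le_sum (f := fun i => H ((Pi.single 0 1 : Fin m → ℝ) i))
      (fun i _ => Hnn _) (Finset.mem_univ 0)
    simpa using this
  -- The cost of a level. A load at level `s < T` exceeds `B / 2 ^ (s + 1)`, whence the argument of
  -- `H`. The floor `1 / m` adds at most 1 over all machines, and level `T` collects the loads of at
  -- most `B / m`.
  let η : Fin (T + 1) → ℝ := fun s =>
    if s.val < T then max (H (1 / 2 ^ (s.val + 1))) (1 / m) else 1 / m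
  have hm1 : 1 / (m : ℝ) ≤ 1 := by
    rw [div_le_one hm0]; exact_mod_cast (by omega : 1 ≤ m)
  have hη1 : ∀ s, η s ≤ 1 := by
    intro s
    simp only [η]
    split_ifs
    · refine max_le ((Hmono _ 1 (by positivity) ?_).trans hH1) hm1
      rw [div_le_one (by positivity)]
      exact one_le_pow₀ (by norm_num)
    · exact hm1
  have hηm : ∀ s, 1 / m ≤ η s := by
    intro s
    simp only [η]
    split_ifs
    · exact le_max_right _ _
    · exact le_rfl
  have hη0 : ∀ s, 0 < η s := fun s => (by positivity : 0 < 1 / (m : ℝ)).trans_le (hηm s)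
  -- Then `2 ^ (l + 1) = 16 * 4 ^ T` dominates `m * (T + 1)`, and all penalties together are at most
  -- `M / 4`.
  set l := 2 * T + 3 with hl
  have hl0 : (0 : ℝ) < (l : ℝ) + 1 := by positivity
  have hB : (0 : ℝ) ≤ B := B.2
  have hQL : ∀ s : Finset (Fin m × Fin (T + 1)), ∑ u ∈ s, η u.2 < 2 →
      g (fun i => ∑ v ∈ s with v.1 = i, (B : ℝ) / 2 ^ v.2.val) ≤ 13 * B := by
    intro s hQ
    let K : Fin m → Finset (Fin (T + 1)) := fun i => Finset.univ.filter fun k => (i, k) ∈ s ∧ k.val < T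
    have hK : ∀ i, ∃ z : ℝ, 0 ≤ z ∧ (∑ k ∈ K i, (B : ℝ) / 2 ^ k.val) ≤ 4 * (B * z) ∧
        H z ≤ ∑ k ∈ K i, η k := by
      intro i
      rcases (K i).eq_empty_or_nonempty with h | h
      · exact ⟨0, le_rfl, by simp [h], by simp [h, H0]⟩
      · obtain ⟨k, hk, hle⟩ := exists_sum_levels_le hB (K i) h
        -- With `k` the largest open budget on machine `i`, the sum is at most `2 * B / 2 ^ k = 4 *
        -- B * z`, and `H z` is covered by the cost of that one level.
        refine ⟨1 / 2 ^ (k.val + 1), by positivity, hle.trans (le_of_eq ?_), ?_⟩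
        · rw [pow_succ]
          field_simp
          ring
        · refine le_trans ?_ (Finset.single_le_sum (fun k _ => (hη0 k).le) hk)
          have := (Finset.mem_filter.1 hk).2.2
          simp only [η, this, if_true]
          exact le_max_left _ _
    choose z hz0 hz1 hz2 using hK
    have hz3 : g z ≤ 3 := by
      refine h2 z hz0 ?_
      refine (Finset.sum_le_sum fun i _ => hz2 i).trans (le_trans ?_ hQ.le)
      have : ∑ u ∈ s, η u.2 = ∑ i, ∑ k with (i, k) ∈ s, η k := by
        rw [← Finset.sum_fiberwise s Prod.fst]
        exact Finset.sum_congr rfl fun i _ => sum_filter_fst s i η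
      rw [this]
      refine Finset.sum_le_sum fun i _ => Finset.sum_le_sum_of_subset_of_nonneg ?_
        fun k _ _ => (hη0 k).le
      intro k hk
      simp only [K, Finset.mem_filter, Finset.mem_univ, true_and] at hk ⊢
      exact hk.1
    -- The factor 13 is `4 * 3 + 1`: the levels below `T` contribute `4 * B * z` with `g z ≤ 3`, the
    -- last level at most `B / m` on each of `m` machines.
    have hle : (fun i => ∑ v ∈ s with v.1 = i, (B : ℝ) / 2 ^ v.2.val) ≤
        (4 * (B : ℝ)) • z + fun _ => (B : ℝ) / m := by
      intro i
      simp only [Pi.add_apply, Pi.smul_apply, smul_eq_mul]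
      rw [sum_filter_fst s i fun k => (B : ℝ) / 2 ^ k.val]
      have h3 := Finset.sum_filter_add_sum_filter_not (Finset.univ.filter fun k => (i, k) ∈ s)
        (fun k : Fin (T + 1) => k.val < T) fun k => (B : ℝ) / 2 ^ k.val
      rw [← h3, Finset.filter_filter]
      refine add_le_add ((hz1 i).trans (by linarith)) ?_
      have h4 : ∀ k ∈ ((Finset.univ.filter fun k => (i, k) ∈ s).filter fun k : Fin (T + 1) =>
          ¬ k.val < T), k = Fin.last T := by
        intro k hk
        have := (Finset.mem_filter.1 hk).2
        ext
        simp only [Fin.val_last]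
        omega
      calc _ ≤ ∑ k ∈ {Fin.last T}, (B : ℝ) / 2 ^ k.val :=
            Finset.sum_le_sum_of_subset_of_nonneg
              (fun k hk => Finset.mem_singleton.2 (h4 k hk)) fun k _ _ => by positivity
        _ = (B : ℝ) / 2 ^ T := by simp
        _ ≤ (B : ℝ) / m := div_le_div_of_nonneg_left hB hm0 hmT
    refine (hg.mono _ _ (fun i => Finset.sum_nonneg fun v _ => by positivity) hle).trans ?_
    refine (hg.add_le _ _).trans ?_
    rw [hg.smul_of_nonneg (by positivity)]
    have h5 := hg.le_sum hg1 (fun _ => (B : ℝ) / m)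
    simp only [abs_of_nonneg (div_nonneg hB hm0.le), mul_one, Finset.sum_const, Finset.card_univ,
      Fintype.card_fin, nsmul_eq_mul, mul_div_cancel₀ _ hm0.ne'] at h5
    have h6 := mul_le_mul_of_nonneg_left hz3 (by positivity : (0 : ℝ) ≤ 4 * B)
    linarith
  obtain ⟨A, hA1, hA2⟩ := exists_level_algorithm hg hw hN hs hα hc (β := B) hB T l (T + 4)
    -- Quotas proportional to cost, small enough that even the largest threshold is at most a
    -- quarter of the jobs on a machine of `J` below.
    (fun s => η s * M / (16 * (l + 1))) (fun s => by have := hη0 s; positivity)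
    (X := M / (16 * (l + 1)))
    (fun s => by
      refine div_le_div_of_nonneg_right ?_ (by positivity)
      have := mul_le_mul_of_nonneg_right (hη1 s) hM.le
      linarith)
    -- The test precedes the insertion, and one packer costs at most 1; so the invariant is a total
    -- below 2.
    (fun s _ => ∑ u ∈ s, η u.2 < 1)
    (fun s s' v hss h => lt_of_le_of_lt
      (Finset.sum_le_sum_of_subset_of_nonneg hss fun u _ _ => (hη0 u.2).le) h)
    (fun s => ∑ u ∈ s, η u.2 < 2) (by norm_num)
    (fun s v _ hv h => by
      rw [Finset.sum_insert hv]
      linarith [hη1 v.2]) hQL hM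
  · refine ⟨A, fun p ω => (hA1 p ω).trans (le_of_eq (by ring)), fun p a ha haM => ?_⟩
    set y : Fin m → ℝ := fun i => w i * machineLoad N p a i with hy
    have hy0 : 0 ≤ y := fun i => mul_nonneg (hw i).le (machineLoad_nonneg hN p a i)
    have hgy : g y ≤ B := ha
    have hyB : ∀ i, y i ≤ B := fun i => by
      have := hg.mul_single_le hy0 i
      rw [hg1, mul_one] at this
      linarith
    choose lev hlev1 hlev2 using fun i => exists_level (hyB i) T
    have hsumη : ∑ i, η (lev i) ≤ 2 := by
      have hterm : ∀ i, η (lev i) ≤ H (y i / B) + 1 / m := by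
        intro i
        simp only [η]
        split_ifs with h
        · refine max_le ?_ (le_add_of_nonneg_left (Hnn _))
          have h3 := hlev2 i h
          have hB0 : (0 : ℝ) < B := by
            refine lt_of_le_of_ne hB fun h0 => ?_
            rw [← h0] at h3
            have := hyB i
            rw [← h0] at this
            simp only [zero_div] at h3
            linarith
          refine (Hmono _ _ (by positivity) ?_).trans (le_add_of_nonneg_right (by positivity))
          rw [le_div_iff₀ hB0, div_mul_eq_mul_div, one_mul]
          exact h3.le
        · exact le_add_of_nonneg_left (Hnn _)
      have hH : ∑ i, H (y i / B) ≤ 1 := by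
        refine h1 (fun i => y i / B) (fun i => div_nonneg (hy0 i) hB) ?_
        have : (fun i => y i / (B : ℝ)) = (1 / (B : ℝ)) • y := by
          funext i
          simp [div_eq_inv_mul]
        rw [this, hg.smul_of_nonneg (by positivity), div_mul_eq_mul_div, one_mul]
        exact div_le_one_of_le₀ hgy hB
      refine (Finset.sum_le_sum fun i _ => hterm i).trans ?_
      rw [Finset.sum_add_distrib, Finset.sum_const, Finset.card_univ, Fintype.card_fin,
        nsmul_eq_mul, mul_one_div_cancel hm0.ne']
      linarith
    obtain ⟨O, hO⟩ : ∃ O : ℝ, O = (a.count : ℝ) := ⟨_, rfl⟩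
    have hOM : M ≤ O := hO ▸ haM
    have hO0 : 0 < O := hM.trans_le hOM
    have hOsum : ∑ i, ((a.jobs i).card : ℝ) = O := by
      rw [hO, ← a.sum_card_jobs]
      push_cast
      rfl
    -- The credits are the job counts scaled down to the total `M`, since the solvers only know `M`
    -- and not the optimum.
    let t : Fin m → ℝ := fun i => (a.jobs i).card * (M / O)
    have ht0 : ∀ i, 0 ≤ t i := fun i => by positivity
    have htsum : ∑ i, t i = M := by
      simp only [t]
      rw [← Finset.sum_mul, hOsum, mul_div_cancel₀ _ hO0.ne']
    -- Machines with too few jobs for their cost are dropped. As the costs sum to at most 2, the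
    -- dropped ones hold at most half of the jobs.
    set J : Finset (Fin m) := Finset.univ.filter fun i => η (lev i) * O / 4 ≤ (a.jobs i).card with hJ
    have hJt : M / 2 ≤ ∑ i ∈ J, t i := by
      have h3 := Finset.sum_filter_add_sum_filter_not Finset.univ
        (fun i => η (lev i) * O / 4 ≤ ((a.jobs i).card : ℝ)) t
      have h4 : ∑ i with ¬ η (lev i) * O / 4 ≤ ((a.jobs i).card : ℝ), t i ≤ ∑ i, η (lev i) * (M / 4) := by
        refine (Finset.sum_le_sum (g := fun i => η (lev i) * (M / 4)) fun i hi => ?_).trans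
          (Finset.sum_le_sum_of_subset_of_nonneg (Finset.filter_subset _ _)
            fun i _ _ => mul_nonneg (hη0 _).le (by positivity))
        have h5 := (not_le.1 (Finset.mem_filter.1 hi).2).le
        calc t i ≤ (η (lev i) * O / 4) * (M / O) := mul_le_mul_of_nonneg_right h5 (by positivity)
          _ = η (lev i) * (M / 4) := by field_simp
      rw [← Finset.sum_mul Finset.univ (fun i => η (lev i))] at h4
      have h6 := mul_le_mul_of_nonneg_right hsumη (by positivity : 0 ≤ M / 4)
      linarith
    -- With this `K` the right side of the credit condition is `M` times the total open cost. A
    -- blocked packer means that this cost is at least 1, which pays for all credits.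
    have key := hA2 p a lev J t (32 * (l + 1)) (fun i _ => hlev1 i) (fun i _ => ht0 i) ?_ ?_ ?_ ?_
      (by positivity) ?_
    · have hpen : (32 * ((l : ℝ) + 1)) * (m * (T + 1)) * (M / (16 * (l + 1))) /
          (2 ^ (l + 1) - 1) ≤ M / 4 := by
        have hp := geom_pos l
        have h3 : (T : ℝ) + 1 ≤ 2 ^ T := by exact_mod_cast Nat.lt_two_pow_self (n := T)
        have h4 : (2 : ℝ) ^ (l + 1) = 16 * (2 ^ T * 2 ^ T) := by
          rw [hl]; ring
        have h5 : (m : ℝ) * (T + 1) ≤ 2 ^ T * 2 ^ T :=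
          mul_le_mul hmT h3 (by positivity) (by positivity)
        have h6 : (1 : ℝ) ≤ 2 ^ T * 2 ^ T := by
          have : (1 : ℝ) ≤ 2 ^ T := one_le_pow₀ (by norm_num)
          nlinarith
        have h7 : (32 * ((l : ℝ) + 1)) * (m * (T + 1)) * (M / (16 * (l + 1))) =
            2 * (m * (T + 1)) * M := by
          field_simp
          ring
        rw [h7, div_le_iff₀ hp, h4]
        nlinarith
      have h3 := mul_le_mul_of_nonneg_left hJt hα
      have h4 := mul_le_mul_of_nonneg_left hpen hα
      have hZ : 0 ≤ A.expectedCount p := integral_nonneg fun _ => Nat.cast_nonneg _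
      have hTl : (T : ℝ) ≤ 3 * Real.log m := clog_le_log hm
      have hT1' : (1 : ℝ) ≤ T := by exact_mod_cast hT1
      have h5 : 2 * α + 16 * (((T + 4 : ℕ) : ℝ) + 1) + 4 * (32 * ((l : ℝ) + 1)) ≤ 2700 * Real.log m := by
        rw [hl]
        push_cast
        nlinarith
      have h6 := mul_le_mul_of_nonneg_right h5 hZ
      rw [div_mul_eq_mul_div, div_le_iff₀ hlog0]
      linarith
    · intro i _
      calc t i ≤ ∑ i, t i := Finset.single_le_sum (fun i _ => ht0 i) (Finset.mem_univ i)
        _ = M := htsum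
    · intro i _
      have : M / O ≤ 1 := (div_le_one hO0).2 hOM
      calc t i ≤ (a.jobs i).card * 1 := mul_le_mul_of_nonneg_left this (Nat.cast_nonneg _)
        _ = _ := mul_one _
    · intro i hi
      refine le_trans ?_ (Finset.mem_filter.1 hi).2
      have h3 : 4 * (((l : ℝ) + 1) * (η (lev i) * M / (16 * (l + 1)))) = η (lev i) * M / 4 := by
        field_simp
        ring
      rw [h3]
      have := mul_le_mul_of_nonneg_left hOM (hη0 (lev i)).le
      linarith
    · intro i hi
      have h3 := (Finset.mem_filter.1 hi).2
      have h4 := mul_le_mul_of_nonneg_right (hηm (lev i)) hO0.le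
      -- The floor of the costs leaves every machine of `J` at least `O / (4 * m)` jobs, so the
      -- scales down to `M / 2 ^ (T + 4)` suffice.
      have h5 : M / 2 ^ (T + 4) ≤ 1 / m * O / 16 := by
        rw [pow_add, div_le_iff₀ (by positivity)]
        have : 1 / (m : ℝ) * O / 16 * (2 ^ T * 2 ^ 4) = O * (2 ^ T / m) := by
          field_simp
          norm_num
        rw [this]
        have h6 : 1 ≤ 2 ^ T / (m : ℝ) := (one_le_div hm0).2 hmT
        nlinarith
      linarith
    · intro s J' hJ' hno
      rcases J'.eq_empty_or_nonempty with rfl | ⟨i, hi⟩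
      · rw [Finset.sum_empty]
        refine mul_nonneg (by positivity) (Finset.sum_nonneg fun v _ => ?_)
        have := hη0 v.2
        positivity
      · have h3 := not_lt.1 (hno i hi)
        have h4 : ∑ i ∈ J', t i ≤ M := htsum ▸ Finset.sum_le_sum_of_subset_of_nonneg
          (Finset.subset_univ _) fun i _ _ => ht0 i
        have h5 : 32 * ((l : ℝ) + 1) * ∑ v ∈ s, η v.2 * M / (16 * (l + 1)) / 2 =
            M * ∑ v ∈ s, η v.2 := by
          rw [Finset.mul_sum, Finset.mul_sum]
          refine Finset.sum_congr rfl fun v _ => ?_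
          field_simp
          ring
        rw [h5]
        nlinarith

/-! ### Top-`k` norms -/

section topK

variable {m : ℕ} {k : ℕ}

lemma le_topKNorm (y : Fin m → ℝ) (S : Finset (Fin m)) (hS : S.card ≤ k) :
    ∑ i ∈ S, |y i| ≤ topKNorm k y :=
  le_ciSup (f := fun S : {S : Finset (Fin m) // S.card ≤ k} => ∑ i ∈ S.1, |y i|)
    (Set.finite_range _).bddAbove ⟨S, hS⟩

lemma topKNorm_le {y : Fin m → ℝ} {b : ℝ}
    (h : ∀ S : Finset (Fin m), S.card ≤ k → ∑ i ∈ S, |y i| ≤ b) : topKNorm k y ≤ b := by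
  have : Nonempty {S : Finset (Fin m) // S.card ≤ k} := ⟨⟨∅, by simp⟩⟩
  exact ciSup_le fun S => h S.1 S.2

lemma abs_le_topKNorm (hk : 1 ≤ k) (y : Fin m → ℝ) (i : Fin m) : |y i| ≤ topKNorm k y := by
  simpa using le_topKNorm y {i} (by simpa using hk)

lemma isMonotoneNorm_topKNorm (hk : 1 ≤ k) : IsMonotoneNorm (topKNorm (m := m) k) where
  add_le x y := topKNorm_le fun S hS => by
    refine le_trans ?_ (add_le_add (le_topKNorm x S hS) (le_topKNorm y S hS))
    rw [← Finset.sum_add_distrib]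
    exact Finset.sum_le_sum fun i _ => abs_add_le _ _
  smul t x := by
    unfold topKNorm
    rw [Real.mul_iSup_of_nonneg (abs_nonneg t)]
    refine iSup_congr fun S => ?_
    rw [Finset.mul_sum]
    exact Finset.sum_congr rfl fun i _ => abs_mul _ _
  eq_zero x h := by
    funext i
    exact abs_nonpos_iff.1 (h ▸ abs_le_topKNorm hk x i)
  mono x y hx hxy := topKNorm_le fun S hS => by
    refine le_trans (Finset.sum_le_sum fun i _ => ?_) (le_topKNorm y S hS)
    rw [abs_of_nonneg (hx i), abs_of_nonneg ((hx i).trans (hxy i))]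
    exact hxy i

lemma topKNorm_single (hk : 1 ≤ k) (i : Fin m) : topKNorm k (Pi.single i 1) = 1 := by
  refine le_antisymm (topKNorm_le fun S _ => ?_) ?_
  · refine (Finset.sum_le_sum_of_subset_of_nonneg (Finset.subset_univ S)
      fun j _ _ => abs_nonneg _).trans (le_of_eq ?_)
    rw [Finset.sum_eq_single i] <;> simp +contextual
  · simpa using abs_le_topKNorm hk (Pi.single i (1 : ℝ)) i

/-- Cost is the excess over `1 / k`. If the norm is at most 1, at most `k` coordinates exceed `1 /
k`, so the excesses sum to at most the norm. Conversely, any `k` coordinates sum to at most `k * (1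
/ k)` plus the total excess, that is `1 + 2`. -/
theorem solvable_topKNorm {n r : ℕ} (hm : 2 ≤ m) (hk : 1 ≤ k) {w : Fin m → ℝ} (hw : ∀ i, 0 < w i)
    {N : Fin m → (Fin n × Fin r → ℝ) → ℝ} (hN : ∀ i, IsMonotoneNorm (N i)) {α c : ℝ}
    (hs : ∀ i, NormPackSolvable (N i) α c) :
    SchedPackSolvable (weighted w (topKNorm k)) N (1 / 10800 * α / Real.log m) (13 * c) := by
  classical
  have hk0 : (0 : ℝ) < k := by exact_mod_cast hk
  refine solvable_of_additive hm (isMonotoneNorm_topKNorm hk) (topKNorm_single hk)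
    (H := fun y => max (y - 1 / k) 0) ?_ (fun y => le_max_right _ _) ?_ ?_ ?_ hw hN hs
  · have : (0 : ℝ) ≤ 1 / k := by positivity
    exact max_eq_right (by linarith)
  · intro x y _ hxy
    exact max_le_max (by linarith) le_rfl
  · intro y hy hgy
    set S : Finset (Fin m) := Finset.univ.filter fun i => 1 / (k : ℝ) < y i with hS
    have hcard : S.card ≤ k := by
      by_contra! hlt
      obtain ⟨S', hS', hc⟩ := Finset.exists_subset_card_eq hlt.le
      have h1 := le_topKNorm y S' hc.le
      have h2 : ∑ _i ∈ S', 1 / (k : ℝ) < ∑ i ∈ S', |y i| := by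
        refine Finset.sum_lt_sum_of_nonempty (Finset.card_pos.1 (by omega)) fun i hi => ?_
        rw [abs_of_nonneg (hy i)]
        exact (Finset.mem_filter.1 (hS' hi)).2
      rw [Finset.sum_const, hc, nsmul_eq_mul, mul_one_div_cancel hk0.ne'] at h2
      linarith
    calc ∑ i, max (y i - 1 / k) 0 = ∑ i ∈ S, max (y i - 1 / k) 0 := by
          refine (Finset.sum_subset (Finset.subset_univ _) fun i _ hi => ?_).symm
          refine max_eq_right ?_
          have : ¬ 1 / (k : ℝ) < y i := fun h => hi (Finset.mem_filter.2 ⟨Finset.mem_univ _, h⟩)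
          linarith
      _ ≤ ∑ i ∈ S, |y i| := Finset.sum_le_sum fun i _ => by
          have : (0 : ℝ) ≤ 1 / k := by positivity
          exact max_le (by linarith [le_abs_self (y i)]) (abs_nonneg _)
      _ ≤ 1 := (le_topKNorm y S hcard).trans hgy
  · intro y hy hsum
    refine topKNorm_le fun S hS => ?_
    calc ∑ i ∈ S, |y i| ≤ ∑ i ∈ S, (1 / (k : ℝ) + max (y i - 1 / k) 0) := by
          refine Finset.sum_le_sum fun i _ => ?_
          rw [abs_of_nonneg (hy i)]
          linarith [le_max_left (y i - 1 / (k : ℝ)) 0]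
      _ = S.card * (1 / (k : ℝ)) + ∑ i ∈ S, max (y i - 1 / k) 0 := by
          rw [Finset.sum_add_distrib, Finset.sum_const, nsmul_eq_mul]
      _ ≤ 1 + 2 := by
          refine add_le_add ?_ (le_trans ?_ hsum)
          · rw [mul_one_div]
            exact div_le_one_of_le₀ (by exact_mod_cast hS) hk0.le
          · exact Finset.sum_le_sum_of_subset_of_nonneg (Finset.subset_univ S)
              fun i _ _ => le_max_right _ _
      _ = 3 := by norm_num

end topK

/-! ### The `ℓ_p` norms -/

section ellp

variable {m : ℕ} {p : ℝ≥0∞}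

lemma ellpNorm_eq_sum (hp : 1 ≤ p) (hp' : p ≠ ∞) (y : Fin m → ℝ) :
    ellpNorm p y = (∑ i, |y i| ^ p.toReal) ^ (1 / p.toReal) :=
  PiLp.norm_eq_sum (ENNReal.toReal_pos (by positivity) hp') _

lemma ellpNorm_top (hm : 2 ≤ m) : ellpNorm (m := m) ∞ = topKNorm 1 := by
  have : NeZero m := ⟨by omega⟩
  funext y
  have h : ellpNorm ∞ y = ⨆ i, |y i| := PiLp.norm_eq_ciSup _
  rw [h]
  refine le_antisymm (ciSup_le fun i => abs_le_topKNorm le_rfl y i) (topKNorm_le fun S hS => ?_)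
  rcases S.eq_empty_or_nonempty with rfl | ⟨i, hi⟩
  · simpa using (abs_nonneg _).trans
      (le_ciSup (f := fun i => |y i|) (Set.finite_range _).bddAbove (0 : Fin m))
  · have : S = {i} := (Finset.card_le_one_iff_subset_singleton.1 hS |>.elim fun j hj => by
      have h1 := Finset.mem_singleton.1 (hj hi)
      subst h1
      exact Finset.Subset.antisymm hj (Finset.singleton_subset_iff.2 hi))
    rw [this, Finset.sum_singleton]
    exact le_ciSup (f := fun i => |y i|) (Set.finite_range _).bddAbove i

lemma isMonotoneNorm_ellpNorm (hp : 1 ≤ p) (hp' : p ≠ ∞) :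
    IsMonotoneNorm (ellpNorm (m := m) p) where
  add_le x y := by
    have : Fact (1 ≤ p) := ⟨hp⟩
    exact norm_add_le (WithLp.toLp p x : PiLp p fun _ : Fin m => ℝ) (WithLp.toLp p y)
  smul t x := by
    have : Fact (1 ≤ p) := ⟨hp⟩
    exact norm_smul t (WithLp.toLp p x : PiLp p fun _ : Fin m => ℝ)
  eq_zero x h := by
    have : Fact (1 ≤ p) := ⟨hp⟩
    have h1 : (WithLp.toLp p x : PiLp p fun _ : Fin m => ℝ) = 0 := norm_eq_zero.1 h
    funext i
    exact congrArg (fun z : PiLp p fun _ : Fin m => ℝ => z i) h1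
  mono x y hx hxy := by
    rw [ellpNorm_eq_sum hp hp', ellpNorm_eq_sum hp hp']
    refine Real.rpow_le_rpow (Finset.sum_nonneg fun i _ => by positivity)
      (Finset.sum_le_sum fun i _ => ?_) (by positivity)
    rw [abs_of_nonneg (hx i), abs_of_nonneg ((hx i).trans (hxy i))]
    exact Real.rpow_le_rpow (hx i) (hxy i) ENNReal.toReal_nonneg

/-- For finite `p` the cost is the `p`-th power, and total cost 2 means norm at most `2 ^ (1 / p) ≤
2`. The case `p = ∞` is Top-1. -/
theorem solvable_ellpNorm {n r : ℕ} (hm : 2 ≤ m) (hp : 1 ≤ p) {w : Fin m → ℝ} (hw : ∀ i, 0 < w i)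
    {N : Fin m → (Fin n × Fin r → ℝ) → ℝ} (hN : ∀ i, IsMonotoneNorm (N i)) {α c : ℝ}
    (hs : ∀ i, NormPackSolvable (N i) α c) :
    SchedPackSolvable (weighted w (ellpNorm p)) N (1 / 10800 * α / Real.log m) (13 * c) := by
  classical
  by_cases hp' : p = ∞
  · rw [hp', ellpNorm_top hm]
    exact solvable_topKNorm hm le_rfl hw hN hs
  have h1p : 1 ≤ p.toReal := by
    rw [← ENNReal.toReal_one]
    exact ENNReal.toReal_mono hp' hp
  have h0p : 0 < p.toReal := by linarith
  refine solvable_of_additive hm (isMonotoneNorm_ellpNorm hp hp') (fun i => ?_)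
    (H := fun y => |y| ^ p.toReal) ?_ (fun y => by positivity) ?_ ?_ ?_ hw hN hs
  · rw [ellpNorm_eq_sum hp hp', Finset.sum_eq_single i]
    · simp
    · intro j _ hj
      simp [hj, h0p.ne']
    · simp
  · simp [h0p.ne']
  · intro x y hx hxy
    refine Real.rpow_le_rpow (abs_nonneg x) ?_ h0p.le
    rwa [abs_of_nonneg hx, abs_of_nonneg (hx.trans hxy)]
  · intro y _ h
    rw [ellpNorm_eq_sum hp hp'] at h
    by_contra! hlt
    exact absurd h (not_le.2 (Real.one_lt_rpow hlt (by positivity)))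
  · intro y _ h
    rw [ellpNorm_eq_sum hp hp']
    have h2 : (∑ i, |y i| ^ p.toReal) ^ (1 / p.toReal) ≤ 2 ^ (1 / p.toReal) :=
      Real.rpow_le_rpow (Finset.sum_nonneg fun i _ => by positivity) h (by positivity)
    have h3 : (2 : ℝ) ^ (1 / p.toReal) ≤ 2 ^ (1 : ℝ) :=
      Real.rpow_le_rpow_of_exponent_le (by norm_num) (div_le_one_of_le₀ h1p h0p.le)
    rw [Real.rpow_one] at h3
    linarith

end ellp

/-! ### Symmetric norms: a random profile by minimax, at the price of a second logarithm -/

/-- A finite zero-sum game in which every strategy secures `v` against itself has value at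
least `v`. -/
lemma exists_mixed_strategy {ι : Type} [Fintype ι] [Nonempty ι] (P : ι → ι → ℝ) (v : ℝ)
    (h : ∀ μ ∈ stdSimplex ℝ ι, v ≤ ∑ a, ∑ b, μ a * P a b * μ b) :
    ∃ σ ∈ stdSimplex ℝ ι, ∀ b, v ≤ ∑ a, σ a * P a b := by
  classical
  have hne : (stdSimplex ℝ ι).Nonempty := ⟨_, single_mem_stdSimplex ℝ (Classical.arbitrary ι)⟩
  have hcv := convex_stdSimplex ℝ ι
  have hcp := isCompact_stdSimplex ℝ ι
  let fy : (ι → ℝ) → (ι → ℝ) →ₗ[ℝ] ℝ := fun y =>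
    ∑ b, (∑ a, y a * P a b) • LinearMap.proj b
  let fx : (ι → ℝ) → (ι → ℝ) →ₗ[ℝ] ℝ := fun x =>
    ∑ a, (∑ b, P a b * x b) • LinearMap.proj a
  have hfy : ∀ y x, fy y x = ∑ a, ∑ b, y a * P a b * x b := fun y x => by
    simp only [fy, LinearMap.sum_apply, LinearMap.smul_apply, LinearMap.proj_apply, smul_eq_mul]
    rw [Finset.sum_comm]
    exact Finset.sum_congr rfl fun b _ => Finset.sum_mul _ _ _
  have hfx : ∀ x y, fx x y = ∑ a, ∑ b, y a * P a b * x b := fun x y => by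
    simp only [fx, LinearMap.sum_apply, LinearMap.smul_apply, LinearMap.proj_apply, smul_eq_mul]
    refine Finset.sum_congr rfl fun a _ => ?_
    rw [Finset.sum_mul]
    exact Finset.sum_congr rfl fun b _ => by ring
  obtain ⟨μ, hμ, σ, hσ, hsad⟩ := Sion.exists_isSaddlePointOn (X := stdSimplex ℝ ι)
    (Y := stdSimplex ℝ ι) (f := fun x y => ∑ a, ∑ b, y a * P a b * x b) hne hcv hcp
    (fun y _ => by
      refine Continuous.lowerSemicontinuous (by fun_prop) |>.lowerSemicontinuousOn _)
    (fun y _ => by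
      have := ((fy y).convexOn hcv).quasiconvexOn
      simpa only [funext (hfy y)] using this)
    hcv hne hcp
    (fun x _ => by
      refine Continuous.upperSemicontinuous (by fun_prop) |>.upperSemicontinuousOn _)
    (fun x _ => by
      have := ((fx x).concaveOn hcv).quasiconcaveOn
      simpa only [funext (hfx x)] using this)
  -- The minimizer's strategy `μ` of the saddle point is played against itself, which yields at
  -- least `v`. By the saddle property this is at most the payoff of `σ` against any pure strategy.
  refine ⟨σ, hσ, fun b => (h μ hμ).trans ?_⟩
  refine (hsad _ (single_mem_stdSimplex ℝ b) μ hμ).trans (le_of_eq ?_)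
  refine Finset.sum_congr rfl fun a _ => ?_
  rw [Finset.sum_eq_single b]
  · simp
  · intro b' _ hb'
    simp [hb']
  · simp

/-- The part of the profile `ν` with multiplicities `N` that is covered by the profile `μ` with
multiplicities `N'`. -/
noncomputable def coverage {S : Type} [Fintype S] (μ : S → ℝ) (N' : S → ℕ) (ν : S → ℝ)
    (N : S → ℕ) : ℝ :=
  ∑ s, if μ s * N s ≤ ν s * N' s then min (ν s) (μ s) else 0

/-- At each level one of the two comparisons `μ s * N s ≤ ν s * N' s` and its converse holds, so at
least one profile covers the other there, to the extent `min (ν s) (μ s) ≥ μ s * ν s`. -/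
lemma sum_mul_le_coverage_add {S : Type} [Fintype S] {μ ν : S → ℝ} (N' N : S → ℕ)
    (hμ : ∀ s, 0 ≤ μ s) (hν : ∀ s, 0 ≤ ν s) (hμ1 : ∀ s, μ s ≤ 1) (hν1 : ∀ s, ν s ≤ 1) :
    ∑ s, μ s * ν s ≤ coverage μ N' ν N + coverage ν N μ N' := by
  unfold coverage
  rw [← Finset.sum_add_distrib]
  refine Finset.sum_le_sum fun s _ => ?_
  have h1 : μ s * ν s ≤ min (ν s) (μ s) :=
    le_min (by nlinarith [hν s, hμ1 s]) (by nlinarith [hμ s, hν1 s])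
  have h2 : 0 ≤ min (ν s) (μ s) := le_min (hν s) (hμ s)
  rcases le_total (μ s * N s) (ν s * N' s) with h | h
  · rw [if_pos h]
    refine h1.trans (le_add_of_nonneg_right ?_)
    rw [min_comm (μ s)]
    split_ifs <;> [exact h2; exact le_rfl]
  · rw [if_pos h, min_comm (μ s)]
    refine h1.trans (le_add_of_nonneg_left ?_)
    split_ifs <;> [exact h2; exact le_rfl]

/-- There is a distribution over profiles that covers every profile well in expectation. -/
lemma exists_mixed_profile {ι S : Type} [Fintype ι] [Nonempty ι] [Fintype S] [Nonempty S]
    (μ : ι → S → ℝ) (N : ι → S → ℕ) (hμ : ∀ a s, 0 ≤ μ a s) (hμ1 : ∀ a, ∑ s, μ a s = 1) :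
    ∃ σ : ι → ℝ, (∀ a, 0 ≤ σ a) ∧ ∑ a, σ a = 1 ∧
      ∀ b, 1 / (2 * Fintype.card S) ≤ ∑ a, σ a * coverage (μ a) (N a) (μ b) (N b) := by
  have hle : ∀ a s, μ a s ≤ 1 := fun a s =>
    hμ1 a ▸ Finset.single_le_sum (fun s _ => hμ a s) (Finset.mem_univ s)
  suffices h : ∀ τ ∈ stdSimplex ℝ ι, (1 / (2 * Fintype.card S) : ℝ) ≤
      ∑ a, ∑ b, τ a * coverage (μ a) (N a) (μ b) (N b) * τ b by
    obtain ⟨σ, hσ, h⟩ := exists_mixed_strategy _ _ h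
    exact ⟨σ, hσ.1, hσ.2, h⟩
  intro τ hτ
  set F : ι → ι → ℝ := fun a b => τ a * coverage (μ a) (N a) (μ b) (N b) * τ b with hF
  -- When a mixed profile is played against itself the payoff may be symmetrized. The sum of the two
  -- coverages then bounds the squared mass of the average profile, which by Cauchy–Schwarz is at
  -- least the reciprocal of the number of levels.
  have h1 : 2 * ∑ a, ∑ b, F a b = ∑ a, ∑ b, (F a b + F b a) := by
    simp only [Finset.sum_add_distrib]
    rw [Finset.sum_comm (f := fun a b => F b a), two_mul]
  have h2 : ∑ s, (∑ a, τ a * μ a s) ^ 2 ≤ ∑ a, ∑ b, (F a b + F b a) := by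
    have h3 : ∑ s, (∑ a, τ a * μ a s) ^ 2 = ∑ a, ∑ b, τ a * τ b * ∑ s, μ a s * μ b s := by
      simp only [sq, Finset.sum_mul_sum]
      simp only [Finset.mul_sum]
      rw [Finset.sum_comm]
      refine Finset.sum_congr rfl fun a _ => ?_
      rw [Finset.sum_comm]
      exact Finset.sum_congr rfl fun b _ => Finset.sum_congr rfl fun s _ => by ring
    rw [h3]
    refine Finset.sum_le_sum fun a _ => Finset.sum_le_sum fun b _ => ?_
    have := mul_le_mul_of_nonneg_left
      (sum_mul_le_coverage_add (N a) (N b) (hμ a) (hμ b) (hle a) (hle b))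
      (mul_nonneg (hτ.1 a) (hτ.1 b))
    refine this.trans (le_of_eq ?_)
    simp only [hF]
    ring
  have h4 : ∑ s, ∑ a, τ a * μ a s = 1 := by
    rw [Finset.sum_comm]
    simp only [← Finset.mul_sum, hμ1, mul_one]
    exact hτ.2
  have h5 := sq_sum_le_card_mul_sum_sq (s := Finset.univ) (f := fun s : S => ∑ a, τ a * μ a s)
  rw [h4, Finset.card_univ] at h5
  have h6 : (0 : ℝ) < Fintype.card S := by exact_mod_cast Fintype.card_pos
  rw [div_le_iff₀ (by positivity)]
  nlinarith

/-- A symmetric monotone norm of a vector of levels is monotone in the multiplicities of the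
levels. -/
lemma IsMonotoneNorm.levels_le {m : ℕ} {S : Type} [DecidableEq S] {g : (Fin m → ℝ) → ℝ}
    (hg : IsMonotoneNorm g) (hsym : IsSymmetric g) {b : S → ℝ} (hb : ∀ s, 0 ≤ b s)
    {W U : Finset (Fin m)} {τ σ : Fin m → S}
    (h : ∀ s, (W.filter fun i => τ i = s).card ≤ (U.filter fun i => σ i = s).card) :
    g (fun i => if i ∈ W then b (τ i) else 0) ≤ g (fun i => if i ∈ U then b (σ i) else 0) := by
  classical
  rcases W.eq_empty_or_nonempty with rfl | ⟨i₀, hi₀⟩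
  · simp only [Finset.notMem_empty, if_false]
    have : (fun _ : Fin m => (0 : ℝ)) = 0 := rfl
    rw [this, hg.zero]
    exact hg.nonneg _
  have : Nonempty (Fin m) := ⟨i₀⟩
  -- Counting gives an injection of the machines of `W` into those of `U` for each level. Together
  -- they are injective on `W` and extend to a permutation, under which `g` is invariant.
  have hex : ∀ s, ∃ f : Fin m → Fin m,
      (↑(W.filter fun i => τ i = s) : Set (Fin m)) ⊆ f ⁻¹' ↑(U.filter fun i => σ i = s) ∧
        Set.InjOn f ↑(W.filter fun i => τ i = s) := fun s => by
    refine Set.Finite.exists_injOn_of_encard_le (Finset.finite_toSet _) ?_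
    rw [Set.encard_coe_eq_coe_finsetCard, Set.encard_coe_eq_coe_finsetCard]
    exact_mod_cast h s
  choose f hf hinj using hex
  have hfU : ∀ i ∈ W, f (τ i) i ∈ U ∧ σ (f (τ i) i) = τ i := fun i hi => by
    have := hf (τ i) (Finset.mem_coe.2 (Finset.mem_filter.2 ⟨hi, rfl⟩))
    exact Finset.mem_filter.1 (Finset.mem_coe.1 this)
  obtain ⟨π, hπ⟩ := Finset.exists_equiv_extend_of_card_eq (t := (Finset.univ : Finset (Fin m)))
    (by simp) (s := W) (f := fun i => f (τ i) i) (Finset.subset_univ _) (by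
      intro i hi i' hi' heq
      simp only at heq
      have hτ : τ i = τ i' := by rw [← (hfU i hi).2, heq, (hfU i' hi').2]
      rw [← hτ] at heq
      exact hinj (τ i) (Finset.mem_coe.2 (Finset.mem_filter.2 ⟨hi, rfl⟩))
        (Finset.mem_coe.2 (Finset.mem_filter.2 ⟨hi', hτ.symm⟩)) heq)
  rw [← hsym (π.trans (Equiv.subtypeUnivEquiv fun i => Finset.mem_univ i))
    (fun i => if i ∈ U then b (σ i) else 0)]
  refine hg.mono _ _ (fun i => ?_) fun i => ?_
  · simp only [Pi.zero_apply]
    split_ifs <;> [exact hb _; exact le_rfl]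
  · simp only [Equiv.trans_apply, Equiv.subtypeUnivEquiv_apply]
    by_cases hi : i ∈ W
    · rw [if_pos hi, hπ i hi, if_pos (hfU i hi).1, (hfU i hi).2]
    · rw [if_neg hi]
      split_ifs <;> [exact hb _; exact le_rfl]

/-- The multiplicity of a level. -/
def multiplicity {m : ℕ} {S : Type} [DecidableEq S] (U : Finset (Fin m)) (σ : Fin m → S) (s : S) : ℕ :=
  (U.filter fun i => σ i = s).card

/-- The open budgets on a machine sum to at most twice the largest. If only the largest is kept, no
level has more machines than it has open packers, and the profile vector dominates up to a
permutation. -/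
lemma exists_level_le {m T : ℕ} {β : ℝ} (hβ : 0 ≤ β) {g : (Fin m → ℝ) → ℝ}
    (hg : IsMonotoneNorm g) (hsym : IsSymmetric g) (U : Finset (Fin m)) (σ : Fin m → Fin (T + 1))
    {s : Finset (Fin m × Fin (T + 1))}
    (hs : ∀ k, (s.filter fun u => u.2 = k).card ≤ multiplicity U σ k) :
    g (fun i => ∑ v ∈ s with v.1 = i, β / 2 ^ v.2.val) ≤
      2 * g (fun i => if i ∈ U then β / 2 ^ (σ i).val else 0) := by
  classical
  let K : Fin m → Finset (Fin (T + 1)) := fun i => Finset.univ.filter fun k => (i, k) ∈ s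
  let W : Finset (Fin m) := Finset.univ.filter fun i => (K i).Nonempty
  have hτ : ∀ i, ∃ k, i ∈ W → (i, k) ∈ s ∧
      ∑ k' ∈ K i, β / 2 ^ k'.val ≤ 2 * (β / 2 ^ k.val) := by
    intro i
    by_cases hi : i ∈ W
    · obtain ⟨k, hk, hle⟩ := exists_sum_levels_le hβ (K i) (Finset.mem_filter.1 hi).2
      exact ⟨k, fun _ => ⟨(Finset.mem_filter.1 hk).2, hle⟩⟩
    · exact ⟨0, fun h => absurd h hi⟩
  choose τ hτ using hτ
  have hW := hg.levels_le hsym (b := fun k : Fin (T + 1) => β / 2 ^ k.val) (fun k => by positivity)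
    (W := W) (U := U) (τ := τ) (σ := σ) fun k => by
      refine le_trans ?_ (hs k)
      refine Finset.card_le_card_of_injOn (fun i => (i, k)) (fun i hi => ?_)
        fun i _ i' _ h => congrArg Prod.fst h
      obtain ⟨h1, h2⟩ := Finset.mem_filter.1 (Finset.mem_coe.1 hi)
      refine Finset.mem_coe.2 (Finset.mem_filter.2 ⟨?_, rfl⟩)
      rw [← h2]
      exact (hτ i h1).1
  have h2 := hg.smul_of_nonneg (t := 2) (by norm_num)
    (fun i => if i ∈ W then β / 2 ^ (τ i).val else 0)
  refine le_trans ?_ (h2.le.trans (mul_le_mul_of_nonneg_left hW (by norm_num)))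
  refine hg.mono _ _ (fun i => Finset.sum_nonneg fun v _ => by positivity) fun i => ?_
  simp only [Pi.smul_apply, smul_eq_mul]
  rw [sum_filter_fst s i fun k => β / 2 ^ k.val]
  by_cases hi : i ∈ W
  · rw [if_pos hi]
    exact (hτ i hi).2
  · rw [if_neg hi, mul_zero]
    have : K i = ∅ := Finset.not_nonempty_iff_eq_empty.1 fun h =>
      hi (Finset.mem_filter.2 ⟨Finset.mem_univ _, h⟩)
    exact (le_of_eq (by
      change ∑ k ∈ K i, β / 2 ^ k.val = 0
      rw [this, Finset.sum_empty]))

/-- The jobs of an allocation with profile `ν` can be thinned out and restricted to large groups at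
covered levels, losing little more than what the profile `μ` does not cover. -/
lemma exists_thinning {m : ℕ} {S : Type} [Fintype S] [DecidableEq S] (c : Fin m → ℕ) {O M : ℝ}
    (hO : ∑ i, (c i : ℝ) = O) (hM : 0 < M) (hMO : M ≤ O) (lev : Fin m → S) {ν : S → ℝ}
    (hν : ∀ s, ν s * O = ∑ i with lev i = s, (c i : ℝ)) {μ : S → ℝ} (hμ : ∀ s, 0 ≤ μ s)
    (N' : S → ℕ) {N : S → ℕ} (hN : N = multiplicity (Finset.univ.filter fun i => c i ≠ 0) lev)
    {D : ℝ} (hD : 0 < D) :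
    ∃ (J : Finset (Fin m)) (t : Fin m → ℝ),
      M / 2 * coverage μ N' ν N - m * (M / D) ≤ ∑ i ∈ J, t i ∧
      (∀ i, 0 ≤ t i) ∧ (∀ i, t i ≤ M) ∧ (∀ i, t i ≤ c i) ∧
      (∀ i ∈ J, O ≤ D * c i) ∧
      (∀ i ∈ J, μ (lev i) * M / N' (lev i) ≤ 2 * c i) ∧
      (∀ s, ∑ i with lev i = s, t i ≤ M * μ s) ∧
      ∀ i ∈ J, N' (lev i) = 0 → μ (lev i) = 0 := by
  classical
  have hO0 : 0 < O := hM.trans_le hMO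
  have hMO0 : 0 ≤ M / O := by positivity
  have hMO1 : M / O ≤ 1 := (div_le_one hO0).2 hMO
  have hν0 : ∀ s, 0 ≤ ν s := fun s => by
    have : 0 ≤ ν s * O := by rw [hν]; positivity
    exact nonneg_of_mul_nonneg_left this hO0
  have hcO : ∀ i, (c i : ℝ) ≤ O := fun i => by
    rw [← hO]
    exact Finset.single_le_sum (f := fun i => (c i : ℝ)) (fun i _ => by positivity)
      (Finset.mem_univ i)
  have hmin : ∀ s, 0 ≤ min (ν s) (μ s) := fun s => le_min (hν0 s) (hμ s)
  -- With this factor the credits at level `s` sum to exactly `M * min (ν s) (μ s)`, the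
  -- contribution of a covered level to the coverage.
  let ρ : S → ℝ := fun s => min (ν s) (μ s) / ν s
  have hρ0 : ∀ s, 0 ≤ ρ s := fun s => div_nonneg (hmin s) (hν0 s)
  have hρ1 : ∀ s, ρ s ≤ 1 := fun s => div_le_one_of_le₀ (min_le_left _ _) (hν0 s)
  have hνρ : ∀ s, ν s * ρ s = min (ν s) (μ s) := fun s => by
    rcases (hν0 s).eq_or_lt with h | h
    · rw [← h, zero_mul, min_eq_left (hμ s)]
    · exact mul_div_cancel₀ _ h.ne'
  let t : Fin m → ℝ := fun i => c i * (M / O) * ρ (lev i)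
  have ht0 : ∀ i, 0 ≤ t i := fun i => mul_nonneg (by positivity) (hρ0 _)
  have ht1 : ∀ i, t i ≤ c i * (M / O) := fun i =>
    mul_le_of_le_one_right (by positivity) (hρ1 _)
  have htlev : ∀ s, ∑ i with lev i = s, t i = M * min (ν s) (μ s) := fun s => by
    have : ∑ i with lev i = s, t i = ∑ i with lev i = s, (c i : ℝ) * ((M / O) * ρ s) := by
      refine Finset.sum_congr rfl fun i hi => ?_
      simp only [t]
      rw [(Finset.mem_filter.1 hi).2, mul_assoc]
    rw [this, ← Finset.sum_mul, ← hν, ← hνρ]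
    field_simp
  let good : S → Prop := fun s => μ s * N s ≤ ν s * N' s
  have hNpos : ∀ i, c i ≠ 0 → (0 : ℝ) < N (lev i) := fun i hi => by
    rw [hN]
    exact_mod_cast Finset.card_pos.2 ⟨i, by simpa using hi⟩
  -- Machines at covered levels that have at least half the average number of jobs of their level
  -- and at least the fraction `1 / D` of all jobs.
  let J : Finset (Fin m) := Finset.univ.filter fun i =>
    c i ≠ 0 ∧ good (lev i) ∧ ν (lev i) * O ≤ 2 * N (lev i) * c i ∧ O ≤ D * c i
  refine ⟨J, t, ?_, ht0, fun i => ?_, fun i => ?_, fun i hi => (Finset.mem_filter.1 hi).2.2.2.2,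
    fun i hi => ?_, fun s => ?_, fun i hi h0 => ?_⟩
  · have hpt : ∀ i, (if good (lev i) then t i else 0) ≤ (if i ∈ J then t i else 0) +
        (if c i ≠ 0 ∧ good (lev i) then M / 2 * (min (ν (lev i)) (μ (lev i)) / N (lev i)) else 0)
        + M / D := by
      intro i
      have hx : 0 ≤ if i ∈ J then t i else 0 := by split_ifs <;> [exact ht0 i; exact le_rfl]
      have hy : 0 ≤ if c i ≠ 0 ∧ good (lev i) then
          M / 2 * (min (ν (lev i)) (μ (lev i)) / N (lev i)) else 0 := by
        split_ifs <;> [exact mul_nonneg (by positivity) (div_nonneg (hmin _) (Nat.cast_nonneg _));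
          exact le_rfl]
      have hz : 0 ≤ M / D := by positivity
      by_cases hg : good (lev i)
      swap
      · rw [if_neg hg]
        positivity
      rw [if_pos hg]
      by_cases hc : c i = 0
      · have : t i = 0 := by simp [t, hc]
        rw [this]
        positivity
      by_cases h1 : ν (lev i) * O ≤ 2 * N (lev i) * c i
      · by_cases h2 : O ≤ D * c i
        · have : i ∈ J := Finset.mem_filter.2 ⟨Finset.mem_univ _, hc, hg, h1, h2⟩
          rw [if_pos this] at hx ⊢
          linarith
        · have : t i ≤ M / D := by
            refine (ht1 i).trans ?_
            rw [le_div_iff₀ hD]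
            calc (c i : ℝ) * (M / O) * D = D * c i * (M / O) := by ring
              _ ≤ O * (M / O) := mul_le_mul_of_nonneg_right (not_le.1 h2).le hMO0
              _ = M := mul_div_cancel₀ _ hO0.ne'
          linarith
      · have : t i ≤ M / 2 * (min (ν (lev i)) (μ (lev i)) / N (lev i)) := by
          have hNp := hNpos i hc
          rw [← hνρ, ← mul_div_assoc, le_div_iff₀ hNp]
          calc (c i : ℝ) * (M / O) * ρ (lev i) * N (lev i)
              = 2 * N (lev i) * c i * ((M / O) * ρ (lev i) / 2) := by ring
            _ ≤ ν (lev i) * O * ((M / O) * ρ (lev i) / 2) :=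
                mul_le_mul_of_nonneg_right (not_le.1 h1).le
                  (by have := hρ0 (lev i); positivity)
            _ = M / 2 * (ν (lev i) * ρ (lev i)) := by field_simp
        have hcond : c i ≠ 0 ∧ good (lev i) := ⟨hc, hg⟩
        rw [if_pos hcond]
        linarith
    have hsum := Finset.sum_le_sum fun i (_ : i ∈ Finset.univ) => hpt i
    rw [Finset.sum_add_distrib, Finset.sum_add_distrib] at hsum
    have e1 : ∑ i, (if good (lev i) then t i else 0) = M * coverage μ N' ν N := by
      rw [← Finset.sum_fiberwise Finset.univ lev, coverage, Finset.mul_sum]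
      refine Finset.sum_congr rfl fun s _ => ?_
      rw [mul_ite, mul_zero, ← htlev]
      by_cases hg : good s
      · rw [if_pos hg]
        refine Finset.sum_congr rfl fun i hi => ?_
        rw [(Finset.mem_filter.1 hi).2, if_pos hg]
      · rw [if_neg hg]
        refine Finset.sum_eq_zero fun i hi => ?_
        rw [(Finset.mem_filter.1 hi).2, if_neg hg]
    have e2 : ∑ i, (if i ∈ J then t i else 0) = ∑ i ∈ J, t i := by
      rw [← Finset.sum_filter]
      simp
    have e3 : ∑ i, (if c i ≠ 0 ∧ good (lev i) then
        M / 2 * (min (ν (lev i)) (μ (lev i)) / N (lev i)) else 0) ≤ M / 2 * coverage μ N' ν N := by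
      rw [← Finset.sum_fiberwise Finset.univ lev, coverage, Finset.mul_sum]
      refine Finset.sum_le_sum fun s _ => ?_
      by_cases hg : good s
      · have : ∑ i with lev i = s, (if c i ≠ 0 ∧ good (lev i) then
            M / 2 * (min (ν (lev i)) (μ (lev i)) / N (lev i)) else 0) =
            N s * (M / 2 * (min (ν s) (μ s) / N s)) := by
          have h1 : ∑ i with lev i = s, (if c i ≠ 0 ∧ good (lev i) then
            M / 2 * (min (ν (lev i)) (μ (lev i)) / N (lev i)) else 0) =
            ∑ i with lev i = s, if c i ≠ 0 then M / 2 * (min (ν s) (μ s) / N s) else 0 := by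
            refine Finset.sum_congr rfl fun i hi => ?_
            rw [(Finset.mem_filter.1 hi).2]
            simp [hg]
          rw [h1, ← Finset.sum_filter, Finset.filter_comm, Finset.sum_const, nsmul_eq_mul]
          congr 2
          rw [hN]
          rfl
        rw [this]
        have hg' : μ s * N s ≤ ν s * N' s := hg
        rw [if_pos hg']
        rcases (Nat.cast_nonneg (N s) : (0 : ℝ) ≤ N s).eq_or_lt with h | h
        · rw [← h, zero_mul]
          exact mul_nonneg (by positivity) (hmin s)
        · refine le_of_eq ?_
          field_simp
      · have hg' : ¬ μ s * N s ≤ ν s * N' s := hg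
        rw [if_neg hg', mul_zero]
        refine (Finset.sum_eq_zero fun i hi => ?_).le
        rw [(Finset.mem_filter.1 hi).2]
        simp [hg]
    have e4 : ∑ _i : Fin m, M / D = m * (M / D) := by simp
    rw [e1, e2, e4] at hsum
    linarith
  · refine (ht1 i).trans ?_
    calc (c i : ℝ) * (M / O) ≤ O * (M / O) := mul_le_mul_of_nonneg_right (hcO i) hMO0
      _ = M := mul_div_cancel₀ _ hO0.ne'
  · exact (ht1 i).trans (mul_le_of_le_one_right (Nat.cast_nonneg _) hMO1)
  · obtain ⟨-, hc, hg, h1, -⟩ := Finset.mem_filter.1 hi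
    have hNp := hNpos i hc
    rcases (Nat.cast_nonneg (N' (lev i)) : (0 : ℝ) ≤ N' (lev i)).eq_or_lt with h | h
    · rw [← h, div_zero]
      positivity
    · rw [div_le_iff₀ h]
      have hg' : μ (lev i) * N (lev i) ≤ ν (lev i) * N' (lev i) := hg
      have h2 := mul_le_mul_of_nonneg_left hMO (mul_nonneg (hμ (lev i)) hNp.le)
      have h3 := mul_le_mul_of_nonneg_right hg' hO0.le
      have h4 := mul_le_mul_of_nonneg_right h1 h.le
      refine le_of_mul_le_mul_right ?_ hNp
      nlinarith
  · rw [htlev]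
    exact mul_le_mul_of_nonneg_left (min_le_right _ _) hM.le
  · obtain ⟨-, hc, hg, -, -⟩ := Finset.mem_filter.1 hi
    have hg' : μ (lev i) * N (lev i) ≤ ν (lev i) * N' (lev i) := hg
    rw [h0, Nat.cast_zero, mul_zero] at hg'
    exact le_antisymm (nonpos_of_mul_nonpos_left hg' (hNpos i hc)) (hμ _)

/-- An algorithm that is good on all inputs whose optimal solutions are covered by a profile `μ`. -/
theorem exists_profile_algorithm {m n r : ℕ} [NeZero m] {g : (Fin m → ℝ) → ℝ}
    (hg : IsMonotoneNorm g) (hsym : IsSymmetric g)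
    {w : Fin m → ℝ} (hw : ∀ i, 0 < w i)
    {N : Fin m → (Fin n × Fin r → ℝ) → ℝ} (hN : ∀ i, IsMonotoneNorm (N i)) {α c : ℝ}
    (hs : ∀ i, NormPackSolvable (N i) α c) (hα : 0 ≤ α) (hα1 : α ≤ 1) (hc : 1 ≤ c) {β : ℝ}
    (hβ : 0 ≤ β) {T : ℕ} (hT1 : 1 ≤ T) (hmT : (m : ℝ) ≤ 2 ^ T) (U : Finset (Fin m))
    (σ : Fin m → Fin (T + 1)) {L : ℝ}
    (hU : g (fun i => if i ∈ U then β / 2 ^ (σ i).val else 0) ≤ L)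
    (μ : Fin (T + 1) → ℝ) (hμ : ∀ s, 0 ≤ μ s) (hμ1 : ∀ s, μ s ≤ 1) {M : ℝ} (hM : 0 < M) :
    ∃ A : OnlineAlg m n r, (∀ p ω, weighted w g (machineLoad N p (A.run ω p)) ≤ c * (2 * L)) ∧
      ∀ (p : Loads m n r) (a : Alloc m n r) (lev : Fin m → Fin (T + 1)) (ν : Fin (T + 1) → ℝ),
        M ≤ a.count → (∀ i, w i * machineLoad N p a i ≤ β / 2 ^ (lev i).val) →
        (∀ s, ν s * a.count = ∑ i with lev i = s, ((a.jobs i).card : ℝ)) →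
        α * (M / 2 * coverage μ (multiplicity U σ) ν
          (multiplicity (Finset.univ.filter fun i => (a.jobs i).card ≠ 0) lev) -
            3 * M / (16 * (T + 1))) ≤ 720 * T * A.expectedCount p := by
  classical
  have hm0 : (0 : ℝ) < m := by exact_mod_cast Nat.pos_of_ne_zero (NeZero.ne m)
  -- Here the penalties must be small against `M / (T + 1)`, because coverage is only of order `1 /
  -- (T + 1)`: `2 ^ (l + 1) = 64 * 8 ^ T` dominates `m * (T + 1) ^ 2`.
  set l := 3 * T + 5 with hl
  have hl0 : (0 : ℝ) < (l : ℝ) + 1 := by positivity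
  set N' := multiplicity U σ with hN'
  have hq0 : ∀ s, 0 ≤ μ s * M / N' s / (8 * (l + 1)) := fun s => by
    have := hμ s
    positivity
  have hqX : ∀ s, μ s * M / N' s / (8 * (l + 1)) ≤ M / (8 * (l + 1)) := fun s => by
    refine div_le_div_of_nonneg_right ?_ (by positivity)
    rcases Nat.eq_zero_or_pos (N' s) with h | h
    · rw [h, Nat.cast_zero, div_zero]
      exact hM.le
    · have h1 : (1 : ℝ) ≤ N' s := by exact_mod_cast h
      rw [div_le_iff₀ (by positivity)]
      have := mul_le_mul_of_nonneg_right (hμ1 s) hM.le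
      nlinarith
  have hQL : ∀ s : Finset (Fin m × Fin (T + 1)),
      (∀ k, (s.filter fun u => u.2 = k).card ≤ N' k) →
      g (fun i => ∑ v ∈ s with v.1 = i, β / 2 ^ v.2.val) ≤ 2 * L := fun s h =>
    (exists_level_le hβ hg hsym U σ h).trans (mul_le_mul_of_nonneg_left hU (by norm_num))
  obtain ⟨A, hA1, hA2⟩ := exists_level_algorithm hg hw hN hs hα hc hβ T l (2 * T + 5) _ hq0 hqX
    -- Each level has its own cap. If it blocks, then `N'` packers of that level are open, and their
    -- quotas pay for `M * μ s`, a bound for all credits at that level.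
    (fun s v => (s.filter fun u => u.2 = v.2).card < N' v.2)
    (fun s s' v hss h => lt_of_le_of_lt (Finset.card_le_card (Finset.filter_subset_filter _ hss)) h)
    (fun s => ∀ k, (s.filter fun u => u.2 = k).card ≤ N' k) (fun k => by simp)
    (fun s v hQ hv h k => by
      rw [Finset.filter_insert]
      split_ifs with hk
      · subst hk
        exact (Finset.card_insert_le _ _).trans h
      · exact hQ k) hQL hM
  refine ⟨A, hA1, fun p a lev ν haM hload hν => ?_⟩
  -- With this `D` the tiny machines lose `2 * M / (16 * (T + 1))` in total; the penalties bring the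
  -- loss to 3 such units.
  have hD : (0 : ℝ) < 8 * m * (T + 1) := by positivity
  obtain ⟨J, t, ht, ht0, htM, htc, hJO, hJq, htμ, hJ0⟩ := exists_thinning
    (fun i => (a.jobs i).card) (by rw [← a.sum_card_jobs]; push_cast; rfl) hM haM lev hν hμ N' rfl hD
  have key := hA2 p a lev J t (16 * (l + 1)) (fun i _ => hload i) (fun i _ => ht0 i)
    (fun i _ => htM i) (fun i _ => htc i)
    (fun i hi => by
      have := hJq i hi
      rw [mul_div_assoc', mul_comm (8 : ℝ), mul_div_mul_left _ _ hl0.ne']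
      linarith)
    (fun i hi => by
      have h1 := hJO i hi
      have h2 : (T : ℝ) + 1 ≤ 2 ^ T := by exact_mod_cast Nat.lt_two_pow_self (n := T)
      have h3 : (m : ℝ) * (T + 1) ≤ 2 ^ T * 2 ^ T :=
        mul_le_mul hmT h2 (by positivity) (by positivity)
      have h4 : (2 : ℝ) ^ (2 * T + 5) = 32 * (2 ^ T * 2 ^ T) := by ring
      rw [h4, div_le_iff₀ (by positivity)]
      have h5 := mul_le_mul_of_nonneg_right h3 (Nat.cast_nonneg (a.jobs i).card : (0 : ℝ) ≤ _)
      nlinarith)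
    (by positivity)
    (fun s J' hJ' hno => by
      have h1 : ∑ i ∈ J', t i = ∑ k ∈ J'.image lev, ∑ i ∈ J' with lev i = k, t i :=
        (Finset.sum_fiberwise_of_maps_to (fun i hi => Finset.mem_image_of_mem lev hi) t).symm
      have h2 : ∀ k ∈ J'.image lev, ∑ i ∈ J' with lev i = k, t i ≤
          16 * (l + 1) * ∑ v ∈ s with v.2 = k, μ v.2 * M / N' v.2 / (8 * (l + 1)) / 2 := by
        intro k hk
        obtain ⟨i, hi, rfl⟩ := Finset.mem_image.1 hk
        have h3 : ∑ i' ∈ J' with lev i' = lev i, t i' ≤ M * μ (lev i) :=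
          (Finset.sum_le_sum_of_subset_of_nonneg
            (Finset.filter_subset_filter _ (Finset.subset_univ _)) fun i _ _ => ht0 i).trans
            (htμ _)
        refine h3.trans ?_
        rcases Nat.eq_zero_or_pos (N' (lev i)) with h | h
        · rw [hJ0 i (hJ' hi) h, mul_zero]
          refine mul_nonneg (by positivity) (Finset.sum_nonneg fun v _ => ?_)
          have := hq0 v.2
          positivity
        · have h4 : ∑ v ∈ s with v.2 = lev i, μ v.2 * M / N' v.2 / (8 * (l + 1)) / 2 =
              (s.filter fun v => v.2 = lev i).card *
                (μ (lev i) * M / N' (lev i) / (8 * (l + 1)) / 2) := by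
            rw [← nsmul_eq_mul, ← Finset.sum_const]
            exact Finset.sum_congr rfl fun v hv => by rw [(Finset.mem_filter.1 hv).2]
          have h5 : (N' (lev i) : ℝ) ≤ (s.filter fun v => v.2 = lev i).card := by
            exact_mod_cast not_lt.1 (hno i hi)
          have h6 := hq0 (lev i)
          have h7 : (0 : ℝ) < N' (lev i) := by exact_mod_cast h
          rw [h4]
          calc M * μ (lev i) = 16 * (l + 1) * (N' (lev i) *
                (μ (lev i) * M / N' (lev i) / (8 * (l + 1)) / 2)) := by
                field_simp
                ring
            _ ≤ _ := by gcongr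
      rw [h1]
      refine (Finset.sum_le_sum h2).trans ?_
      rw [← Finset.mul_sum]
      refine mul_le_mul_of_nonneg_left ?_ (by positivity)
      rw [← Finset.sum_fiberwise s (fun v => v.2)]
      refine Finset.sum_le_sum_of_subset_of_nonneg (Finset.subset_univ _) fun k _ _ =>
        Finset.sum_nonneg fun v _ => ?_
      have := hq0 v.2
      positivity)
  have hpen : 16 * ((l : ℝ) + 1) * (m * (T + 1)) * (M / (8 * (l + 1))) / (2 ^ (l + 1) - 1) ≤
      M / (16 * (T + 1)) := by
    have hp := geom_pos l
    have h3 : (T : ℝ) + 1 ≤ 2 ^ T := by exact_mod_cast Nat.lt_two_pow_self (n := T)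
    have h4 : (2 : ℝ) ^ (l + 1) = 64 * (2 ^ T * 2 ^ T * 2 ^ T) := by
      rw [hl]; ring
    have h5 : (m : ℝ) * (T + 1) ≤ 2 ^ T * 2 ^ T :=
      mul_le_mul hmT h3 (by positivity) (by positivity)
    have h5' : (m : ℝ) * (T + 1) * (T + 1) ≤ 2 ^ T * 2 ^ T * 2 ^ T :=
      mul_le_mul h5 h3 (by positivity) (by positivity)
    have h6 : (1 : ℝ) ≤ 2 ^ T * 2 ^ T * 2 ^ T := by
      have : (1 : ℝ) ≤ 2 ^ T := one_le_pow₀ (by norm_num)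
      nlinarith [mul_le_mul this this zero_le_one (by positivity)]
    have h7 : 16 * ((l : ℝ) + 1) * (m * (T + 1)) * (M / (8 * (l + 1))) = 2 * (m * (T + 1)) * M := by
      field_simp
      ring
    rw [h7, div_le_div_iff₀ hp (by positivity), h4]
    have h8 := mul_le_mul_of_nonneg_left h5' hM.le
    have h9 := mul_le_mul_of_nonneg_left h6 hM.le
    nlinarith
  have hD' : (m : ℝ) * (M / (8 * m * (T + 1))) = 2 * (M / (16 * (T + 1))) := by
    field_simp
    ring
  rw [hD'] at ht
  have h3 := mul_le_mul_of_nonneg_left ht hα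
  have h4 := mul_le_mul_of_nonneg_left hpen hα
  have hZ : 0 ≤ A.expectedCount p := integral_nonneg fun _ => Nat.cast_nonneg _
  have h5 : 2 * α + 16 * (((2 * T + 5 : ℕ) : ℝ) + 1) + 4 * (16 * ((l : ℝ) + 1)) ≤ 720 * T := by
    have hT1' : (1 : ℝ) ≤ T := by exact_mod_cast hT1
    rw [hl]
    push_cast
    linarith
  have h6 := mul_le_mul_of_nonneg_right h5 hZ
  have h7 : 3 * M / (16 * ((T : ℝ) + 1)) = 3 * (M / (16 * (T + 1))) := by ring
  rw [h7]
  linarith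

theorem solvable_of_isSymmetric {m n r : ℕ} (hm : 2 ≤ m) {g : (Fin m → ℝ) → ℝ}
    (hg : IsMonotoneNorm g) (hsym : IsSymmetric g) {w : Fin m → ℝ} (hw : ∀ i, 0 < w i)
    {N : Fin m → (Fin n × Fin r → ℝ) → ℝ} (hN : ∀ i, IsMonotoneNorm (N i)) {α c : ℝ}
    (hs : ∀ i, NormPackSolvable (N i) α c) :
    SchedPackSolvable (weighted w g) N (1 / 207360 * α / Real.log m ^ 2) (6 * c) := by
  classical
  have : NeZero m := ⟨by omega⟩
  obtain ⟨hα, hα1, hc, -⟩ := hs 0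
  have hlog := one_half_le_log hm
  have hlog0 : 0 < Real.log m := by linarith
  have hm0 : (0 : ℝ) < m := by exact_mod_cast (by omega : 0 < m)
  refine schedPackSolvable_of_pos (hg.weighted hw) hN (by positivity) ?_ (by linarith) ?_
  · rw [div_le_one (by positivity)]
    nlinarith
  intro B M hM
  have hB : (0 : ℝ) ≤ B := B.2
  set T := Nat.clog 2 m with hT
  have hmT : (m : ℝ) ≤ 2 ^ T := by exact_mod_cast Nat.le_pow_clog (by norm_num) m
  have hT1 : 1 ≤ T := Nat.clog_pos (by norm_num) hm
  obtain ⟨κ, hκ⟩ : ∃ κ, κ = g (Pi.single 0 1) := ⟨_, rfl⟩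
  have hκi : ∀ i, g (Pi.single i 1) = κ := fun i => by
    rw [hκ, ← hsym (Equiv.swap 0 i) (Pi.single 0 1)]
    congr 1
    funext j
    simp only [Pi.single_apply, Equiv.swap_apply_eq_iff, Equiv.swap_apply_left]
  have hκ0 : 0 < κ := by
    rw [hκ]
    refine lt_of_le_of_ne (hg.nonneg _) fun h => ?_
    have := congrFun (hg.eq_zero _ h.symm) 0
    simp at this
  -- The largest weighted load of a single machine that is compatible with `g ≤ B`.
  set β : ℝ := B / κ with hβdef
  have hβ : 0 ≤ β := by positivity
  have hβκ : β * κ = B := div_mul_cancel₀ _ hκ0.ne'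
  let vec : (Fin m → Fin (T + 1)) × (Fin m → Fin (n + 1)) → Fin m → ℝ := fun x i =>
    if i ∈ Finset.univ.filter fun i => (x.2 i).val ≠ 0 then β / 2 ^ (x.1 i).val else 0
  -- A profile records the level and the number of jobs of each machine, so the game is finite.
  -- Rounding loads up to levels at most doubles them, except for an additive `β / 2 ^ T` per
  -- machine of total norm at most `B`; hence `3 * B`.
  let ι : Type := {x : (Fin m → Fin (T + 1)) × (Fin m → Fin (n + 1)) //
    g (vec x) ≤ 3 * B ∧ 0 < ∑ i, (x.2 i).val}
  let sup : ι → Finset (Fin m) := fun x => Finset.univ.filter fun i => (x.1.2 i).val ≠ 0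
  let μ : ι → Fin (T + 1) → ℝ := fun x s =>
    (∑ i with x.1.1 i = s, ((x.1.2 i).val : ℝ)) / ∑ i, ((x.1.2 i).val : ℝ)
  have hμ : ∀ x s, 0 ≤ μ x s := fun x s => by positivity
  have hμ1 : ∀ x, ∑ s, μ x s = 1 := fun x => by
    simp only [μ]
    rw [← Finset.sum_div, Finset.sum_fiberwise]
    refine div_self (ne_of_gt ?_)
    exact_mod_cast x.2.2
  have hμle : ∀ x s, μ x s ≤ 1 := fun x s =>
    hμ1 x ▸ Finset.single_le_sum (fun s _ => hμ x s) (Finset.mem_univ s)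
  have hprof : ∀ (p : Loads m n r) (a : Alloc m n r), weighted w g (machineLoad N p a) ≤ B →
      M ≤ a.count → ∃ x : ι, (∀ i, (x.1.2 i).val = (a.jobs i).card) ∧
        ∀ i, w i * machineLoad N p a i ≤ β / 2 ^ (x.1.1 i).val := by
    intro p a ha haM
    set y : Fin m → ℝ := fun i => w i * machineLoad N p a i with hy
    have hy0 : 0 ≤ y := fun i => mul_nonneg (hw i).le (machineLoad_nonneg hN p a i)
    have hgy : g y ≤ B := ha
    have hyβ : ∀ i, y i ≤ β := fun i => by
      have := hg.mul_single_le hy0 i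
      rw [hκi] at this
      rw [hβdef, le_div_iff₀ hκ0]
      linarith
    choose lev hlev1 hlev2 using fun i => exists_level (hyβ i) T
    refine ⟨⟨(lev, fun i => ⟨(a.jobs i).card, Nat.lt_succ_of_le ?_⟩), ?_, ?_⟩, fun i => rfl, hlev1⟩
    · exact (Finset.card_le_univ _).trans (by simp)
    · have hle : vec (lev, fun i => ⟨(a.jobs i).card, Nat.lt_succ_of_le
          ((Finset.card_le_univ _).trans (by simp))⟩) ≤ (2 : ℝ) • y + fun _ => β / 2 ^ T := by
        intro i
        simp only [vec, Pi.add_apply, Pi.smul_apply, smul_eq_mul]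
        have h0 := hy0 i
        simp only [Pi.zero_apply] at h0
        have h1 : 0 ≤ β / 2 ^ T := by positivity
        split_ifs
        · by_cases h : (lev i).val < T
          · have h2 := hlev2 i h
            rw [pow_succ, ← div_div] at h2
            linarith
          · have h2 : (lev i).val = T := le_antisymm (Nat.lt_succ_iff.1 (lev i).2) (not_lt.1 h)
            rw [h2]
            linarith
        · linarith
      refine (hg.mono _ _ (fun i => ?_) hle).trans ((hg.add_le _ _).trans ?_)
      · simp only [vec, Pi.zero_apply]
        split_ifs <;> positivity
      · rw [hg.smul_of_nonneg (by norm_num)]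
        have h5 := hg.le_sum hκi (fun _ => β / 2 ^ T)
        rw [abs_of_nonneg (by positivity : 0 ≤ β / 2 ^ T), Finset.sum_const, Finset.card_univ,
          Fintype.card_fin, nsmul_eq_mul] at h5
        have h6 : (m : ℝ) * (β / 2 ^ T * κ) ≤ B := by
          have : (m : ℝ) * (β / 2 ^ T * κ) = m * B / 2 ^ T := by
            rw [← hβκ]
            ring
          rw [this, div_le_iff₀ (by positivity)]
          nlinarith
        linarith
    · have h1 : (0 : ℝ) < a.count := hM.trans_le haM
      have h2 : 0 < a.count := by exact_mod_cast h1
      rw [← a.sum_card_jobs] at h2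
      exact h2
  rcases isEmpty_or_nonempty ι with hι | hι
  -- Without profiles no feasible allocation has `M` jobs, and any algorithm that respects the load
  -- bound will do; the empty profile gives one.
  · obtain ⟨A, hA, -⟩ := exists_profile_algorithm hg hsym hw hN hs hα hα1 hc hβ hT1 hmT ∅ 0
      (L := 0) (by
        simp only [Finset.notMem_empty, if_false]
        exact hg.zero.le) 0 (fun _ => le_rfl) (fun _ => zero_le_one) hM
    refine ⟨A, fun p ω => (hA p ω).trans ?_, fun p a ha haM => ?_⟩
    · have : 0 ≤ c * B := mul_nonneg (by linarith) hB
      linarith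
    · obtain ⟨x, -⟩ := hprof p a ha haM
      exact (hι.false x).elim
  choose A hA1 hA2 using fun x : ι => exists_profile_algorithm hg hsym hw hN hs hα hα1 hc hβ hT1
    hmT (sup x) x.1.1 x.2.1 (μ x) (hμ x) (hμle x) hM
  obtain ⟨σ, hσ0, hσ1, hσ⟩ := exists_mixed_profile μ (fun x => multiplicity (sup x) x.1.1) hμ hμ1
  obtain ⟨A', hrun, hcount⟩ := exists_mixture σ hσ0 hσ1 A
  refine ⟨A', fun p ω => ?_, fun p a ha haM => ?_⟩
  · obtain ⟨x, ω', h⟩ := hrun ω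
    rw [h]
    exact (hA1 x p ω').trans (le_of_eq (by ring))
  · obtain ⟨x, hx1, hx2⟩ := hprof p a ha haM
    have hsum : ∑ i, ((x.1.2 i).val : ℝ) = a.count := by
      rw [← a.sum_card_jobs]
      push_cast
      exact Finset.sum_congr rfl fun i _ => by rw [hx1]
    have hcnt0 : (0 : ℝ) < a.count := hM.trans_le haM
    have hsup : (Finset.univ.filter fun i => (a.jobs i).card ≠ 0) = sup x :=
      Finset.filter_congr fun i _ => by rw [hx1]
    have key : ∀ x', α * (M / 2 * coverage (μ x') (multiplicity (sup x') x'.1.1) (μ x)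
        (multiplicity (sup x) x.1.1) - 3 * M / (16 * (T + 1))) ≤
          720 * T * (A x').expectedCount p := fun x' => by
      have := hA2 x' p a x.1.1 (μ x) haM hx2 fun s => by
        simp only [μ]
        rw [hsum, div_mul_cancel₀ _ hcnt0.ne']
        exact Finset.sum_congr rfl fun i _ => by rw [hx1]
      rwa [hsup] at this
    have h1 := Finset.sum_le_sum fun x' (_ : x' ∈ Finset.univ) =>
      mul_le_mul_of_nonneg_left (key x') (hσ0 x')
    have h2 : ∑ x', σ x' * (720 * T * (A x').expectedCount p) = 720 * T * A'.expectedCount p := by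
      rw [hcount, Finset.mul_sum]
      exact Finset.sum_congr rfl fun _ _ => by ring
    have h3 : ∑ x', σ x' * (α * (M / 2 * coverage (μ x') (multiplicity (sup x') x'.1.1) (μ x)
        (multiplicity (sup x) x.1.1) - 3 * M / (16 * (T + 1)))) =
        α * (M / 2) * ∑ x', σ x' * coverage (μ x') (multiplicity (sup x') x'.1.1) (μ x)
          (multiplicity (sup x) x.1.1) - α * (3 * M / (16 * (T + 1))) * ∑ x', σ x' := by
      rw [Finset.mul_sum, Finset.mul_sum, ← Finset.sum_sub_distrib]
      exact Finset.sum_congr rfl fun _ _ => by ring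
    rw [h2, h3, hσ1, mul_one] at h1
    have h4 := mul_le_mul_of_nonneg_left (hσ x) (by positivity : 0 ≤ α * (M / 2))
    rw [Fintype.card_fin] at h4
    push_cast at h4
    -- Expected coverage `1 / (2 * (T + 1))` is worth four units of `M / (16 * (T + 1))`, three of
    -- which are lost. The factor `720 * T` is the second logarithm.
    have h5 : α * M / (16 * (T + 1)) ≤ 720 * T * A'.expectedCount p := by
      have : α * M / (16 * ((T : ℝ) + 1)) =
          α * (M / 2) * (1 / (2 * (T + 1))) - α * (3 * M / (16 * (T + 1))) := by
        field_simp
        ring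
      rw [this]
      linarith
    rw [div_le_iff₀ (by positivity)] at h5
    have hZ : 0 ≤ A'.expectedCount p := integral_nonneg fun _ => Nat.cast_nonneg _
    have hTl : (T : ℝ) ≤ 3 * Real.log m := clog_le_log hm
    have hT1' : (1 : ℝ) ≤ T := by exact_mod_cast hT1
    have h6 : 720 * (T : ℝ) * (16 * (T + 1)) ≤ 207360 * Real.log m ^ 2 := by nlinarith
    have h7 := mul_le_mul_of_nonneg_right h6 hZ
    rw [div_mul_eq_mul_div, div_le_iff₀ (by positivity)]
    linarith

/-! ### Assembling the theorem with common constants -/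

lemma SchedPackSolvable.mono {m n r : ℕ} {f : (Fin m → ℝ) → ℝ}
    {N : Fin m → (Fin n × Fin r → ℝ) → ℝ} {α α' c c' : ℝ} (h : SchedPackSolvable f N α c)
    (hα0 : 0 ≤ α') (hα : α' ≤ α) (hc : c ≤ c') : SchedPackSolvable f N α' c' := by
  obtain ⟨h0, h1, h2, h3⟩ := h
  refine ⟨hα0, hα.trans h1, h2.trans hc, fun B M => ?_⟩
  obtain ⟨A, h4, h5⟩ := h3 B M
  refine ⟨A, fun p ω => (h4 p ω).trans (mul_le_mul_of_nonneg_right hc B.2), fun p hp => ?_⟩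
  rcases le_total M 0 with hM | hM
  · exact (mul_nonpos_of_nonneg_of_nonpos hα0 hM).trans (integral_nonneg fun _ => Nat.cast_nonneg _)
  · exact (mul_le_mul_of_nonneg_right hα hM).trans (h5 p hp)

end SchedPack

theorem mainTheorem9 :
    ∃ κ : ℝ, 0 < κ ∧ ∃ C : ℝ, 1 ≤ C ∧
      ∀ (m n r : ℕ), 2 ≤ m →
      ∀ (N : Fin m → (Fin n × Fin r → ℝ) → ℝ), (∀ i, SchedPack.IsMonotoneNorm (N i)) →
      ∀ (α c : ℝ), (∀ i, SchedPack.NormPackSolvable (N i) α c) →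
      ∀ (w : Fin m → ℝ), (∀ i, 0 < w i) →
        (∀ g : (Fin m → ℝ) → ℝ, SchedPack.IsMonotoneNorm g → SchedPack.IsSymmetric g →
          SchedPack.SchedPackSolvable (SchedPack.weighted w g) N
            (κ * α / Real.log m ^ 2) (C * c)) ∧
        (∀ p : ENNReal, 1 ≤ p →
          SchedPack.SchedPackSolvable (SchedPack.weighted w (SchedPack.ellpNorm p)) N
            (κ * α / Real.log m) (C * c)) ∧
        (∀ k : ℕ, 1 ≤ k → k ≤ m →
          SchedPack.SchedPackSolvable (SchedPack.weighted w (SchedPack.topKNorm k)) N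
            (κ * α / Real.log m) (C * c)) := by
  refine ⟨1 / 207360, by norm_num, 13, by norm_num, ?_⟩
  intro m n r hm N hN α c hs w hw
  obtain ⟨hα, -, hc, -⟩ := hs ⟨0, by omega⟩
  have hlog : 0 < Real.log m := by linarith [SchedPack.one_half_le_log hm]
  have hle : 1 / 207360 * α / Real.log m ≤ 1 / 10800 * α / Real.log m :=
    div_le_div_of_nonneg_right (mul_le_mul_of_nonneg_right (by norm_num) hα) hlog.le
  refine ⟨fun g hg hsym => ?_, fun p hp => ?_, fun k hk _ => ?_⟩
  · exact (SchedPack.solvable_of_isSymmetric hm hg hsym hw hN hs).mono (by positivity) le_rfl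
      (by linarith)
  · exact (SchedPack.solvable_ellpNorm hm hp hw hN hs).mono (by positivity) hle le_rfl
  · exact (SchedPack.solvable_topKNorm hm hk hw hN hs).mono (by positivity) hle le_rfl
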